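/- **Setting.** "Positive definite" for a real square matrix $M$ means $x^\top Mx>0$ for $x\neq0$. Let $\mathcal I=[t_0,t_1]$. *Discretisation.* Let $\Omega\subset\mathbb R^3$ be open, $\Omega_c\subset\Omega$ measurable (the conductor), let $(w_k)$ (edge fields) and $(f_l)$ (face fields) be finite families of vector fields in $L^2(\Omega)^3$, each linearly independent, and let $C$, $\tilde S$ be the discrete curl and divergence. They come from a Finite Element sequence (there are $n_j\in L^2(\Omega)$ with weak gradient $-\sum_k\tilde S_{jk}w_k$, and $w_k$ has weak curl $\sum_l C_{lk}f_l$) or from the Finite Integration Technique ($-\tilde S^\top$, $C$ are the edge/node and face/edge incidence matrices of a grid). Boundary conditions are imposed, so that $\ker\tilde S^\top=\{0\}$. *Materials.* At each point $B=f_{BH}(H)=\mu(H)H$, where either $f_{BH}(s)=ms$ with $m>0$, or $f_{BH}\in C^1([0,\infty))$, $f_{BH}(0)=0$, $f_{BH}'\ge\mu_0$ on $(0,\infty)$ and $f_{BH}'(s)\to\mu_0>0$ as $s\to\infty$; measurably in space, and with $f_{BH}'$ bounded above and away from $0$ uniformly in space. $\nu$ is the reluctivity, $H=\nu(B)B=f_{BH}^{-1}(B)$.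 The conductivity $\sigma$ vanishes outside $\Omega_c$ and is bounded above and away from $0$ on $\Omega_c$; $\rho=1/\sigma$. Put $(M_\mu(h))_{ij}=\int_\Omega\mu(|u|)\,w_i\cdot w_j$ and $(M_{\mu,d}(h))_{ij}=\int_\Omega w_i\cdot\big(\mu(|u|)I+\tfrac{\mu'(|u|)}{|u|}uu^\top\big)w_j$ with $u=\sum_kh_kw_k$; $(M_\nu(b))_{ij}=\int_\Omega\nu(|\sum_lb_lf_l|)f_i\cdot f_j$; $(M_\sigma)_{ij}=\int_\Omega\sigma w_i\cdot w_j$; $(M_\rho)_{ij}=\int_{\Omega_c}\rho f_i\cdot f_j$. *Gauged T-$\Omega$ system*, with $x_\lambda=(t_{red},\Psi)$, current $i_s$, voltage $v_s$ and $h=Pt_{red}+\tilde S^\top\Psi+Y_si_s$: $$P^\top C^\top M_\rho CP\,t_{red}+P^\top M_{\mu,d}(h)h'=0,\qquad \tilde SM_\mu(h)h=0,\qquad Y_s^\top M_{\mu,d}(h)h'-v_s=0,$$ where $P$, $Y_s$ are real matrices (gauge, discrete source field) such that $\det(P^\top C^\top M_\rho CP)\ne0$ and $0\ne CY_sx\ne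 CPy$ for all $x,y\ne0$, and $M_{\mu,d}$ is a $C^1$ function of $h$. *Gauged A\* system*, with $x_\lambda=a_{red}$ and $b=CPa_{red}$: $$\bar M_\sigma a_{red}'+P^\top C^\top M_\nu(b)b-\bar X_si_s=0,\qquad \bar X_s^\top a_{red}'-v_s=0,$$ where $P$ is a real matrix (gauge, in general different from the one above), $\bar M_\sigma=P^\top M_\sigma P$, $\bar X_s=P^\top X_s$, $(X_s)_{kr}=\int_\Omega\chi_r\cdot w_k$ for winding functions $\chi_r\in L^2(\Omega)^3$, such that $\lambda\bar M_\sigma+P^\top C^\top M_\nu(b)CP$ is positive definite for all $\lambda>0$ and all $b=CPa$, $\bar X_s$ has full column rank, and $\operatorname{im}\bar X_s\perp\operatorname{im}\bar M_\sigma$. *Inductance-like element.* A differentiable element DAE $F(x',i',x,i,v,t)=0$ is inductance-like if there are continuous $f_x,f_\phi$ and a $C^1$ function $\phi$ such that $F=0$ and $\frac{d}{dt}F=0$ together imply $x'=f_x(x,i,v,t)$ and $\frac{d}{dt}\phi(i,x,t)=f_\phi(x,i,v,t)$ for $t\in\mathcal I$, where $\partial\phi/\partial i$ is regular and $\frac{\partial}{\partial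 v}\big((\frac{\partial\phi}{\partial i})^{-1}(-\frac{\partial\phi}{\partial x}f_x-\frac{\partial\phi}{\partial t}+f_\phi)\big)$ exists and is positive definite. *Linear index-2 components.* A DAE $F(z',z,t)=0$, differentiable in $(z',z)$, has linear index-2 components on $\mathcal I$ if, for all $t\in\mathcal I$ and all $(z',z)$, with $A=\partial F/\partial z'$, $B_z=\partial F/\partial z$: (a) its index is at most two, in the sense that $Aw_0=0$, $Aw_1+B_zw_0=0$, $Aw_2+B_zw_1=0$ imply $w_0=0$; and (b) there are a constant projector $T$ and a constant linear map $B$, independent of $(z',z,t)$, such that $\operatorname{im}T=\{w: Aw=0,\ B_zw\in\operatorname{im}A\}$ (the index-2 components: the directions of $z'$ left undetermined after one differentiation) and $F(z',z,t)=F(z',(I-T)z,t)+BTz$. *Circuit.* For a circuit with reduced incidence matrices $A_C,A_R,A_L,A_V,A_I,A_\lambda$ of a directed graph, the coupled system in the unknowns $(e,i_L,i_V,x_\lambda,i_\lambda)$ is $$A_C\tfrac{d}{dt}q(A_C^\top e,t)+A_Rg(A_R^\top e,t)+A_Li_L+A_Vi_V+A_\lambda i_\lambda+A_Ii_{src}(t)=0,$$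 $$\tfrac{d}{dt}\phi_L(i_L,t)-A_L^\top e=0,\qquad A_V^\top e-v_{src}(t)=0,\qquad F(x_\lambda',i_\lambda',x_\lambda,i_\lambda,A_\lambda^\top e,t)=0.$$ It is well posed if $\ker(A_R\ A_C\ A_V\ A_L\ A_\lambda)^\top=\{0\}$, $\ker A_V=\{0\}$, $q,\phi_L$ are $C^2$, $g,i_{src},v_{src}$ are $C^1$, and the Jacobians of $q$, $g$, $\phi_L$ with respect to their first arguments are positive definite for all $t\in\mathcal I$. **Proposition (Linear index-2 components for A\* and T-$\Omega$).** Let $F$ be the DAE of the gauged T-$\Omega$ system or of the gauged A\* system, with linear or field-dependent materials, as above. Then $F$ is an inductance-like element, and the voltage enters it linearly: $F(x',i',x,i,v,t)=\tilde F(x',i',x,i,t)+Bv$ with a constant matrix $B$. Moreover, for every well-posed circuit, the coupled system has linear index-2 components on $\mathcal I$. -/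

import Mathlib

open MeasureTheory Set Filter Topology Matrix

noncomputable section

namespace FieldCircuit

/-! ### Differential algebraic equations -/

/-- Positive definiteness of a (not necessarily symmetric) real matrix. -/
def IsPosDef {n : Type*} [Fintype n] (M : Matrix n n ℝ) : Prop :=
  ∀ x : n → ℝ, x ≠ 0 → 0 < x ⬝ᵥ (M *ᵥ x)

section DAE

variable {Z W : Type*} [NormedAddCommGroup Z] [NormedSpace ℝ Z]
  [NormedAddCommGroup W] [NormedSpace ℝ W]

/-- The Jacobian `∂F/∂z'` of a DAE `F(z', z, t) = 0` at `(y, z, t)`. -/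
def jacDot (F : Z → Z → ℝ → W) (y z : Z) (t : ℝ) : Z →L[ℝ] W :=
  fderiv ℝ (fun y' => F y' z t) y

/-- The Jacobian `∂F/∂z` of a DAE `F(z', z, t) = 0` at `(y, z, t)`. -/
def jac (F : Z → Z → ℝ → W) (y z : Z) (t : ℝ) : Z →L[ℝ] W :=
  fderiv ℝ (fun z' => F y z' t) z

/-- The space `N ∩ S₀` of index-2 components of `F(z', z, t) = 0` at `(y, z, t)`, where
`N = ker ∂F/∂z'` and `S₀ = {w | (∂F/∂z) w ∈ im ∂F/∂z'}`. These are the directions `w` of `z'`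
that are left undetermined by the (linearised) equations `F = 0`, `(d/dt) F = 0`, that is,
after one differentiation. -/
def indexTwoSpace (F : Z → Z → ℝ → W) (y z : Z) (t : ℝ) : Submodule ℝ Z :=
  LinearMap.ker (jacDot F y z t : Z →ₗ[ℝ] W) ⊓
    (LinearMap.range (jacDot F y z t : Z →ₗ[ℝ] W)).comap (jac F y z t : Z →ₗ[ℝ] W)

/-- No direction of `z'` is left undetermined by the linearised equations after two
differentiations: the local matrix pencil `(∂F/∂z', ∂F/∂z)` has index at most two. -/
def LocalIndexAtMostTwo (F : Z → Z → ℝ → W) (y z : Z) (t : ℝ) : Prop :=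
  ∀ w₀ w₁ w₂ : Z, jacDot F y z t w₀ = 0 → jacDot F y z t w₁ + jac F y z t w₀ = 0 →
    jacDot F y z t w₂ + jac F y z t w₁ = 0 → w₀ = 0

/-- A DAE `F(z', z, t) = 0`, `t ∈ I`, with linear index-2 components: its index does not exceed
two, the space of index-2 components is the range of a constant projector `T`, and the
index-2 components `T z` enter the equations linearly with a constant coefficient,
`F(z', z, t) = F(z', (1 - T) z, t) + B T z`. -/
def HasLinearIndexTwoComponents (I : Set ℝ) (F : Z → Z → ℝ → W) : Prop :=
  (∀ t ∈ I, Differentiable ℝ (fun p : Z × Z => F p.1 p.2 t)) ∧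
  (∀ t ∈ I, ∀ y z : Z, LocalIndexAtMostTwo F y z t) ∧
  ∃ (T : Z →ₗ[ℝ] Z) (B : Z →ₗ[ℝ] W),
    (∀ z, T (T z) = T z) ∧
    (∀ t ∈ I, ∀ y z : Z, LinearMap.range T = indexTwoSpace F y z t) ∧
    (∀ t ∈ I, ∀ y z : Z, F y z t = F y (z - T z) t + B (T z))

end DAE

/-! ### Inductance-like elements -/

/-- The residual `F(x', i', x, i, v, t)` of the DAE of a circuit element with internal variables
`x : ι → ℝ`, branch currents `i : κ → ℝ` and branch voltages `v : κ → ℝ`. -/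
abbrev ElementDAE (ι κ : Type*) : Type _ :=
  (ι → ℝ) → (κ → ℝ) → (ι → ℝ) → (κ → ℝ) → (κ → ℝ) → ℝ → (ι ⊕ κ → ℝ)

/-- Inductance-like element on the time interval `I`. The equations `F = 0` and `(d/dt) F = 0`
are imposed at a time `t` along an arbitrary smooth trajectory, so only the values at `t` of the
trajectory and of its derivatives, subject to these two equations, enter. -/
def IsInductanceLike {ι κ : Type*} [Fintype ι] [Fintype κ] (I : Set ℝ) (F : ElementDAE ι κ) :
    Prop :=
  Differentiable ℝ (fun p : (ι → ℝ) × (κ → ℝ) × (ι → ℝ) × (κ → ℝ) × (κ → ℝ) × ℝ =>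
    F p.1 p.2.1 p.2.2.1 p.2.2.2.1 p.2.2.2.2.1 p.2.2.2.2.2) ∧
  ∃ (fx : (ι → ℝ) → (κ → ℝ) → (κ → ℝ) → ℝ → (ι → ℝ))
    (φ : (κ → ℝ) → (ι → ℝ) → ℝ → (κ → ℝ))
    (fφ : (ι → ℝ) → (κ → ℝ) → (κ → ℝ) → ℝ → (κ → ℝ)),
    Continuous (fun p : (ι → ℝ) × (κ → ℝ) × (κ → ℝ) × ℝ => fx p.1 p.2.1 p.2.2.1 p.2.2.2) ∧
    Continuous (fun p : (ι → ℝ) × (κ → ℝ) × (κ → ℝ) × ℝ => fφ p.1 p.2.1 p.2.2.1 p.2.2.2) ∧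
    ContDiff ℝ 1 (fun p : (κ → ℝ) × (ι → ℝ) × ℝ => φ p.1 p.2.1 p.2.2) ∧
    -- one differentiation yields the differential equations for `x` and `φ(i, x, t)`
    (∀ (x : ℝ → ι → ℝ) (i v : ℝ → κ → ℝ), ContDiff ℝ 2 x → ContDiff ℝ 2 i → ContDiff ℝ 1 v →
      ∀ t ∈ I,
        F (deriv x t) (deriv i t) (x t) (i t) (v t) t = 0 →
        HasDerivAt (fun τ => F (deriv x τ) (deriv i τ) (x τ) (i τ) (v τ) τ) 0 t →
        HasDerivAt x (fx (x t) (i t) (v t) t) t ∧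
        HasDerivAt (fun τ => φ (i τ) (x τ) τ) (fφ (x t) (i t) (v t) t) t) ∧
    (∀ (i : κ → ℝ) (x : ι → ℝ), ∀ t ∈ I,
      -- `∂φ/∂i` is regular
      (fderiv ℝ (fun i' => φ i' x t) i).IsInvertible ∧
      -- `∂/∂v ((∂φ/∂i)⁻¹ (- ∂φ/∂x f_x - ∂φ/∂t + f_φ))` is positive definite
      ∀ v : κ → ℝ, ∃ D : (κ → ℝ) →L[ℝ] (κ → ℝ),
        HasFDerivAt (fun v' : κ → ℝ =>
          (fderiv ℝ (fun i' => φ i' x t) i).inverse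
            (-(fderiv ℝ (fun x' => φ i x' t) x (fx x i v' t))
              - deriv (fun t' => φ i x t') t + fφ x i v' t)) D v ∧
        ∀ w : κ → ℝ, w ≠ 0 → 0 < w ⬝ᵥ D w)

/-- The voltage enters the DAE of the element linearly:
`F(x', i', x, i, v, t) = F̃(x', i', x, i, t) + B v` with a constant matrix `B`. -/
def IsVoltageLinear {ι κ : Type*} [Fintype κ] (F : ElementDAE ι κ) : Prop :=
  ∃ (Ft : (ι → ℝ) → (κ → ℝ) → (ι → ℝ) → (κ → ℝ) → ℝ → (ι ⊕ κ → ℝ)) (B : Matrix (ι ⊕ κ) κ ℝ),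
    ∀ x' i' x i v t, F x' i' x i v t = Ft x' i' x i t + B *ᵥ v

/-! ### Circuits in modified nodal analysis -/

/-- Reduced incidence matrix of a family of directed branches `b ↦ (tail, head)`; `none` is the
reference (mass) node. -/
def incidence {Nd β : Type*} [DecidableEq Nd] (br : β → Option Nd × Option Nd) :
    Matrix Nd β ℝ :=
  fun n b => (if (br b).1 = some n then 1 else 0) - (if (br b).2 = some n then 1 else 0)

/-- A circuit: a directed graph on the nodes `Option Nd` whose branches are capacitors,
resistors, inductors, voltage sources, current sources and generalised elements (indexed by
`Cap`, `Res`, `Ind`, `Vol`, `Cur`, `κ`), with the constitutive functions of its lumped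
elements. -/
structure Circuit (Nd Cap Res Ind Vol Cur κ : Type*) where
  brC : Cap → Option Nd × Option Nd
  brR : Res → Option Nd × Option Nd
  brL : Ind → Option Nd × Option Nd
  brV : Vol → Option Nd × Option Nd
  brI : Cur → Option Nd × Option Nd
  brLam : κ → Option Nd × Option Nd
  /-- charges `q(v_C, t)` -/
  q : (Cap → ℝ) × ℝ → (Cap → ℝ)
  /-- resistive currents `g(v_R, t)` -/
  g : (Res → ℝ) × ℝ → (Res → ℝ)
  /-- fluxes `φ_L(i_L, t)` -/
  phiL : (Ind → ℝ) × ℝ → (Ind → ℝ)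
  isrc : ℝ → Cur → ℝ
  vsrc : ℝ → Vol → ℝ

section Circuit

variable {Nd Cap Res Ind Vol Cur κ ι : Type*} [Fintype Nd] [DecidableEq Nd] [Fintype Cap]
  [Fintype Res] [Fintype Ind] [Fintype Vol] [Fintype Cur] [Fintype κ] [Fintype ι]

/-- Well-posedness of the circuit on the time interval `I`, together with the smoothness of its
constitutive functions. -/
structure Circuit.WellPosed (ckt : Circuit Nd Cap Res Ind Vol Cur κ) (I : Set ℝ) : Prop where
  smooth_q : ContDiff ℝ 2 ckt.q
  smooth_g : ContDiff ℝ 1 ckt.g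
  smooth_phiL : ContDiff ℝ 2 ckt.phiL
  smooth_isrc : ContDiff ℝ 1 ckt.isrc
  smooth_vsrc : ContDiff ℝ 1 ckt.vsrc
  /-- no cutsets of current sources: `ker (A_R A_C A_V A_L A_λ)ᵀ = {0}` -/
  no_cutset : ∀ e : Nd → ℝ, (incidence ckt.brR)ᵀ *ᵥ e = 0 → (incidence ckt.brC)ᵀ *ᵥ e = 0 →
    (incidence ckt.brV)ᵀ *ᵥ e = 0 → (incidence ckt.brL)ᵀ *ᵥ e = 0 →
    (incidence ckt.brLam)ᵀ *ᵥ e = 0 → e = 0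
  /-- no loops of voltage sources: `ker A_V = {0}` -/
  no_loop : ∀ i : Vol → ℝ, incidence ckt.brV *ᵥ i = 0 → i = 0
  posDef_G : ∀ v, ∀ t ∈ I, ∀ w : Res → ℝ, w ≠ 0 →
    0 < w ⬝ᵥ fderiv ℝ (fun v' => ckt.g (v', t)) v w
  posDef_L : ∀ i, ∀ t ∈ I, ∀ w : Ind → ℝ, w ≠ 0 →
    0 < w ⬝ᵥ fderiv ℝ (fun i' => ckt.phiL (i', t)) i w
  posDef_C : ∀ v, ∀ t ∈ I, ∀ w : Cap → ℝ, w ≠ 0 →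
    0 < w ⬝ᵥ fderiv ℝ (fun v' => ckt.q (v', t)) v w

/-- The unknowns `(e, i_L, i_V, x_λ, i_λ)` of the coupled system. -/
abbrev CoupledVar (Nd Ind Vol ι κ : Type*) : Type _ :=
  (Nd → ℝ) × (Ind → ℝ) × (Vol → ℝ) × (ι → ℝ) × (κ → ℝ)

/-- The equations of the coupled system: Kirchhoff's current law, inductors, voltage sources,
generalised element. -/
abbrev CoupledEq (Nd Ind Vol ι κ : Type*) : Type _ :=
  (Nd → ℝ) × (Ind → ℝ) × (Vol → ℝ) × (ι ⊕ κ → ℝ)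

/-- The residual of the MNA equations coupled to a generalised element with DAE `F`, via
`v_λ = A_λᵀ e`. The derivatives `(d/dt) q(A_Cᵀ e, t)` and `(d/dt) φ_L(i_L, t)` are expanded by
the chain rule; `y = z'`. -/
def coupledDAE (ckt : Circuit Nd Cap Res Ind Vol Cur κ) (F : ElementDAE ι κ) :
    CoupledVar Nd Ind Vol ι κ → CoupledVar Nd Ind Vol ι κ → ℝ → CoupledEq Nd Ind Vol ι κ :=
  fun y z t =>
    let e := z.1
    let iL := z.2.1
    let iV := z.2.2.1
    let x := z.2.2.2.1
    let iLam := z.2.2.2.2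
    let e' := y.1
    let iL' := y.2.1
    let x' := y.2.2.2.1
    let iLam' := y.2.2.2.2
    let AC := incidence ckt.brC
    let AR := incidence ckt.brR
    let AL := incidence ckt.brL
    let AV := incidence ckt.brV
    let AI := incidence ckt.brI
    let ALam := incidence ckt.brLam
    (AC *ᵥ (fderiv ℝ ckt.q (ACᵀ *ᵥ e, t) (ACᵀ *ᵥ e', 1)) + AR *ᵥ ckt.g (ARᵀ *ᵥ e, t)
        + AL *ᵥ iL + AV *ᵥ iV + ALam *ᵥ iLam + AI *ᵥ ckt.isrc t,
     fderiv ℝ ckt.phiL (iL, t) (iL', 1) - ALᵀ *ᵥ e,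
     AVᵀ *ᵥ e - ckt.vsrc t,
     F x' iLam' x iLam (ALamᵀ *ᵥ e) t)

end Circuit

/-! ### Space discretisation -/

/-- Physical space, with the Euclidean norm. -/
abbrev R3 : Type := EuclideanSpace ℝ (Fin 3)

/-- Partial derivative in the `i`-th coordinate direction. -/
def pderiv (i : Fin 3) (u : R3 → ℝ) (p : R3) : ℝ :=
  fderiv ℝ u p (EuclideanSpace.single i 1)

/-- Classical curl of a smooth vector field. -/
def curl (u : R3 → R3) (p : R3) : R3 :=
  !₂[pderiv 1 (fun r => u r 2) p - pderiv 2 (fun r => u r 1) p,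
     pderiv 2 (fun r => u r 0) p - pderiv 0 (fun r => u r 2) p,
     pderiv 0 (fun r => u r 1) p - pderiv 1 (fun r => u r 0) p]

/-- `g` is the weak gradient of `u` in `Ω`. -/
def HasWeakGrad (Ω : Set R3) (u : R3 → ℝ) (g : R3 → R3) : Prop :=
  ∀ η : R3 → ℝ, ContDiff ℝ (⊤ : ℕ∞) η → HasCompactSupport η → tsupport η ⊆ Ω →
    ∀ i : Fin 3, ∫ p in Ω, u p * pderiv i η p = -∫ p in Ω, g p i * η p

/-- `g` is the weak curl of `u` in `Ω`. -/
def HasWeakCurl (Ω : Set R3) (u g : R3 → R3) : Prop :=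
  ∀ η : R3 → R3, ContDiff ℝ (⊤ : ℕ∞) η → HasCompactSupport η → tsupport η ⊆ Ω →
    ∫ p in Ω, inner ℝ (u p) (curl η p) = ∫ p in Ω, inner ℝ (g p) (η p)

section Discretisation

variable {Nn Ed Fa : Type*} [Fintype Nn] [Fintype Ed] [Fintype Fa]

/-- Finite Element exact sequence: for suitable nodal basis functions `n_j`, the matrices `-Sᵀ`
and `C` represent the gradient from nodal to edge functions and the curl from edge to face
functions. -/
def IsFiniteElementSequence (Ω : Set R3) (edge : Ed → R3 → R3) (face : Fa → R3 → R3)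
    (C : Matrix Fa Ed ℝ) (S : Matrix Nn Ed ℝ) : Prop :=
  (∃ nodal : Nn → R3 → ℝ, ∀ j, MemLp (nodal j) 2 (volume.restrict Ω) ∧
    HasWeakGrad Ω (nodal j) (fun p => -∑ k, S j k • edge k p)) ∧
  ∀ k, HasWeakCurl Ω (edge k) (fun p => ∑ l, C l k • face l p)

/-- Finite Integration Technique: `-Sᵀ` and `C` are the incidence matrices of the edges and faces
of a grid. An edge runs from `tail` to `head` (`none` stands for the nodes eliminated by the
boundary conditions); the boundary of the face `l` is the closed walk of the directed edges
`step l 0, …, step l (len l)`, where `true` means that the edge is traversed from tail to head. -/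
def IsGridIncidence (C : Matrix Fa Ed ℝ) (S : Matrix Nn Ed ℝ) : Prop :=
  ∃ (tail head : Ed → Option Nn) (len : Fa → ℕ) (step : ∀ l, Fin (len l + 1) → Ed × Bool),
    (∀ l m, (if (step l m).2 then head (step l m).1 else tail (step l m).1) =
      (if (step l (m + 1)).2 then tail (step l (m + 1)).1 else head (step l (m + 1)).1)) ∧
    (∀ j k, -S j k = (open Classical in
      (if head k = some j then 1 else 0) - (if tail k = some j then 1 else 0) : ℝ)) ∧
    (∀ l k, C l k = ∑ m, (open Classical in
      if (step l m).1 = k then (if (step l m).2 then 1 else -1) else 0 : ℝ))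

variable (Nn Ed Fa)

/-- A suitable space discretisation on the domain `Ω` with conducting subdomain `Ωc`, by linearly
independent square integrable edge and face fields. The discrete curl `C`, gradient `-Sᵀ` and
divergence `S` are those of a Finite Element sequence or of a Finite Integration grid. -/
structure Discretisation where
  Ω : Set R3
  Ωc : Set R3
  isOpen : IsOpen Ω
  measurableSet_c : MeasurableSet Ωc
  subset : Ωc ⊆ Ω
  edge : Ed → R3 → R3
  face : Fa → R3 → R3
  memLp_edge : ∀ k, MemLp (edge k) 2 (volume.restrict Ω)
  memLp_face : ∀ l, MemLp (face l) 2 (volume.restrict Ω)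
  indep_edge : ∀ c : Ed → ℝ, (∀ᵐ p ∂(volume.restrict Ω), ∑ k, c k • edge k p = 0) → c = 0
  indep_face : ∀ c : Fa → ℝ, (∀ᵐ p ∂(volume.restrict Ω), ∑ l, c l • face l p = 0) → c = 0
  /-- discrete curl -/
  C : Matrix Fa Ed ℝ
  /-- discrete divergence -/
  S : Matrix Nn Ed ℝ
  deRham : IsFiniteElementSequence Ω edge face C S ∨ IsGridIncidence C S
  /-- the boundary conditions are imposed, so the discrete gradient has full column rank -/
  grad_injective : ∀ ψ : Nn → ℝ, Sᵀ *ᵥ ψ = 0 → ψ = 0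

end Discretisation

/-! ### Materials -/

/-- The secant coefficient `s ↦ g(s) / s` of a curve `g` with `g(0) = 0`, continued to `s = 0` by
`g'(0)`. -/
def secant (g : ℝ → ℝ) (s : ℝ) : ℝ :=
  if s = 0 then derivWithin g (Ici 0) 0 else g s / s

/-- Natural assumptions on a B-H curve `f(H) = μ(H) H`; `μ₀` is the vacuum permeability. -/
structure IsBHCurve (μ₀ : ℝ) (f : ℝ → ℝ) : Prop where
  contDiffOn : ContDiffOn ℝ 1 f (Ici 0)
  zero : f 0 = 0
  le_deriv : ∀ s, 0 < s → μ₀ ≤ deriv f s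
  tendsto : Tendsto (deriv f) atTop (𝓝 μ₀)

/-- Material data on a domain: the magnetisation curve `B = bh p H` at each point `p`, either
a nonlinear B-H curve or a linear law, and the conductivity `σ`, positive on `Ωc` and zero
elsewhere. The uniform bounds in `p` make the material matrices finite. -/
structure Material (Ω Ωc : Set R3) where
  μ₀ : ℝ
  μ₀_pos : 0 < μ₀
  bh : R3 → ℝ → ℝ
  measurable_bh : Measurable (Function.uncurry bh)
  isBH : ∀ p ∈ Ω, IsBHCurve μ₀ (bh p) ∨ ∃ m : ℝ, 0 < m ∧ ∀ s, 0 ≤ s → bh p s = m * s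
  bounds : ∃ lo hi : ℝ, 0 < lo ∧ ∀ p ∈ Ω, ∀ s, 0 < s → lo ≤ deriv (bh p) s ∧ deriv (bh p) s ≤ hi
  σ : R3 → ℝ
  measurable_σ : Measurable σ
  σ_bounds : ∃ lo hi : ℝ, 0 < lo ∧ ∀ p ∈ Ωc, lo ≤ σ p ∧ σ p ≤ hi
  σ_zero : ∀ p ∉ Ωc, σ p = 0

namespace Material

variable {Ω Ωc : Set R3}

/-- Permeability `μ(H)` at `p`, with `B = μ(H) H`. -/
def mu (mat : Material Ω Ωc) (p : R3) : ℝ → ℝ := secant (mat.bh p)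

/-- Reluctivity `ν(B)` at `p`, with `H = ν(B) B` the inverse of the B-H curve. -/
def nu (mat : Material Ω Ωc) (p : R3) : ℝ → ℝ :=
  secant (Function.invFunOn (mat.bh p) (Ici 0))

end Material

/-- Differential material tensor `κ(|s|) 1 + (1/|s|) κ'(|s|) s sᵀ`, applied to `v`. -/
def diffTensor (kap : ℝ → ℝ) (s v : R3) : R3 :=
  kap ‖s‖ • v + (‖s‖⁻¹ * deriv kap ‖s‖ * inner ℝ s v) • s

/-- The field `∑ c_k b_k` with coefficients `c`. -/
def fieldOf {n : Type*} [Fintype n] (b : n → R3 → R3) (c : n → ℝ) (p : R3) : R3 :=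
  ∑ k, c k • b k p

/-- Material matrix `∫_G κ b_i · b_j` of a coefficient depending on space only. -/
def linMatrix {n : Type*} (G : Set R3) (b : n → R3 → R3) (kap : R3 → ℝ) : Matrix n n ℝ :=
  fun i j => ∫ p in G, kap p * inner ℝ (b i p) (b j p)

/-- Material matrix `∫_G κ(|u|) b_i · b_j` at the discrete field `u = ∑ c_k b_k`. -/
def matMatrix {n : Type*} [Fintype n] (G : Set R3) (b : n → R3 → R3) (kap : R3 → ℝ → ℝ)
    (c : n → ℝ) : Matrix n n ℝ :=
  fun i j => ∫ p in G, kap p ‖fieldOf b c p‖ * inner ℝ (b i p) (b j p)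

/-- Differential material matrix `∫_G b_i · κ_d(u) b_j` at the discrete field `u = ∑ c_k b_k`. -/
def diffMatMatrix {n : Type*} [Fintype n] (G : Set R3) (b : n → R3 → R3) (kap : R3 → ℝ → ℝ)
    (c : n → ℝ) : Matrix n n ℝ :=
  fun i j => ∫ p in G, inner ℝ (b i p) (diffTensor (kap p) (fieldOf b c p) (b j p))

/-! ### The two formulations -/

namespace Discretisation

variable {Nn Ed Fa Rd κ : Type*} [Fintype Nn] [Fintype Ed] [Fintype Fa] [Fintype Rd] [Fintype κ]
variable (D : Discretisation Nn Ed Fa)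

/-- `M_μ(h)` -/
def Mmu (mat : Material D.Ω D.Ωc) : (Ed → ℝ) → Matrix Ed Ed ℝ := matMatrix D.Ω D.edge mat.mu

/-- `M_{μ,d}(h)` -/
def Mmud (mat : Material D.Ω D.Ωc) : (Ed → ℝ) → Matrix Ed Ed ℝ :=
  diffMatMatrix D.Ω D.edge mat.mu

/-- `M_ν(b)` -/
def Mnu (mat : Material D.Ω D.Ωc) : (Fa → ℝ) → Matrix Fa Fa ℝ := matMatrix D.Ω D.face mat.nu

/-- `M_σ` -/
def Msigma (mat : Material D.Ω D.Ωc) : Matrix Ed Ed ℝ := linMatrix D.Ω D.edge mat.σ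

/-- `M_ρ`, with the resistivity `ρ = 1/σ` on the conducting domain. -/
def Mrho (mat : Material D.Ω D.Ωc) : Matrix Fa Fa ℝ :=
  linMatrix D.Ωc D.face (fun p => (mat.σ p)⁻¹)

/-- Discretised winding functions `(X_s)_{k r} = ∫_Ω χ_r · b_k`. -/
def Xs (χ : κ → R3 → R3) : Matrix Ed κ ℝ :=
  fun k r => ∫ p in D.Ω, inner ℝ (χ r p) (D.edge k p)

/-- Assumptions on the gauged T-Ω formulation with gauging matrix `P` and discrete source winding
fields `Y_s`: `K_ρ = Pᵀ Cᵀ M_ρ C P` is regular, `0 ≠ C Y_s x ≠ C P y` for `x, y ≠ 0`, and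
the differential material matrix is sufficiently smooth. -/
structure TOmegaGauge [DecidableEq Rd] (mat : Material D.Ω D.Ωc) (P : Matrix Ed Rd ℝ)
    (Y : Matrix Ed κ ℝ) : Prop where
  regular : (Pᵀ * D.Cᵀ * D.Mrho mat * D.C * P).det ≠ 0
  curl_source : ∀ x : κ → ℝ, x ≠ 0 → D.C *ᵥ (Y *ᵥ x) ≠ 0 ∧
    ∀ y : Rd → ℝ, y ≠ 0 → D.C *ᵥ (Y *ᵥ x) ≠ D.C *ᵥ (P *ᵥ y)
  smooth : ∀ i j, ContDiff ℝ 1 (fun h => D.Mmud mat h i j)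

/-- The gauged T-Ω system with `x_λ = (t_red, Ψ)` and `h = P t_red + Sᵀ Ψ + Y_s i_s`. -/
def tOmega (mat : Material D.Ω D.Ωc) (P : Matrix Ed Rd ℝ) (Y : Matrix Ed κ ℝ) :
    ElementDAE (Rd ⊕ Nn) κ :=
  fun x' i' x i v _ =>
    let h : Ed → ℝ := P *ᵥ (x ∘ Sum.inl) + D.Sᵀ *ᵥ (x ∘ Sum.inr) + Y *ᵥ i
    let h' : Ed → ℝ := P *ᵥ (x' ∘ Sum.inl) + D.Sᵀ *ᵥ (x' ∘ Sum.inr) + Y *ᵥ i'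
    Sum.elim
      (Sum.elim
        ((Pᵀ * D.Cᵀ * D.Mrho mat * D.C * P) *ᵥ (x ∘ Sum.inl) + Pᵀ *ᵥ (D.Mmud mat h *ᵥ h'))
        (D.S *ᵥ (D.Mmu mat h *ᵥ h)))
      (Yᵀ *ᵥ (D.Mmud mat h *ᵥ h') - v)

/-- Assumptions on the gauged A* formulation with gauging matrix `P` and winding functions `χ`:
the pencil `λ M̄_σ + K_ν` is positive definite for `λ > 0`, and `X̄_s = Pᵀ X_s` has full column
rank and `im X̄_s ⟂ im M̄_σ`. -/
structure AStarGauge (mat : Material D.Ω D.Ωc) (P : Matrix Ed Rd ℝ) (χ : κ → R3 → R3) :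
    Prop where
  memLp : ∀ r, MemLp (χ r) 2 (volume.restrict D.Ω)
  pencil : ∀ (a : Rd → ℝ) (lam : ℝ), 0 < lam →
    IsPosDef (lam • (Pᵀ * D.Msigma mat * P) +
      Pᵀ * D.Cᵀ * D.Mnu mat (D.C *ᵥ (P *ᵥ a)) * D.C * P)
  rank : ∀ i : κ → ℝ, (Pᵀ * D.Xs χ) *ᵥ i = 0 → i = 0
  orth : ∀ (i : κ → ℝ) (a : Rd → ℝ),
    ((Pᵀ * D.Xs χ) *ᵥ i) ⬝ᵥ ((Pᵀ * D.Msigma mat * P) *ᵥ a) = 0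

/-- The gauged A* system with `x_λ = a_red` and `b = C P a_red`. -/
def aStar (mat : Material D.Ω D.Ωc) (P : Matrix Ed Rd ℝ) (χ : κ → R3 → R3) :
    ElementDAE Rd κ :=
  fun a' _ a i v _ =>
    let b : Fa → ℝ := D.C *ᵥ (P *ᵥ a)
    Sum.elim
      ((Pᵀ * D.Msigma mat * P) *ᵥ a' + (Pᵀ * D.Cᵀ) *ᵥ (D.Mnu mat b *ᵥ b) - (Pᵀ * D.Xs χ) *ᵥ i)
      ((Pᵀ * D.Xs χ)ᵀ *ᵥ a' - v)

end Discretisation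

end FieldCircuit

end

set_option linter.unusedSectionVars false

/-! The theorem is a passivity statement. Both field models store magnetic energy, and the
differential material matrices, which measure the energy of a change of the field, are positive
definite. All injectivity and sign conditions come from pairing equations with their own solutions.

Materials. If a curve has slopes in `[lo, hi]` with `lo > 0`, its secants lie in the same interval.
The differential tensor at `u` acts as the slope along `u` and as the secant across `u`, so it is
bounded and coercive uniformly in `u` and in space. Integration gives a matrix that is continuous in
the field (`continuous_diffMatMatrix`), positive definite (`diffMatMatrix_pos`), and the derivative
of `c ↦ M(c) c` (`hasFDerivAt_matMatrix`). The inverse curve has slopes in `[hi⁻¹, lo⁻¹]`, so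
reluctivities need no separate argument.

Elements. For T-Ω, differentiating the divergence equation completes a system with matrix `Gᵀ
M_{μ,d} G`, `G = (P Sᵀ Y)`. Since `C Sᵀ = 0` (`curl_mul_grad`), the gauge conditions make `G`
injective, and the matrix is positive definite. For A*, the sources lie in the kernel of the reduced
conductivity matrix. Projecting the first equation onto this kernel removes `a'`; differentiating
the result gives the missing equations, and the differential stiffness is positive definite on the
kernel. In both cases `φ = i` works, and `isInductanceLike_of_linearSystem` concludes.

Circuit. The linearised element enters only through `IsPassivePencil`. Under it the index-2 space
depends on the incidence matrices alone (`mem_circuitIndexTwoSpace_iff`), hence has a constant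
projector, and its elements are invisible to every nonlinear term. The index is at most two
(`index_le_two_of_isPassivePencil`): Kirchhoff's current law, tested with an index-2 potential,
makes a sum of an inductor energy and a field energy vanish, and the topological conditions do the
rest. -/

namespace FieldCircuit

/-! ### Magnetisation curves -/

/-- A curve on `[0, ∞)` through the origin that is continuously differentiable with slope in
`[lo, hi]`. -/
structure IsRegularCurve (lo hi : ℝ) (f : ℝ → ℝ) : Prop where
  zero : f 0 = 0
  contDiffOn : ContDiffOn ℝ 1 f (Ici 0)
  le_slope : ∀ s, 0 ≤ s → lo ≤ derivWithin f (Ici 0) s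
  slope_le : ∀ s, 0 ≤ s → derivWithin f (Ici 0) s ≤ hi

/-- The one-sided derivative is continuous up to `0`, and a closed interval contains the limits of
its points, so the bounds on the open half-line extend to the endpoint. -/
theorem isRegularCurve_of_deriv {lo hi : ℝ} {f : ℝ → ℝ} (h0 : f 0 = 0)
    (hf : ContDiffOn ℝ 1 f (Ici 0)) (hb : ∀ s, 0 < s → lo ≤ deriv f s ∧ deriv f s ≤ hi) :
    IsRegularCurve lo hi f := by
  have hc : ContinuousOn (derivWithin f (Ici 0)) (Ici 0) :=
    hf.continuousOn_derivWithin (uniqueDiffOn_Ici 0) le_rfl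
  have hpos : ∀ s, 0 < s → derivWithin f (Ici 0) s ∈ Icc lo hi := fun s hs => by
    rw [derivWithin_of_mem_nhds (Ici_mem_nhds hs)]; exact hb s hs
  have key : ∀ s, 0 ≤ s → derivWithin f (Ici 0) s ∈ Icc lo hi := by
    intro s hs
    rcases hs.eq_or_lt with rfl | hs
    · have ht : Tendsto (derivWithin f (Ici 0)) (𝓝[>] 0) (𝓝 (derivWithin f (Ici 0) 0)) :=
        (hc 0 self_mem_Ici).mono_left (nhdsWithin_mono _ Ioi_subset_Ici_self)
      exact isClosed_Icc.mem_of_tendsto ht (by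
        filter_upwards [self_mem_nhdsWithin] with s hs using hpos s hs)
    · exact hpos s hs
  exact ⟨h0, hf, fun s hs => (key s hs).1, fun s hs => (key s hs).2⟩

namespace IsRegularCurve

variable {lo hi : ℝ} {f : ℝ → ℝ}

theorem hasDerivWithinAt (hf : IsRegularCurve lo hi f) {s : ℝ} (hs : 0 ≤ s) :
    HasDerivWithinAt f (derivWithin f (Ici 0) s) (Ici 0) s :=
  ((hf.contDiffOn.differentiableOn one_ne_zero) s hs).hasDerivWithinAt

theorem hasDerivAt (hf : IsRegularCurve lo hi f) {s : ℝ} (hs : 0 < s) :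
    HasDerivAt f (derivWithin f (Ici 0) s) s :=
  (hf.hasDerivWithinAt hs.le).hasDerivAt (Ici_mem_nhds hs)

theorem continuousOn_slope (hf : IsRegularCurve lo hi f) :
    ContinuousOn (derivWithin f (Ici 0)) (Ici 0) :=
  hf.contDiffOn.continuousOn_derivWithin (uniqueDiffOn_Ici 0) le_rfl

theorem mul_sub_le (hf : IsRegularCurve lo hi f) {s t : ℝ} (hs : 0 ≤ s) (hst : s ≤ t) :
    lo * (t - s) ≤ f t - f s :=
  (convex_Ici 0).mul_sub_le_image_sub_of_le_deriv hf.contDiffOn.continuousOn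
    (fun x hx => by
      rw [interior_Ici] at hx
      exact (hf.hasDerivAt hx).differentiableAt.differentiableWithinAt)
    (fun x hx => by
      rw [interior_Ici] at hx
      rw [(hf.hasDerivAt hx).deriv]; exact hf.le_slope x (le_of_lt hx))
    s hs t (hs.trans hst) hst

theorem sub_le_mul (hf : IsRegularCurve lo hi f) {s t : ℝ} (hs : 0 ≤ s) (hst : s ≤ t) :
    f t - f s ≤ hi * (t - s) :=
  (convex_Ici 0).image_sub_le_mul_sub_of_deriv_le hf.contDiffOn.continuousOn
    (fun x hx => by
      rw [interior_Ici] at hx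
      exact (hf.hasDerivAt hx).differentiableAt.differentiableWithinAt)
    (fun x hx => by
      rw [interior_Ici] at hx
      rw [(hf.hasDerivAt hx).deriv]; exact hf.slope_le x (le_of_lt hx))
    s hs t (hs.trans hst) hst

theorem le_secant (hf : IsRegularCurve lo hi f) {s : ℝ} (hs : 0 ≤ s) : lo ≤ secant f s := by
  rcases hs.eq_or_lt with rfl | hs
  · simpa [secant] using hf.le_slope 0 le_rfl
  · have := hf.mul_sub_le le_rfl hs.le
    rw [secant, if_neg hs.ne', le_div_iff₀ hs]
    simpa [hf.zero] using this

theorem secant_le (hf : IsRegularCurve lo hi f) {s : ℝ} (hs : 0 ≤ s) : secant f s ≤ hi := by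
  rcases hs.eq_or_lt with rfl | hs
  · simpa [secant] using hf.slope_le 0 le_rfl
  · have := hf.sub_le_mul le_rfl hs.le
    rw [secant, if_neg hs.ne', div_le_iff₀ hs]
    simpa [hf.zero] using this

/-- Away from `0` this is continuity of a quotient. At `0` the secant is the difference quotient of
`f`, whose limit is the one-sided derivative chosen as the value of `secant` there. -/
theorem continuousOn_secant (hf : IsRegularCurve lo hi f) : ContinuousOn (secant f) (Ici 0) := by
  intro s hs
  rcases (show (0:ℝ) ≤ s from hs).eq_or_lt with rfl | hs
  · have h := hasDerivWithinAt_iff_tendsto_slope.1 (hf.hasDerivWithinAt le_rfl)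
    rw [ContinuousWithinAt, ← insert_sdiff_self_of_mem (self_mem_Ici (a := (0:ℝ))),
      nhdsWithin_insert, tendsto_sup]
    refine ⟨tendsto_pure_nhds _ _, ?_⟩
    have h0 : secant f 0 = derivWithin f (Ici 0) 0 := if_pos rfl
    rw [h0]
    refine h.congr' ?_
    filter_upwards [self_mem_nhdsWithin] with t ht
    have : t ≠ 0 := fun h => ht.2 h
    simp [secant, this, slope_def_field, hf.zero]
  · have : ContinuousAt (fun t => f t / t) s :=
      ((hf.hasDerivAt hs).continuousAt).div continuousAt_id hs.ne'
    refine (this.congr ?_).continuousWithinAt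
    filter_upwards [eventually_ne_nhds hs.ne'] with t ht
    rw [secant, if_neg ht]

theorem hasDerivAt_secant (hf : IsRegularCurve lo hi f) {s : ℝ} (hs : 0 < s) :
    HasDerivAt (secant f) ((derivWithin f (Ici 0) s - secant f s) / s) s := by
  have := (hf.hasDerivAt hs).div (hasDerivAt_id s) hs.ne'
  refine (this.congr_of_eventuallyEq ?_).congr_deriv ?_
  · filter_upwards [eventually_ne_nhds hs.ne'] with t ht
    simp [secant, if_neg ht]
  · rw [secant, if_neg hs.ne']
    simp only [id]
    field_simp

/-- The differential tensor in terms of the secant and the tangent slope. -/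
theorem diffTensor_eq (hf : IsRegularCurve lo hi f) (u v : R3) :
    diffTensor (secant f) u v = secant f ‖u‖ • v +
      ((derivWithin f (Ici 0) ‖u‖ - secant f ‖u‖) * (‖u‖⁻¹ * (‖u‖⁻¹ * inner ℝ u v))) • u := by
  by_cases hu : u = 0
  · simp [diffTensor, hu]
  · have h := norm_pos_iff.2 hu
    rw [diffTensor, (hf.hasDerivAt_secant h).deriv]
    congr 2
    field_simp

/-- Grouping each inner product with its own `‖u‖⁻¹` leaves only components along the direction of
`u`, bounded uniformly in `u`. The convention `0⁻¹ = 0` makes the formula hold at `u = 0` as well.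
-/
theorem inner_diffTensor (hf : IsRegularCurve lo hi f) (u v w : R3) :
    inner ℝ w (diffTensor (secant f) u v) = secant f ‖u‖ * inner ℝ w v +
      (derivWithin f (Ici 0) ‖u‖ - secant f ‖u‖) *
        ((‖u‖⁻¹ * inner ℝ u v) * (‖u‖⁻¹ * inner ℝ u w)) := by
  rw [hf.diffTensor_eq, inner_add_right, inner_smul_right, inner_smul_right,
    real_inner_comm u w]
  ring

theorem norm_inv_mul_inner_le (u v : R3) : |‖u‖⁻¹ * inner ℝ u v| ≤ ‖v‖ := by
  by_cases hu : u = 0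
  · simp [hu]
  · have h := norm_pos_iff.2 hu
    rw [abs_mul, abs_of_pos (inv_pos.2 h), inv_mul_le_iff₀ h]
    exact abs_real_inner_le_norm u v

theorem abs_inner_diffTensor_le (hf : IsRegularCurve lo hi f) (hlo : 0 < lo) (u v w : R3) :
    |inner ℝ w (diffTensor (secant f) u v)| ≤ 2 * hi * (‖w‖ * ‖v‖) := by
  rw [hf.inner_diffTensor]
  have h1 := hf.le_secant (norm_nonneg u)
  have h2 := hf.secant_le (norm_nonneg u)
  have h3 := hf.le_slope _ (norm_nonneg u)
  have h4 := hf.slope_le _ (norm_nonneg u)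
  have e1 : |secant f ‖u‖ * inner ℝ w v| ≤ hi * (‖w‖ * ‖v‖) := by
    rw [abs_mul, abs_of_pos (hlo.trans_le h1)]
    exact mul_le_mul h2 (abs_real_inner_le_norm w v) (abs_nonneg _) (by linarith)
  have e2 : |(derivWithin f (Ici 0) ‖u‖ - secant f ‖u‖) *
        ((‖u‖⁻¹ * inner ℝ u v) * (‖u‖⁻¹ * inner ℝ u w))| ≤ hi * (‖w‖ * ‖v‖) := by
    rw [abs_mul, abs_mul, mul_comm ‖w‖]
    have : |derivWithin f (Ici 0) ‖u‖ - secant f ‖u‖| ≤ hi := by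
      rw [abs_le]; constructor <;> linarith
    exact mul_le_mul this (mul_le_mul (norm_inv_mul_inner_le u v) (norm_inv_mul_inner_le u w)
      (abs_nonneg _) (norm_nonneg _)) (by positivity) (by linarith)
  exact (abs_add_le _ _).trans (by linarith)

/-- With `c` the component of `v` along `u`, the form equals the secant times `‖v‖² - c²` plus the
slope times `c²`. Both weights are nonnegative and both coefficients are at least `lo`. -/
theorem mul_norm_sq_le_inner_diffTensor (hf : IsRegularCurve lo hi f) (u v : R3) :
    lo * ‖v‖ ^ 2 ≤ inner ℝ v (diffTensor (secant f) u v) := by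
  rw [hf.inner_diffTensor, real_inner_self_eq_norm_sq]
  have h1 := hf.le_secant (norm_nonneg u)
  have h3 := hf.le_slope _ (norm_nonneg u)
  have h5 := sq_le_sq' (abs_le.1 (norm_inv_mul_inner_le u v)).1
    (abs_le.1 (norm_inv_mul_inner_le u v)).2
  have h6 := sq_nonneg (‖u‖⁻¹ * inner ℝ u v)
  nlinarith [mul_nonneg (sub_nonneg.2 h1) (sub_nonneg.2 h5), mul_nonneg (sub_nonneg.2 h3) h6]

theorem continuous_secant_norm (hf : IsRegularCurve lo hi f) :
    Continuous (fun u : R3 => secant f ‖u‖) :=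
  hf.continuousOn_secant.comp_continuous continuous_norm fun u => norm_nonneg u

/-- The direction of `u` has no limit as `u → 0`, but it is multiplied by slope minus secant, which
is continuous and vanishes at `0`; a null factor times a bounded one tends to zero. -/
theorem continuous_diffTensor (hf : IsRegularCurve lo hi f) (v w : R3) :
    Continuous (fun u : R3 => inner ℝ w (diffTensor (secant f) u v)) := by
  simp only [hf.inner_diffTensor]
  refine (hf.continuous_secant_norm.mul continuous_const).add ?_
  have hd : Continuous (fun u : R3 => derivWithin f (Ici 0) ‖u‖ - secant f ‖u‖) :=
    (hf.continuousOn_slope.comp_continuous continuous_norm fun u => norm_nonneg u).sub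
      hf.continuous_secant_norm
  rw [continuous_iff_continuousAt]
  intro u
  by_cases hu : u = 0
  · subst hu
    have h0 : Tendsto (fun u : R3 => (derivWithin f (Ici 0) ‖u‖ - secant f ‖u‖)) (𝓝 0) (𝓝 0) := by
      have := hd.tendsto 0
      simpa [secant] using this
    have : Tendsto (fun u : R3 => (derivWithin f (Ici 0) ‖u‖ - secant f ‖u‖) *
        ((‖u‖⁻¹ * inner ℝ u v) * (‖u‖⁻¹ * inner ℝ u w))) (𝓝 0) (𝓝 0) := by
      refine h0.zero_mul_isBoundedUnder_le (isBoundedUnder_of ⟨‖v‖ * ‖w‖, fun u => ?_⟩)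
      simp only [Function.comp, Real.norm_eq_abs, abs_mul (‖u‖⁻¹ * inner ℝ u v)]
      exact mul_le_mul (norm_inv_mul_inner_le u v) (norm_inv_mul_inner_le u w)
        (abs_nonneg _) (norm_nonneg _)
    simpa [ContinuousAt] using this
  · have hi' : ContinuousAt (fun u : R3 => ‖u‖⁻¹) u :=
      continuousAt_inv₀ (norm_ne_zero_iff.2 hu) |>.comp continuous_norm.continuousAt
    exact hd.continuousAt.mul ((hi'.mul (by fun_prop)).mul (hi'.mul (by fun_prop)))

/-- The differential tensor is linear in its last argument. -/
theorem diffTensor_isLinear (kap : ℝ → ℝ) (u : R3) : IsLinearMap ℝ (diffTensor kap u) where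
  map_add v w := by
    simp only [diffTensor, inner_add_right, mul_add, smul_add, add_smul]; abel
  map_smul r v := by
    simp only [diffTensor, inner_smul_right, smul_add, smul_smul]
    congr 1
    · rw [mul_comm]
    · congr 1; ring

/-- This is why the tangent material law is `diffTensor`. For `u ≠ 0` it is the product rule. At `0`
the remainder is the secant increment times `u`, which is `o(u)` by continuity of the secant alone.
-/
theorem hasFDerivAt_field (hf : IsRegularCurve lo hi f) (u : R3) :
    HasFDerivAt (fun u : R3 => secant f ‖u‖ • u)
      (LinearMap.toContinuousLinearMap ((diffTensor_isLinear (secant f) u).mk' _)) u := by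
  by_cases hu : u = 0
  · subst hu
    have h0 : Tendsto (fun u : R3 => secant f ‖u‖ - secant f 0) (𝓝 0) (𝓝 0) := by
      simpa using (hf.continuous_secant_norm.tendsto 0).sub_const (secant f 0)
    rw [hasFDerivAt_iff_isLittleO_nhds_zero]
    have := (Asymptotics.isLittleO_one_iff ℝ).2 h0 |>.smul_isBigO
      (Asymptotics.isBigO_refl (fun u : R3 => u) (𝓝 0))
    refine (this.congr_left fun u => ?_).trans_isBigO ?_
    · simp [diffTensor, sub_smul]
    · simp only [one_smul]; exact Asymptotics.isBigO_refl _ _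
  · have h := norm_pos_iff.2 hu
    have hn : HasFDerivAt (fun u : R3 => ‖u‖) (‖u‖⁻¹ • innerSL ℝ u) u := by
      have h2 := (hasStrictFDerivAt_norm_sq u).hasFDerivAt.sqrt (by positivity)
      refine (h2.congr_of_eventuallyEq (Eventually.of_forall fun w => ?_)).congr_fderiv ?_
      · simp
      · ext w
        simp only [Real.sqrt_sq h.le, _root_.smul_apply, smul_eq_mul,
          nsmul_eq_mul, innerSL_apply_apply, Nat.cast_ofNat]
        field_simp
    have hs := (hf.hasDerivAt_secant h).comp_hasFDerivAt u hn
    refine (hs.smul (hasFDerivAt_id u)).congr_fderiv ?_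
    ext1 w
    simp [diffTensor, (hf.hasDerivAt_secant h).deriv, smul_smul]
    congr 1
    ring

end IsRegularCurve

/-! ### The inverse curve -/

namespace IsRegularCurve

variable {lo hi : ℝ} {f : ℝ → ℝ}

theorem strictMonoOn (hf : IsRegularCurve lo hi f) (hlo : 0 < lo) : StrictMonoOn f (Ici 0) := by
  intro s hs t _ hst
  have := hf.mul_sub_le hs hst.le
  nlinarith [mul_pos hlo (sub_pos.2 hst)]

/-- Since the slope is at least `lo`, the value at `b / lo` is at least `b`, and the intermediate
value theorem applies on `[0, b / lo]`. -/
theorem surjOn (hf : IsRegularCurve lo hi f) (hlo : 0 < lo) : SurjOn f (Ici 0) (Ici 0) := by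
  intro b hb
  have hb : 0 ≤ b := hb
  have h := hf.mul_sub_le le_rfl (div_nonneg hb hlo.le)
  rw [hf.zero, sub_zero, sub_zero, mul_div_cancel₀ _ hlo.ne'] at h
  have := intermediate_value_Icc (div_nonneg hb hlo.le)
    (hf.contDiffOn.continuousOn.mono Icc_subset_Ici_self)
  rw [hf.zero] at this
  obtain ⟨s, hs, rfl⟩ := this ⟨hb, h⟩
  exact ⟨s, hs.1, rfl⟩

theorem invFunOn_nonneg (hf : IsRegularCurve lo hi f) (hlo : 0 < lo) {b : ℝ} (hb : 0 ≤ b) :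
    0 ≤ Function.invFunOn f (Ici 0) b :=
  Function.invFunOn_mem (hf.surjOn hlo hb)

theorem apply_invFunOn (hf : IsRegularCurve lo hi f) (hlo : 0 < lo) {b : ℝ} (hb : 0 ≤ b) :
    f (Function.invFunOn f (Ici 0) b) = b :=
  Function.invFunOn_eq (hf.surjOn hlo hb)

/-- Sublevel sets of the inverse are described by the curve itself; this later yields joint
measurability of the inverse curves in space and field strength. -/
theorem invFunOn_le_iff (hf : IsRegularCurve lo hi f) (hlo : 0 < lo) {b c : ℝ} (hb : 0 ≤ b)
    (hc : 0 ≤ c) : Function.invFunOn f (Ici 0) b ≤ c ↔ b ≤ f c := by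
  rw [← (hf.strictMonoOn hlo).le_iff_le (hf.invFunOn_nonneg hlo hb) hc, hf.apply_invFunOn hlo hb]

theorem invFunOn_zero (hf : IsRegularCurve lo hi f) (hlo : 0 < lo) :
    Function.invFunOn f (Ici 0) 0 = 0 :=
  le_antisymm ((hf.invFunOn_le_iff hlo le_rfl le_rfl).2 hf.zero.ge)
    (hf.invFunOn_nonneg hlo le_rfl)

theorem continuousOn_invFunOn (hf : IsRegularCurve lo hi f) (hlo : 0 < lo) :
    ContinuousOn (Function.invFunOn f (Ici 0)) (Ici 0) := by
  have : LipschitzOnWith (Real.toNNReal lo⁻¹) (Function.invFunOn f (Ici 0)) (Ici 0) := by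
    refine LipschitzOnWith.of_dist_le_mul fun a ha b hb => ?_
    wlog hab : Function.invFunOn f (Ici 0) a ≤ Function.invFunOn f (Ici 0) b generalizing a b
    · rw [dist_comm, dist_comm a b]; exact this b hb a ha (le_of_not_ge hab)
    have h := hf.mul_sub_le (hf.invFunOn_nonneg hlo ha) hab
    rw [hf.apply_invFunOn hlo ha, hf.apply_invFunOn hlo hb] at h
    rw [Real.coe_toNNReal _ (inv_pos.2 hlo).le, dist_comm, dist_comm a, Real.dist_eq,
      Real.dist_eq, abs_of_nonneg (sub_nonneg.2 hab), inv_mul_eq_div, le_div_iff₀ hlo]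
    calc _ = lo * (Function.invFunOn f (Ici 0) b - Function.invFunOn f (Ici 0) a) := mul_comm _ _
      _ ≤ b - a := h
      _ ≤ |b - a| := le_abs_self _
  exact this.continuousOn

/-- Difference quotients of the inverse are reciprocals of those of `f`. Continuity of the inverse
moves the base points to the right limit, and injectivity keeps them off it. -/
theorem hasDerivWithinAt_invFunOn (hf : IsRegularCurve lo hi f) (hlo : 0 < lo) {b : ℝ}
    (hb : 0 ≤ b) : HasDerivWithinAt (Function.invFunOn f (Ici 0))
      (derivWithin f (Ici 0) (Function.invFunOn f (Ici 0) b))⁻¹ (Ici 0) b := by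
  set g := Function.invFunOn f (Ici 0) with hg
  have hgb := hf.invFunOn_nonneg hlo hb
  have hne : derivWithin f (Ici 0) (g b) ≠ 0 := (hlo.trans_le (hf.le_slope _ hgb)).ne'
  have hd := (hf.hasDerivWithinAt hgb)
  rw [hasDerivWithinAt_iff_tendsto_slope] at hd ⊢
  have ht : Tendsto g (𝓝[Ici 0 \ {b}] b) (𝓝[Ici 0 \ {g b}] (g b)) := by
    refine tendsto_nhdsWithin_iff.2 ⟨((hf.continuousOn_invFunOn hlo) b hb).mono_left
      (nhdsWithin_mono _ sdiff_subset), ?_⟩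
    filter_upwards [self_mem_nhdsWithin] with c hc
    refine ⟨hf.invFunOn_nonneg hlo hc.1, fun h => hc.2 ?_⟩
    have := congrArg f (show g c = g b from h)
    rwa [hf.apply_invFunOn hlo hc.1, hf.apply_invFunOn hlo hb] at this
  refine ((hd.comp ht).inv₀ hne).congr' ?_
  filter_upwards [self_mem_nhdsWithin] with c hc
  simp only [Function.comp, slope_def_field, inv_div]
  rw [hf.apply_invFunOn hlo hc.1, hf.apply_invFunOn hlo hb]

theorem invFunOn (hf : IsRegularCurve lo hi f) (hlo : 0 < lo) :
    IsRegularCurve hi⁻¹ lo⁻¹ (Function.invFunOn f (Ici 0)) := by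
  have hd : ∀ b, 0 ≤ b → derivWithin (Function.invFunOn f (Ici 0)) (Ici 0) b =
      (derivWithin f (Ici 0) (Function.invFunOn f (Ici 0) b))⁻¹ := fun b hb =>
    (hf.hasDerivWithinAt_invFunOn hlo hb).derivWithin (uniqueDiffOn_Ici 0 b hb)
  refine ⟨hf.invFunOn_zero hlo, ?_, fun b hb => ?_, fun b hb => ?_⟩
  · rw [contDiffOn_one_iff_derivWithin (uniqueDiffOn_Ici 0)]
    refine ⟨fun b hb => (hf.hasDerivWithinAt_invFunOn hlo hb).differentiableWithinAt, ?_⟩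
    refine ContinuousOn.congr ?_ hd
    refine ContinuousOn.inv₀ (hf.continuousOn_slope.comp (hf.continuousOn_invFunOn hlo)
      fun b hb => hf.invFunOn_nonneg hlo hb) fun b hb => ?_
    exact (hlo.trans_le (hf.le_slope _ (hf.invFunOn_nonneg hlo hb))).ne'
  · rw [hd b hb]
    have := hf.invFunOn_nonneg hlo hb
    exact inv_anti₀ (hlo.trans_le (hf.le_slope _ this)) (hf.slope_le _ this)
  · rw [hd b hb]
    have := hf.invFunOn_nonneg hlo hb
    exact inv_anti₀ hlo (hf.le_slope _ this)

end IsRegularCurve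

/-! ### Material matrices -/

/-- A measurable family of magnetisation curves with uniformly bounded slopes. -/
structure IsCurveFamily (Ω : Set R3) (lo hi : ℝ) (f : R3 → ℝ → ℝ) : Prop where
  measurableSet : MeasurableSet Ω
  pos : 0 < lo
  regular : ∀ p ∈ Ω, IsRegularCurve lo hi (f p)
  measurable : Measurable ((Ω ×ˢ Ici (0 : ℝ)).indicator (Function.uncurry f))

namespace IsCurveFamily

variable {Ω : Set R3} {lo hi : ℝ} {f : R3 → ℝ → ℝ}

theorem measurableSet_prod (hf : IsCurveFamily Ω lo hi f) :
    MeasurableSet (Ω ×ˢ Ici (0 : ℝ)) :=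
  hf.measurableSet.prod measurableSet_Ici

/-- The slope is the pointwise limit of forward difference quotients with steps `1 / (n + 1)`.
Forward steps stay in the half-line, so they also reach the one-sided derivative at `0`. -/
theorem measurable_slope (hf : IsCurveFamily Ω lo hi f) :
    Measurable ((Ω ×ˢ Ici (0 : ℝ)).indicator
      (fun q : R3 × ℝ => derivWithin (f q.1) (Ici 0) q.2)) := by
  set F := (Ω ×ˢ Ici (0 : ℝ)).indicator (Function.uncurry f) with hF
  have hm : ∀ n : ℕ, Measurable ((Ω ×ˢ Ici (0 : ℝ)).indicator
      (fun q : R3 × ℝ => ((n : ℝ) + 1) * (F (q.1, q.2 + 1 / ((n : ℝ) + 1)) - F q))) := fun n =>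
    (measurable_const.mul ((hf.measurable.comp (by fun_prop)).sub hf.measurable)).indicator
      hf.measurableSet_prod
  refine measurable_of_tendsto_metrizable hm (tendsto_pi_nhds.2 fun q => ?_)
  by_cases hq : q ∈ Ω ×ˢ Ici (0 : ℝ)
  · obtain ⟨hp, hs⟩ := hq
    have hs : 0 ≤ q.2 := hs
    simp only [indicator_of_mem (show q ∈ Ω ×ˢ Ici (0 : ℝ) from ⟨hp, hs⟩)]
    have hd := hasDerivWithinAt_iff_tendsto_slope.1 ((hf.regular q.1 hp).hasDerivWithinAt hs)
    have ht : Tendsto (fun n : ℕ => q.2 + 1 / ((n : ℝ) + 1)) atTop (𝓝[Ici 0 \ {q.2}] q.2) := by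
      refine tendsto_nhdsWithin_iff.2 ⟨?_, Eventually.of_forall fun n => ?_⟩
      · simpa using tendsto_one_div_add_atTop_nhds_zero_nat.const_add q.2
      · have : (0:ℝ) < 1 / ((n : ℝ) + 1) := by positivity
        exact ⟨by simp only [mem_Ici]; linarith, by simp only [mem_singleton_iff]; linarith⟩
    refine (hd.comp ht).congr fun n => ?_
    have hn : (0:ℝ) < 1 / ((n : ℝ) + 1) := by positivity
    have h1 : F (q.1, q.2 + 1 / ((n : ℝ) + 1)) = f q.1 (q.2 + 1 / ((n : ℝ) + 1)) :=
      indicator_of_mem (s := Ω ×ˢ Ici (0 : ℝ)) (a := (q.1, q.2 + 1 / ((n : ℝ) + 1)))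
        ⟨hp, by simp only [mem_Ici]; linarith⟩ _
    have h2 : F q = f q.1 q.2 := indicator_of_mem (s := Ω ×ˢ Ici (0 : ℝ)) ⟨hp, hs⟩ _
    simp only [Function.comp, slope_def_field, h1, h2, add_sub_cancel_left]
    field_simp
  · simp [indicator_of_notMem hq]

theorem measurable_secant (hf : IsCurveFamily Ω lo hi f) :
    Measurable ((Ω ×ˢ Ici (0 : ℝ)).indicator (fun q : R3 × ℝ => secant (f q.1) q.2)) := by
  have h : (Ω ×ˢ Ici (0 : ℝ)).indicator (fun q : R3 × ℝ => secant (f q.1) q.2) =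
      fun q => if q.2 = 0 then (Ω ×ˢ Ici (0 : ℝ)).indicator
          (fun q : R3 × ℝ => derivWithin (f q.1) (Ici 0) q.2) q
        else (Ω ×ˢ Ici (0 : ℝ)).indicator (Function.uncurry f) q / q.2 := by
    funext q
    by_cases hq : q ∈ Ω ×ˢ Ici (0 : ℝ)
    · simp only [indicator_of_mem hq, secant, Function.uncurry]
      split_ifs with h
      · rw [h]
      · rfl
    · simp [indicator_of_notMem hq]
  rw [h]
  exact Measurable.ite (measurable_snd (measurableSet_singleton 0)) hf.measurable_slope
    (hf.measurable.div measurable_snd)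

/-- Only values at points of `Ω` and nonnegative arguments matter, since a norm is inserted; hence
joint measurability of the indicator suffices. -/
theorem aestronglyMeasurable_comp_norm (hΩ : MeasurableSet Ω) {g : R3 → ℝ → ℝ}
    (hg : Measurable ((Ω ×ˢ Ici (0 : ℝ)).indicator (Function.uncurry g))) {u : R3 → R3}
    (hu : AEStronglyMeasurable u (volume.restrict Ω)) :
    AEStronglyMeasurable (fun p => g p ‖u p‖) (volume.restrict Ω) := by
  have h : AEMeasurable (fun p => (p, ‖u p‖)) (volume.restrict Ω) :=
    aemeasurable_id.prodMk hu.norm.aemeasurable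
  refine ((hg.comp_aemeasurable h).aestronglyMeasurable).congr ?_
  filter_upwards [ae_restrict_mem hΩ] with p hp
  exact indicator_of_mem (s := Ω ×ˢ Ici (0 : ℝ)) ⟨hp, norm_nonneg _⟩ _

theorem aestronglyMeasurable_secant (hf : IsCurveFamily Ω lo hi f) {u : R3 → R3}
    (hu : AEStronglyMeasurable u (volume.restrict Ω)) :
    AEStronglyMeasurable (fun p => secant (f p) ‖u p‖) (volume.restrict Ω) :=
  aestronglyMeasurable_comp_norm (g := fun p => secant (f p)) hf.measurableSet
    hf.measurable_secant hu

theorem aestronglyMeasurable_diffTensor (hf : IsCurveFamily Ω lo hi f) {u v w : R3 → R3}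
    (hu : AEStronglyMeasurable u (volume.restrict Ω))
    (hv : AEStronglyMeasurable v (volume.restrict Ω))
    (hw : AEStronglyMeasurable w (volume.restrict Ω)) :
    AEStronglyMeasurable (fun p => inner ℝ (w p) (diffTensor (secant (f p)) (u p) (v p)))
      (volume.restrict Ω) := by
  have hs := hf.aestronglyMeasurable_secant hu
  have hd := aestronglyMeasurable_comp_norm (g := fun p => derivWithin (f p) (Ici 0))
    hf.measurableSet hf.measurable_slope hu
  have hn : AEStronglyMeasurable (fun p => ‖u p‖⁻¹) (volume.restrict Ω) :=
    hu.norm.aemeasurable.inv.aestronglyMeasurable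
  refine ((hs.mul (hw.inner (𝕜 := ℝ) hv)).add ((hd.sub hs).mul ((hn.mul (hu.inner (𝕜 := ℝ) hv)).mul
    (hn.mul (hu.inner (𝕜 := ℝ) hw))))).congr ?_
  filter_upwards [ae_restrict_mem hf.measurableSet] with p hp
  exact ((hf.regular p hp).inner_diffTensor _ _ _).symm

/-- The family of inverse curves. -/
theorem invFunOn (hf : IsCurveFamily Ω lo hi f) (hhi : 0 < hi) :
    IsCurveFamily Ω hi⁻¹ lo⁻¹ (fun p => Function.invFunOn (f p) (Ici 0)) where
  measurableSet := hf.measurableSet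
  pos := inv_pos.2 hhi
  regular p hp := (hf.regular p hp).invFunOn hf.pos
  measurable := by
    -- For `c ≥ 0` the sublevel set is, inside the product set, `{(p, b) | b ≤ f p c}`, and it
    -- contains the whole complement, where the indicator is `0`. For `c < 0` it is empty.
    refine measurable_of_Iic fun c => ?_
    by_cases hc : 0 ≤ c
    · have hmeas : MeasurableSet {q : R3 × ℝ | q ∈ Ω ×ˢ Ici (0 : ℝ) → q.2 ≤
          (Ω ×ˢ Ici (0 : ℝ)).indicator (Function.uncurry f) (q.1, c)} := by
        have h2 : MeasurableSet {q : R3 × ℝ | q.2 ≤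
          (Ω ×ˢ Ici (0 : ℝ)).indicator (Function.uncurry f) (q.1, c)} :=
          measurableSet_le measurable_snd (hf.measurable.comp (by fun_prop))
        convert hf.measurableSet_prod.compl.union h2 using 1
        ext q
        simp only [mem_ofPred_eq, mem_union, mem_compl_iff, imp_iff_not_or]
      convert hmeas using 1
      ext q
      simp only [mem_preimage, mem_Iic, mem_ofPred_eq]
      by_cases hq : q ∈ Ω ×ˢ Ici (0 : ℝ)
      · rw [indicator_of_mem hq, indicator_of_mem (s := Ω ×ˢ Ici (0 : ℝ)) (a := (q.1, c)) ⟨hq.1, hc⟩]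
        simp only [hq, forall_const, Function.uncurry]
        exact (hf.regular q.1 hq.1).invFunOn_le_iff hf.pos hq.2 hc
      · simp [hq, hc]
    · convert MeasurableSet.empty (α := R3 × ℝ) using 1
      ext q
      simp only [mem_preimage, mem_Iic, mem_empty_iff_false, iff_false, not_le]
      by_cases hq : q ∈ Ω ×ˢ Ici (0 : ℝ)
      · rw [indicator_of_mem hq]
        exact (not_le.1 hc).trans_le ((hf.regular q.1 hq.1).invFunOn_nonneg hf.pos hq.2)
      · rw [indicator_of_notMem hq]; exact not_le.1 hc

/-! ### Integrated material matrices: continuity, definiteness and the derivative of `c ↦ M(c) c`.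
-/

section Matrices

variable {n : Type*} [Fintype n] {b : n → R3 → R3}

theorem fieldOf_add (c d : n → ℝ) (p : R3) :
    fieldOf b (c + d) p = fieldOf b c p + fieldOf b d p := by
  simp [fieldOf, add_smul, Finset.sum_add_distrib]

theorem fieldOf_smul (r : ℝ) (c : n → ℝ) (p : R3) :
    fieldOf b (r • c) p = r • fieldOf b c p := by
  simp [fieldOf, Finset.smul_sum, smul_smul]

/-- Evaluation of a discrete field at a point, as a linear map in the coefficients. -/
noncomputable def fieldCLM (b : n → R3 → R3) (p : R3) : (n → ℝ) →L[ℝ] R3 :=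
  LinearMap.toContinuousLinearMap
    { toFun := fun c => fieldOf b c p
      map_add' := fun c d => fieldOf_add c d p
      map_smul' := fun r c => fieldOf_smul r c p }

theorem memLp_fieldOf (hb : ∀ k, MemLp (b k) 2 (volume.restrict Ω)) (c : n → ℝ) :
    MemLp (fieldOf b c) 2 (volume.restrict Ω) :=
  memLp_finsetSum _ fun k _ => (hb k).const_smul (c k)

/-- The pointwise bound `2 * hi * (‖w‖ * ‖v‖)` does not involve `u`; as a multiple of a product of
two `L²` functions it is integrable. The same bound later serves as the dominating function. -/
theorem integrable_diffTensor (hf : IsCurveFamily Ω lo hi f) {u v w : R3 → R3}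
    (hu : AEStronglyMeasurable u (volume.restrict Ω))
    (hv : MemLp v 2 (volume.restrict Ω)) (hw : MemLp w 2 (volume.restrict Ω)) :
    Integrable (fun p => inner ℝ (w p) (diffTensor (secant (f p)) (u p) (v p)))
      (volume.restrict Ω) := by
  refine ((hw.norm.integrable_mul hv.norm).const_mul (2 * hi)).mono'
    (hf.aestronglyMeasurable_diffTensor hu hv.1 hw.1) ?_
  filter_upwards [ae_restrict_mem hf.measurableSet] with p hp
  exact (hf.regular p hp).abs_inner_diffTensor_le hf.pos _ _ _

theorem integrable_secant (hf : IsCurveFamily Ω lo hi f) {u v w : R3 → R3}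
    (hu : AEStronglyMeasurable u (volume.restrict Ω))
    (hv : MemLp v 2 (volume.restrict Ω)) (hw : MemLp w 2 (volume.restrict Ω)) :
    Integrable (fun p => secant (f p) ‖u p‖ * inner ℝ (w p) (v p)) (volume.restrict Ω) := by
  refine ((hw.norm.integrable_mul hv.norm).const_mul hi).mono'
    ((hf.aestronglyMeasurable_secant hu).mul (hw.1.inner hv.1)) ?_
  filter_upwards [ae_restrict_mem hf.measurableSet] with p hp
  have h1 := (hf.regular p hp).le_secant (norm_nonneg (u p))
  have h2 := (hf.regular p hp).secant_le (norm_nonneg (u p))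
  rw [norm_mul, Real.norm_eq_abs, abs_of_pos (hf.pos.trans_le h1)]
  exact mul_le_mul h2 (abs_real_inner_le_norm _ _) (abs_nonneg _)
    ((hf.pos.trans_le h1).le.trans h2)

theorem matMatrix_mulVec (hf : IsCurveFamily Ω lo hi f)
    (hb : ∀ k, MemLp (b k) 2 (volume.restrict Ω)) (c d : n → ℝ) (i : n) :
    (matMatrix Ω b (fun p => secant (f p)) c *ᵥ d) i =
      ∫ p in Ω, inner ℝ (b i p) (secant (f p) ‖fieldOf b c p‖ • fieldOf b d p) := by
  have hu := (memLp_fieldOf hb c).1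
  simp only [mulVec, dotProduct, matMatrix]
  simp only [← integral_mul_const]
  rw [← integral_finsetSum _ fun j _ => (hf.integrable_secant hu (hb j) (hb i)).mul_const _]
  refine integral_congr_ae (Eventually.of_forall fun p => ?_)
  simp only [inner_smul_right]
  rw [show fieldOf b d p = ∑ k, d k • b k p from rfl, inner_sum, Finset.mul_sum]
  refine Finset.sum_congr rfl fun j _ => ?_
  rw [inner_smul_right]; ring

theorem diffMatMatrix_mulVec (hf : IsCurveFamily Ω lo hi f)
    (hb : ∀ k, MemLp (b k) 2 (volume.restrict Ω)) (c d : n → ℝ) (i : n) :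
    (diffMatMatrix Ω b (fun p => secant (f p)) c *ᵥ d) i =
      ∫ p in Ω, inner ℝ (b i p) (diffTensor (secant (f p)) (fieldOf b c p) (fieldOf b d p)) := by
  have hu := (memLp_fieldOf hb c).1
  simp only [mulVec, dotProduct, diffMatMatrix]
  simp only [← integral_mul_const]
  rw [← integral_finsetSum _ fun j _ => (hf.integrable_diffTensor hu (hb j) (hb i)).mul_const _]
  refine integral_congr_ae (Eventually.of_forall fun p => ?_)
  simp only
  have := map_sum ((IsRegularCurve.diffTensor_isLinear (secant (f p)) (fieldOf b c p)).mk' _)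
    (fun k => d k • b k p) Finset.univ
  simp only [IsLinearMap.mk'_apply,
    (IsRegularCurve.diffTensor_isLinear (secant (f p)) (fieldOf b c p)).map_smul] at this
  rw [show fieldOf b d p = ∑ k, d k • b k p from rfl, this, inner_sum]
  refine Finset.sum_congr rfl fun j _ => ?_
  rw [inner_smul_right]; ring

/-- The differential material matrix depends continuously on the field. -/
theorem continuous_diffMatMatrix (hf : IsCurveFamily Ω lo hi f)
    (hb : ∀ k, MemLp (b k) 2 (volume.restrict Ω)) :
    Continuous (diffMatMatrix Ω b (fun p => secant (f p))) := by
  refine continuous_matrix fun i j => ?_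
  refine continuous_of_dominated (bound := fun p => 2 * hi * (‖b i p‖ * ‖b j p‖))
    (fun c => hf.aestronglyMeasurable_diffTensor (memLp_fieldOf hb c).1 (hb j).1 (hb i).1)
    (fun c => ?_) (((hb i).norm.integrable_mul (hb j).norm).const_mul (2 * hi)) ?_
  · filter_upwards [ae_restrict_mem hf.measurableSet] with p hp
    exact (hf.regular p hp).abs_inner_diffTensor_le hf.pos _ _ _
  · filter_upwards [ae_restrict_mem hf.measurableSet] with p hp
    exact ((hf.regular p hp).continuous_diffTensor _ _).comp (fieldCLM b p).continuous

/-- The differential material matrix is positive definite. -/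
theorem diffMatMatrix_pos (hf : IsCurveFamily Ω lo hi f)
    (hb : ∀ k, MemLp (b k) 2 (volume.restrict Ω))
    (hind : ∀ c : n → ℝ, (∀ᵐ p ∂(volume.restrict Ω), ∑ k, c k • b k p = 0) → c = 0)
    (c : n → ℝ) {d : n → ℝ} (hd : d ≠ 0) :
    0 < d ⬝ᵥ (diffMatMatrix Ω b (fun p => secant (f p)) c *ᵥ d) := by
  have hu := (memLp_fieldOf hb c).1
  have hv := memLp_fieldOf hb d
  have h1 : d ⬝ᵥ (diffMatMatrix Ω b (fun p => secant (f p)) c *ᵥ d) =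
      ∫ p in Ω, inner ℝ (fieldOf b d p)
        (diffTensor (secant (f p)) (fieldOf b c p) (fieldOf b d p)) := by
    simp only [dotProduct, hf.diffMatMatrix_mulVec hb]
    simp only [← integral_const_mul]
    rw [← integral_finsetSum _ fun j _ => (hf.integrable_diffTensor hu hv (hb j)).const_mul _]
    refine integral_congr_ae (Eventually.of_forall fun p => ?_)
    simp only
    nth_rw 3 [fieldOf]
    rw [sum_inner]
    refine Finset.sum_congr rfl fun j _ => ?_
    rw [real_inner_smul_left]
  have hsq : Integrable (fun p => lo * ‖fieldOf b d p‖ ^ 2) (volume.restrict Ω) :=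
    hv.integrable_norm_pow two_ne_zero |>.const_mul lo
  have h2 : ∫ p in Ω, lo * ‖fieldOf b d p‖ ^ 2 ≤ ∫ p in Ω, inner ℝ (fieldOf b d p)
        (diffTensor (secant (f p)) (fieldOf b c p) (fieldOf b d p)) := by
    refine integral_mono_ae hsq (hf.integrable_diffTensor hu hv hv) ?_
    filter_upwards [ae_restrict_mem hf.measurableSet] with p hp
    exact (hf.regular p hp).mul_norm_sq_le_inner_diffTensor _ _
  rw [h1]
  refine lt_of_lt_of_le ?_ h2
  have hnn : ∀ p, 0 ≤ lo * ‖fieldOf b d p‖ ^ 2 := fun p =>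
    mul_nonneg hf.pos.le (sq_nonneg _)
  -- Equality would force the field with coefficients `d` to vanish almost everywhere, which linear
  -- independence excludes.
  refine lt_of_le_of_ne (integral_nonneg hnn) fun h0 => hd (hind d ?_)
  have := (integral_eq_zero_iff_of_nonneg hnn hsq).1 h0.symm
  filter_upwards [this] with p hp
  have hp : lo * ‖fieldOf b d p‖ ^ 2 = 0 := hp
  simpa [hf.pos.ne', fieldOf] using hp

/-- The differential material matrix is the derivative of `c ↦ M(c) c`. -/
theorem hasFDerivAt_matMatrix (hf : IsCurveFamily Ω lo hi f)
    (hb : ∀ k, MemLp (b k) 2 (volume.restrict Ω)) (c : n → ℝ) :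
    HasFDerivAt (fun c => matMatrix Ω b (fun p => secant (f p)) c *ᵥ c)
      (LinearMap.toContinuousLinearMap
        (mulVecLin (diffMatMatrix Ω b (fun p => secant (f p)) c))) c := by
  rw [hasFDerivAt_pi']
  intro i
  simp only [hf.matMatrix_mulVec hb]
  -- Differentiation under the integral sign: `F' c p` is the derivative of the integrand, by
  -- `hasFDerivAt_field` and the chain rule.
  set F' : (n → ℝ) → R3 → (n → ℝ) →L[ℝ] ℝ := fun c p =>
    (innerSL ℝ (b i p)).comp ((LinearMap.toContinuousLinearMap
      ((IsRegularCurve.diffTensor_isLinear (secant (f p)) (fieldOf b c p)).mk' _)).comp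
        (fieldCLM b p)) with hF'
  have hF'app : ∀ c p d, F' c p d =
      inner ℝ (b i p) (diffTensor (secant (f p)) (fieldOf b c p) (fieldOf b d p)) :=
    fun c p d => rfl
  classical
  -- The expansion in coordinate functionals gives both the measurability of `F' c` and a norm bound
  -- independent of `c`, so the whole space can serve as the neighbourhood in the dominated theorem.
  have hF'sum : ∀ c p, F' c p = ∑ j, (inner ℝ (b i p)
      (diffTensor (secant (f p)) (fieldOf b c p) (b j p))) •
        (ContinuousLinearMap.proj j : (n → ℝ) →L[ℝ] ℝ) := by
    intro c p
    refine ContinuousLinearMap.ext fun d => ?_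
    rw [hF'app]
    have := map_sum ((IsRegularCurve.diffTensor_isLinear (secant (f p)) (fieldOf b c p)).mk' _)
      (fun k => d k • b k p) Finset.univ
    simp only [IsLinearMap.mk'_apply,
      (IsRegularCurve.diffTensor_isLinear (secant (f p)) (fieldOf b c p)).map_smul] at this
    rw [show fieldOf b d p = ∑ k, d k • b k p from rfl, this, inner_sum]
    simp only [inner_smul_right, _root_.sum_apply, _root_.smul_apply,
      ContinuousLinearMap.proj_apply, smul_eq_mul]
    exact Finset.sum_congr rfl fun j _ => mul_comm _ _
  have hF'meas : AEStronglyMeasurable (F' c) (volume.restrict Ω) := by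
    rw [show F' c = fun p => ∑ j, (inner ℝ (b i p)
      (diffTensor (secant (f p)) (fieldOf b c p) (b j p))) •
        (ContinuousLinearMap.proj j : (n → ℝ) →L[ℝ] ℝ) from funext (hF'sum c)]
    exact Finset.aestronglyMeasurable_fun_sum _ fun j _ =>
      (hf.aestronglyMeasurable_diffTensor (memLp_fieldOf hb c).1 (hb j).1 (hb i).1).smul_const _
  have hbound : ∀ p ∈ Ω, ∀ c, ‖F' c p‖ ≤ ∑ j, 2 * hi * (‖b i p‖ * ‖b j p‖) *
      ‖(ContinuousLinearMap.proj j : (n → ℝ) →L[ℝ] ℝ)‖ := by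
    intro p hp c
    rw [hF'sum]
    refine (norm_sum_le _ _).trans (Finset.sum_le_sum fun j _ => ?_)
    rw [norm_smul]
    exact mul_le_mul_of_nonneg_right ((hf.regular p hp).abs_inner_diffTensor_le hf.pos _ _ _)
      (norm_nonneg _)
  have hbi : Integrable (fun p => ∑ j, 2 * hi * (‖b i p‖ * ‖b j p‖) *
      ‖(ContinuousLinearMap.proj j : (n → ℝ) →L[ℝ] ℝ)‖) (volume.restrict Ω) :=
    integrable_finsetSum _ fun j _ =>
      (((hb i).norm.integrable_mul (hb j).norm).const_mul (2 * hi)).mul_const _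
  have hint : ∀ c, Integrable (fun p => inner ℝ (b i p)
      (secant (f p) ‖fieldOf b c p‖ • fieldOf b c p)) (volume.restrict Ω) := fun c => by
    simp only [inner_smul_right]
    exact hf.integrable_secant (memLp_fieldOf hb c).1 (memLp_fieldOf hb c) (hb i)
  have key := hasFDerivAt_integral_of_dominated_of_fderiv_le (𝕜 := ℝ)
    (μ := volume.restrict Ω) (x₀ := c) (s := univ) (F := fun c p => inner ℝ (b i p)
      (secant (f p) ‖fieldOf b c p‖ • fieldOf b c p)) (F' := F') univ_mem
    (Eventually.of_forall fun c => (hint c).1) (hint c) hF'meas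
    (by filter_upwards [ae_restrict_mem hf.measurableSet] with p hp
        exact fun c _ => hbound p hp c) hbi
    (by filter_upwards [ae_restrict_mem hf.measurableSet] with p hp
        intro c _
        have h1 := HasFDerivAt.comp (f := fieldCLM b p) c
          ((hf.regular p hp).hasFDerivAt_field (fieldOf b c p)) (fieldCLM b p).hasFDerivAt
        exact (innerSL ℝ (b i p)).hasFDerivAt.comp c h1)
  refine key.congr_fderiv (ContinuousLinearMap.ext fun d => ?_)
  have hFint : Integrable (F' c) (volume.restrict Ω) := hbi.mono' hF'meas (by
    filter_upwards [ae_restrict_mem hf.measurableSet] with p hp using hbound p hp c)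
  rw [ContinuousLinearMap.integral_apply hFint]
  simp only [hF'app]
  exact (hf.diffMatMatrix_mulVec hb c d i).symm

end Matrices

end IsCurveFamily

namespace Material

variable {Ω Ωc : Set R3}

theorem exists_isCurveFamily (mat : Material Ω Ωc) (hΩ : MeasurableSet Ω) :
    ∃ lo hi : ℝ, 0 < hi ∧ IsCurveFamily Ω lo hi mat.bh := by
  obtain ⟨lo, hi, hlo, hb⟩ := mat.bounds
  -- On an empty domain the bounds say nothing about `hi`; the maximum guarantees positivity.
  refine ⟨lo, max lo hi, hlo.trans_le (le_max_left _ _), hΩ, hlo, fun p hp => ?_,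
    mat.measurable_bh.indicator (hΩ.prod measurableSet_Ici)⟩
  have hb' : ∀ s, 0 < s → lo ≤ deriv (mat.bh p) s ∧ deriv (mat.bh p) s ≤ max lo hi :=
    fun s hs => ⟨(hb p hp s hs).1, (hb p hp s hs).2.trans (le_max_right _ _)⟩
  rcases mat.isBH p hp with h | ⟨m, _, h⟩
  · exact isRegularCurve_of_deriv h.zero h.contDiffOn hb'
  · refine isRegularCurve_of_deriv (by simpa using h 0 le_rfl) ?_ hb'
    exact (contDiff_const.mul contDiff_id).contDiffOn.congr fun s hs => h s hs

end Material

/-! ### The discrete curl of a discrete gradient vanishes -/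

section Smooth

open scoped ContDiff

theorem contDiff_pderiv {u : R3 → ℝ} (hu : ContDiff ℝ ∞ u) (i : Fin 3) :
    ContDiff ℝ ∞ (pderiv i u) :=
  (hu.fderiv_right (m := ∞) (by simp)).clm_apply contDiff_const

theorem tsupport_pderiv_subset (u : R3 → ℝ) (i : Fin 3) :
    tsupport (pderiv i u) ⊆ tsupport u := by
  refine (closure_mono fun p hp => ?_).trans (tsupport_fderiv_subset ℝ (f := u))
  intro h
  have h : fderiv ℝ u p = 0 := h
  exact hp (by simp [pderiv, h])

theorem pderiv_pderiv_comm {u : R3 → ℝ} (hu : ContDiff ℝ ∞ u) (i j : Fin 3) (p : R3) :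
    pderiv i (pderiv j u) p = pderiv j (pderiv i u) p := by
  have hd : DifferentiableAt ℝ (fderiv ℝ u) p :=
    ((hu.fderiv_right (m := ∞) (by simp)).differentiable (by simp)) p
  have key : ∀ i j, pderiv i (pderiv j u) p =
      fderiv ℝ (fderiv ℝ u) p (EuclideanSpace.single i 1) (EuclideanSpace.single j 1) := by
    intro i j
    have := hd.hasFDerivAt.clm_apply (hasFDerivAt_const (EuclideanSpace.single j (1:ℝ)) p)
    change fderiv ℝ (fun q => fderiv ℝ u q (EuclideanSpace.single j 1)) p _ = _
    rw [this.fderiv]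
    simp
  rw [key, key]
  exact (hu.contDiffAt.isSymmSndFDerivAt (by
    rw [minSmoothness_of_isRCLikeNormedField]
    exact WithTop.coe_le_coe.2 le_top)) _ _

theorem pderiv_sub {u v : R3 → ℝ} (hu : ContDiff ℝ ∞ u) (hv : ContDiff ℝ ∞ v) (i : Fin 3)
    (p : R3) : pderiv i (fun q => u q - v q) p = pderiv i u p - pderiv i v p := by
  simp only [pderiv]
  rw [fderiv_fun_sub (hu.differentiable (by simp) p) (hv.differentiable (by simp) p)]
  rfl

theorem contDiff_curl {η : R3 → R3} (hη : ContDiff ℝ ∞ η) (i : Fin 3) :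
    ContDiff ℝ ∞ (fun p => curl η p i) := by
  have h : ∀ j, ContDiff ℝ ∞ (fun r => η r j) := fun j => (contDiff_euclidean.1 hη) j
  fin_cases i
  · exact (contDiff_pderiv (h 2) 1).sub (contDiff_pderiv (h 1) 2)
  · exact (contDiff_pderiv (h 0) 2).sub (contDiff_pderiv (h 2) 0)
  · exact (contDiff_pderiv (h 1) 0).sub (contDiff_pderiv (h 0) 1)

theorem tsupport_curl_subset (η : R3 → R3) (i : Fin 3) :
    tsupport (fun p => curl η p i) ⊆ tsupport η := by
  have h : ∀ j k, tsupport (pderiv k (fun r => η r j)) ⊆ tsupport η := fun j k =>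
    (tsupport_pderiv_subset _ k).trans (closure_mono fun p hp h => hp (by simp [h]))
  have h2 : ∀ j k j' k', tsupport (fun p => pderiv k (fun r => η r j) p -
      pderiv k' (fun r => η r j') p) ⊆ tsupport η := fun j k j' k' =>
    (tsupport_sub _ _).trans (union_subset (h j k) (h j' k'))
  fin_cases i
  · exact h2 2 1 1 2
  · exact h2 0 2 2 0
  · exact h2 1 0 0 1

theorem div_curl {η : R3 → R3} (hη : ContDiff ℝ ∞ η) (p : R3) :
    ∑ i, pderiv i (fun q => curl η q i) p = 0 := by
  have h : ∀ j, ContDiff ℝ ∞ (fun r => η r j) := fun j => (contDiff_euclidean.1 hη) j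
  have h0 : (fun q => curl η q 0) = fun q => pderiv 1 (fun r => η r 2) q -
    pderiv 2 (fun r => η r 1) q := rfl
  have h1 : (fun q => curl η q 1) = fun q => pderiv 2 (fun r => η r 0) q -
    pderiv 0 (fun r => η r 2) q := rfl
  have h2 : (fun q => curl η q 2) = fun q => pderiv 0 (fun r => η r 1) q -
    pderiv 1 (fun r => η r 0) q := rfl
  rw [Fin.sum_univ_three, h0, h1, h2]
  simp only [pderiv_sub (contDiff_pderiv (h _) _) (contDiff_pderiv (h _) _)]
  rw [pderiv_pderiv_comm (h 2) 1 0, pderiv_pderiv_comm (h 1) 2 0, pderiv_pderiv_comm (h 0) 2 1]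
  ring

/-- Each component of `curl η` is an admissible test function for the weak gradient. Summing the
three identities leaves `u` against the divergence of `curl η`, which vanishes by symmetry of second
derivatives. -/
theorem integral_inner_curl_of_hasWeakGrad {Ω : Set R3} {u : R3 → ℝ} {g : R3 → R3}
    (hu : MemLp u 2 (volume.restrict Ω)) (hg : MemLp g 2 (volume.restrict Ω))
    (h : HasWeakGrad Ω u g) {η : R3 → R3} (hη : ContDiff ℝ ∞ η) (hc : HasCompactSupport η)
    (hs : tsupport η ⊆ Ω) : ∫ p in Ω, inner ℝ (g p) (curl η p) = 0 := by
  have hcc : ∀ i, HasCompactSupport (fun p => curl η p i) := fun i =>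
    hc.of_isClosed_subset (isClosed_tsupport _) (tsupport_curl_subset η i)
  have hcp : ∀ i, HasCompactSupport (pderiv i (fun p => curl η p i)) := fun i =>
    (hcc i).of_isClosed_subset (isClosed_tsupport _) (tsupport_pderiv_subset _ i)
  have hgi : ∀ i : Fin 3, MemLp (fun p => g p i) 2 (volume.restrict Ω) := fun i =>
    hg.continuousLinearMap_comp (EuclideanSpace.proj i : R3 →L[ℝ] ℝ)
  have hcL : ∀ i : Fin 3, MemLp (fun p => curl η p i) 2 (volume.restrict Ω) := fun i =>
    (contDiff_curl hη i).continuous.memLp_of_hasCompactSupport (hcc i)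
  have hpL : ∀ i : Fin 3, MemLp (pderiv i (fun p => curl η p i)) 2 (volume.restrict Ω) := fun i =>
    (contDiff_pderiv (contDiff_curl hη i) i).continuous.memLp_of_hasCompactSupport (hcp i)
  have hi1 : ∀ i : Fin 3, Integrable (fun p => g p i * curl η p i) (volume.restrict Ω) := fun i =>
    (hgi i).integrable_mul (hcL i)
  have hi2 : ∀ i : Fin 3, Integrable (fun p => u p * pderiv i (fun p => curl η p i) p)
      (volume.restrict Ω) := fun i => hu.integrable_mul (hpL i)
  have e1 : ∀ p, inner ℝ (g p) (curl η p) = ∑ i, g p i * curl η p i := fun p => by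
    simp [PiLp.inner_apply, mul_comm]
  simp only [e1]
  rw [integral_finsetSum _ fun i _ => hi1 i]
  have e2 : ∀ i : Fin 3, ∫ p in Ω, g p i * curl η p i =
      -∫ p in Ω, u p * pderiv i (fun p => curl η p i) p := fun i => by
    rw [h _ (contDiff_curl hη i) (hcc i) ((tsupport_curl_subset η i).trans hs) i, neg_neg]
  simp only [e2, Finset.sum_neg_distrib]
  rw [← integral_finsetSum _ fun i _ => hi2 i]
  simp only [← Finset.mul_sum, div_curl hη, mul_zero, integral_zero, neg_zero]

end Smooth

variable {Nn Ed Fa : Type*} [Fintype Nn] [Fintype Ed] [Fintype Fa]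

/-- The entries are sums of node indicators around the closed boundary walk of a face, and such sums
telescope. -/
theorem IsGridIncidence.curl_mul_grad {C : Matrix Fa Ed ℝ} {S : Matrix Nn Ed ℝ}
    (h : IsGridIncidence C S) : C * Sᵀ = 0 := by
  classical
  obtain ⟨tail, head, len, step, hw, hS, hC⟩ := h
  ext l j
  simp only [mul_apply, transpose_apply, Matrix.zero_apply]
  have hS' : ∀ k, S j k = -((if head k = some j then 1 else 0) -
      (if tail k = some j then 1 else 0)) := fun k => by
    rw [← neg_neg (S j k), hS j k]
  have hC' : ∀ k, C l k = ∑ m, if (step l m).1 = k then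
      (if (step l m).2 then 1 else -1) else 0 := fun k => by
    rw [hC l k]
  -- `st m` is the node where step `m` starts. It is also where the previous step ends, with `m + 1`
  -- taken cyclically in `Fin (len l + 1)`, so the two sums differ by a cyclic shift.
  set st : Fin (len l + 1) → Option Nn := fun m =>
    if (step l m).2 then tail (step l m).1 else head (step l m).1 with hst
  have e1 : ∑ k, C l k * S j k = ∑ m, ((if st m = some j then (1:ℝ) else 0) -
      (if st (m + 1) = some j then 1 else 0)) := by
    simp only [hC', Finset.sum_mul]
    rw [Finset.sum_comm]
    refine Finset.sum_congr rfl fun m _ => ?_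
    simp only [ite_mul, zero_mul, Finset.sum_ite_eq, Finset.mem_univ, if_true]
    have hm : st (m + 1) = if (step l m).2 then head (step l m).1 else tail (step l m).1 :=
      (hw l m).symm
    have hm' : st m = if (step l m).2 then tail (step l m).1 else head (step l m).1 := rfl
    rw [hS', hm, hm']
    cases (step l m).2 <;> simp
  rw [e1, Finset.sum_sub_distrib, sub_eq_zero]
  exact (Equiv.sum_comp (Equiv.addRight (1 : Fin (len l + 1)))
    (fun m => if st m = some j then (1:ℝ) else 0)).symm

/-! ### `C Sᵀ = 0` for Finite Element sequences. -/

namespace Discretisation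

variable (D : Discretisation Nn Ed Fa)

open scoped ContDiff in
-- The `j`-th discrete gradient is a weak gradient, so its weak curl is zero. That weak curl is
-- also, up to sign, the face field whose coefficients are column `j` of `C Sᵀ`. The face field
-- therefore vanishes almost everywhere, and independence of the face fields finishes the proof.
theorem curl_mul_grad_of_isFiniteElementSequence
    (h : IsFiniteElementSequence D.Ω D.edge D.face D.C D.S) : D.C * D.Sᵀ = 0 := by
  obtain ⟨⟨nodal, hn⟩, hcurl⟩ := h
  ext l j
  have hE : MemLp (fun p => -∑ k, D.S j k • D.edge k p) 2 (volume.restrict D.Ω) :=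
    (memLp_finsetSum _ fun k _ => (D.memLp_edge k).const_smul (D.S j k)).neg
  set c : Fa → ℝ := fun l => (D.C * D.Sᵀ) l j with hcdef
  have hF : MemLp (fun p => ∑ l, c l • D.face l p) 2 (volume.restrict D.Ω) :=
    memLp_finsetSum _ fun k _ => (D.memLp_face k).const_smul (c k)
  have key : ∀ η : R3 → R3, ContDiff ℝ ∞ η → HasCompactSupport η → tsupport η ⊆ D.Ω →
      ∫ p in D.Ω, inner ℝ (∑ l, c l • D.face l p) (η p) = 0 := by
    intro η hη hc hs
    have hηL : MemLp η 2 (volume.restrict D.Ω) :=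
      hη.continuous.memLp_of_hasCompactSupport hc
    have hcL : MemLp (curl η) 2 (volume.restrict D.Ω) := by
      have : Continuous (curl η) := by
        rw [← (WithLp.linearEquiv 2 ℝ (Fin 3 → ℝ)).toContinuousLinearEquiv.comp_continuous_iff]
        exact continuous_pi fun i => (contDiff_curl hη i).continuous
      refine this.memLp_of_hasCompactSupport (hc.of_isClosed_subset (isClosed_tsupport _) ?_)
      refine closure_minimal (fun p hp => ?_) (isClosed_tsupport _)
      by_contra hp'
      refine hp (PiLp.ext fun i => ?_)
      by_contra hi
      exact hp' (tsupport_curl_subset η i (subset_tsupport _ hi))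
    have hint1 : ∀ k, Integrable (fun p => inner ℝ (D.edge k p) (curl η p))
        (volume.restrict D.Ω) := fun k => by
      refine ((D.memLp_edge k).norm.integrable_mul hcL.norm).mono'
        ((D.memLp_edge k).1.inner hcL.1) (Eventually.of_forall fun p => ?_)
      exact norm_inner_le_norm _ _
    have hint2 : ∀ l, Integrable (fun p => inner ℝ (D.face l p) (η p))
        (volume.restrict D.Ω) := fun k => by
      refine ((D.memLp_face k).norm.integrable_mul hηL.norm).mono'
        ((D.memLp_face k).1.inner hηL.1) (Eventually.of_forall fun p => ?_)
      exact norm_inner_le_norm _ _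
    have h0 := integral_inner_curl_of_hasWeakGrad (hn j).1 hE (hn j).2 hη hc hs
    simp only [inner_neg_left, sum_inner, real_inner_smul_left] at h0
    rw [integral_neg, neg_eq_zero, integral_finsetSum _ fun k _ => (hint1 k).const_mul _] at h0
    simp only [integral_const_mul] at h0
    have h1 : ∀ k, ∫ p in D.Ω, inner ℝ (D.edge k p) (curl η p) =
        ∑ l, D.C l k * ∫ p in D.Ω, inner ℝ (D.face l p) (η p) := fun k => by
      rw [hcurl k η hη hc hs]
      simp only [sum_inner, real_inner_smul_left]
      rw [integral_finsetSum _ fun l _ => (hint2 l).const_mul _]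
      simp only [integral_const_mul]
    simp only [h1, Finset.mul_sum] at h0
    rw [Finset.sum_comm] at h0
    simp only [sum_inner, real_inner_smul_left]
    rw [integral_finsetSum _ fun l _ => (hint2 l).const_mul _]
    simp only [integral_const_mul]
    rw [← h0]
    refine Finset.sum_congr rfl fun l _ => ?_
    rw [hcdef]
    simp only [mul_apply, transpose_apply, Finset.sum_mul]
    refine Finset.sum_congr rfl fun k _ => by ring
  -- Test fields `g • e_m` with scalar `g` reduce the vector statement to the fundamental lemma of
  -- the calculus of variations for each component.
  have hzero : ∀ m : Fin 3, ∀ᵐ p, p ∈ D.Ω → (∑ l, c l • D.face l p) m = 0 := by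
    intro m
    have hFm : MemLp (fun p => (∑ l, c l • D.face l p) m) 2 (volume.restrict D.Ω) :=
      hF.continuousLinearMap_comp (EuclideanSpace.proj m : R3 →L[ℝ] ℝ)
    refine D.isOpen.ae_eq_zero_of_integral_contDiff_smul_eq_zero
      (locallyIntegrableOn_of_locallyIntegrable_restrict
        (hFm.locallyIntegrable (by norm_num))) fun g hg hgc hgs => ?_
    have hsub : tsupport (fun p => g p • (EuclideanSpace.single m 1 : R3)) ⊆ tsupport g :=
      tsupport_smul_subset_left _ _
    have := key (fun p => g p • EuclideanSpace.single m 1) (hg.smul contDiff_const)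
      (hgc.of_isClosed_subset (isClosed_tsupport _) hsub) (hsub.trans hgs)
    simp only [inner_smul_right, EuclideanSpace.inner_single_right] at this
    rw [← setIntegral_eq_integral_of_forall_compl_eq_zero (s := D.Ω) (fun p hp => by
      rw [image_eq_zero_of_notMem_tsupport fun h => hp (hgs h), zero_smul])]
    simpa using this
  have hc0 := D.indep_face c (by
    rw [ae_restrict_iff' D.isOpen.measurableSet]
    filter_upwards [ae_all_iff.2 hzero] with p hp hpΩ
    exact PiLp.ext fun m => hp m hpΩ)
  exact congrFun hc0 l

theorem curl_mul_grad : D.C * D.Sᵀ = 0 :=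
  D.deRham.elim D.curl_mul_grad_of_isFiniteElementSequence fun h => h.curl_mul_grad

end Discretisation

/-! ### Linear algebra of the coupled system -/

section LinearAlgebra

variable {m n : Type*} [Fintype m] [Fintype n]

theorem dotProduct_mulVec_eq (M : Matrix m n ℝ) (x : m → ℝ) (y : n → ℝ) :
    x ⬝ᵥ (M *ᵥ y) = (Mᵀ *ᵥ x) ⬝ᵥ y := by
  rw [dotProduct_mulVec, mulVec_transpose]

/-- Multiplication by a matrix as a continuous linear map. -/
noncomputable def mulVecCLM (M : Matrix m n ℝ) : (n → ℝ) →L[ℝ] (m → ℝ) :=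
  LinearMap.toContinuousLinearMap M.mulVecLin

@[fun_prop]
theorem differentiable_mulVec {E : Type*} [NormedAddCommGroup E] [NormedSpace ℝ E]
    (M : Matrix m n ℝ) {f : E → n → ℝ} (hf : Differentiable ℝ f) :
    Differentiable ℝ (fun p => M *ᵥ f p) :=
  (mulVecCLM M).differentiable.comp hf

/-- A linear map `C` with `x · C x > 0` for `x ≠ 0`. -/
def IsPosDefMap (C : (n → ℝ) →ₗ[ℝ] (n → ℝ)) : Prop :=
  ∀ w, w ≠ 0 → 0 < w ⬝ᵥ C w

theorem IsPosDefMap.eq_zero {C : (n → ℝ) →ₗ[ℝ] (n → ℝ)} (hC : IsPosDefMap C) {w : n → ℝ}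
    (h : w ⬝ᵥ C w = 0) : w = 0 := by
  by_contra hw
  exact (hC w hw).ne' h

theorem IsPosDefMap.surjective {C : (n → ℝ) →ₗ[ℝ] (n → ℝ)} (hC : IsPosDefMap C) :
    Function.Surjective C := by
  refine LinearMap.surjective_of_injective (LinearMap.ker_eq_bot.1 (LinearMap.ker_eq_bot'.2 ?_))
  exact fun w hw => hC.eq_zero (by rw [hw, dotProduct_zero])

/-- `im (A C Aᵀ) = im A` for positive definite `C`. -/
theorem IsPosDefMap.range_congruence {C : (n → ℝ) →ₗ[ℝ] (n → ℝ)} (hC : IsPosDefMap C)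
    (A : Matrix m n ℝ) (c : n → ℝ) : ∃ e : m → ℝ, A *ᵥ C (Aᵀ *ᵥ e) = A *ᵥ c := by
  classical
  set M : (m → ℝ) →ₗ[ℝ] (m → ℝ) := A.mulVecLin ∘ₗ C ∘ₗ Aᵀ.mulVecLin with hM
  -- Definiteness gives `A C Aᵀ` the kernel of `Aᵀ`, so by rank-nullity and equality of row and
  -- column rank its range has the dimension of the range of `A`, in which it is contained.
  have hker : LinearMap.ker M = LinearMap.ker Aᵀ.mulVecLin := by
    ext e
    simp only [LinearMap.mem_ker, hM, LinearMap.comp_apply, mulVecLin_apply]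
    refine ⟨fun h => hC.eq_zero ?_, fun h => by rw [h, map_zero, mulVec_zero]⟩
    rw [← dotProduct_mulVec_eq, h, dotProduct_zero]
  have hle : LinearMap.range M ≤ LinearMap.range A.mulVecLin :=
    LinearMap.range_comp_le_range _ _
  have h1 := LinearMap.finrank_range_add_finrank_ker M
  have h2 := LinearMap.finrank_range_add_finrank_ker Aᵀ.mulVecLin
  have h3 : Module.finrank ℝ (LinearMap.range Aᵀ.mulVecLin) =
      Module.finrank ℝ (LinearMap.range A.mulVecLin) := rank_transpose A
  rw [hker] at h1
  have heq := Submodule.eq_of_le_of_finrank_eq hle (by omega)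
  have : A *ᵥ c ∈ LinearMap.range M := by rw [heq]; exact ⟨c, rfl⟩
  exact this

end LinearAlgebra

/-- The properties of the linearisation `A (x', i') + B (x, i) + Bv v = 0` of an element DAE that
determine the index-2 components of a circuit containing it. -/
structure IsPassivePencil {ι κ : Type*} [Fintype κ]
    (A B : (ι → ℝ) × (κ → ℝ) →ₗ[ℝ] (ι ⊕ κ → ℝ)) (Bv : Matrix (ι ⊕ κ) κ ℝ) : Prop where
  eq_zero : ∀ ξ ζ u, A ξ = 0 → B ξ + Bv *ᵥ u = A ζ → ξ = 0
  voltage_mem : ∀ u, ∃ ζ, Bv *ᵥ u = A ζ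
  passive : ∀ ξ ζ u u', A ξ + Bv *ᵥ u = 0 → B ξ + Bv *ᵥ u' = A ζ → u ≠ 0 → 0 < u ⬝ᵥ ξ.2

section Circuit

variable {Nd Cap Res Ind Vol Cur κ ι : Type*} [Fintype Nd] [DecidableEq Nd] [Fintype Cap]
  [Fintype Res] [Fintype Ind] [Fintype Vol] [Fintype Cur] [Fintype κ] [Fintype ι]

/-- The index-2 components of the coupled system: node potentials that are constant across
capacitors, resistors and voltage sources, and currents of voltage sources that can be
closed through capacitors. -/
def circuitIndexTwoSpace (ckt : Circuit Nd Cap Res Ind Vol Cur κ) (ι : Type*) :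
    Submodule ℝ (CoupledVar Nd Ind Vol ι κ) where
  carrier := {w | (incidence ckt.brR)ᵀ *ᵥ w.1 = 0 ∧ (incidence ckt.brC)ᵀ *ᵥ w.1 = 0 ∧
    (incidence ckt.brV)ᵀ *ᵥ w.1 = 0 ∧ (∃ c, incidence ckt.brV *ᵥ w.2.2.1 = incidence ckt.brC *ᵥ c) ∧
    w.2.1 = 0 ∧ w.2.2.2 = 0}
  zero_mem' := by
    refine ⟨by simp, by simp, by simp, ⟨0, by simp⟩, rfl, rfl⟩
  add_mem' := by
    rintro a b ⟨h1, h2, h3, ⟨c, h4⟩, h5, h6⟩ ⟨h1', h2', h3', ⟨c', h4'⟩, h5', h6'⟩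
    refine ⟨?_, ?_, ?_, ⟨c + c', ?_⟩, ?_, ?_⟩ <;> simp [mulVec_add, *]
  smul_mem' := by
    rintro r a ⟨h1, h2, h3, ⟨c, h4⟩, h5, h6⟩
    refine ⟨?_, ?_, ?_, ⟨r • c, ?_⟩, ?_, ?_⟩ <;> simp [mulVec_smul, *]

variable {ckt : Circuit Nd Cap Res Ind Vol Cur κ}
  {A B : (ι → ℝ) × (κ → ℝ) →ₗ[ℝ] (ι ⊕ κ → ℝ)} {Bv : Matrix (ι ⊕ κ) κ ℝ}
  {C Kq : (Cap → ℝ) →ₗ[ℝ] (Cap → ℝ)} {G : (Res → ℝ) →ₗ[ℝ] (Res → ℝ)}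
  {L KL : (Ind → ℝ) →ₗ[ℝ] (Ind → ℝ)}
  {JA JB : CoupledVar Nd Ind Vol ι κ → CoupledEq Nd Ind Vol ι κ}

/-- The preimage `ζ` is assembled blockwise: capacitor potentials from `range_congruence`, inductor
currents from invertibility of `L`, element variables from `voltage_mem`. Conversely, definiteness
and `eq_zero` remove all components but potentials and source currents. -/
theorem mem_circuitIndexTwoSpace_iff (hp : IsPassivePencil A B Bv) (hC : IsPosDefMap C)
    (hG : IsPosDefMap G) (hL : IsPosDefMap L)
    (hJA : ∀ w, JA w = (incidence ckt.brC *ᵥ C ((incidence ckt.brC)ᵀ *ᵥ w.1), L w.2.1, 0,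
      A w.2.2.2))
    (hJB : ∀ w, JB w = (incidence ckt.brC *ᵥ Kq ((incidence ckt.brC)ᵀ *ᵥ w.1)
      + incidence ckt.brR *ᵥ G ((incidence ckt.brR)ᵀ *ᵥ w.1) + incidence ckt.brL *ᵥ w.2.1
      + incidence ckt.brV *ᵥ w.2.2.1 + incidence ckt.brLam *ᵥ w.2.2.2.2,
      KL w.2.1 - (incidence ckt.brL)ᵀ *ᵥ w.1, (incidence ckt.brV)ᵀ *ᵥ w.1,
      B w.2.2.2 + Bv *ᵥ ((incidence ckt.brLam)ᵀ *ᵥ w.1)))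
    (w : CoupledVar Nd Ind Vol ι κ) :
    w ∈ circuitIndexTwoSpace ckt ι ↔ JA w = 0 ∧ ∃ ζ, JA ζ = JB w := by
  simp only [hJA, hJB, Prod.mk.injEq, Prod.mk_eq_zero, true_and]
  constructor
  · rintro ⟨hR, hCe, hV, ⟨c, hc⟩, hl, hξ⟩
    refine ⟨⟨by rw [hCe, map_zero, mulVec_zero], by rw [hl, map_zero],
      by rw [hξ, map_zero]⟩, ?_⟩
    obtain ⟨e', he'⟩ := hC.range_congruence (incidence ckt.brC) c
    obtain ⟨l', hl'⟩ := hL.surjective (KL w.2.1 - (incidence ckt.brL)ᵀ *ᵥ w.1)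
    obtain ⟨ζ, hζ⟩ := hp.voltage_mem ((incidence ckt.brLam)ᵀ *ᵥ w.1)
    refine ⟨(e', l', 0, ζ), ?_, hl', hV.symm, ?_⟩
    · have : w.2.2.2.2 = 0 := by rw [hξ]; rfl
      simp only [he', hCe, hR, hl, this, map_zero, mulVec_zero, hc, zero_add, add_zero]
    · rw [hξ, map_zero, zero_add, hζ]
  · rintro ⟨⟨h1, h2, h4⟩, ζ, k1, -, k3, k4⟩
    have hξ : w.2.2.2 = 0 := hp.eq_zero _ _ _ h4 k4.symm
    have hl : w.2.1 = 0 := hL.eq_zero (by rw [h2, dotProduct_zero])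
    have hCe : (incidence ckt.brC)ᵀ *ᵥ w.1 = 0 :=
      hC.eq_zero (by rw [← dotProduct_mulVec_eq, h1, dotProduct_zero])
    have hi : w.2.2.2.2 = 0 := by rw [hξ]; rfl
    simp only [hCe, hl, hi, map_zero, mulVec_zero, zero_add, add_zero] at k1
    -- Testing the current law with the potential `w.1` itself cancels the capacitor and voltage
    -- source terms and leaves the resistive power.
    have hR : (incidence ckt.brR)ᵀ *ᵥ w.1 = 0 := by
      refine hG.eq_zero ?_
      have := congrArg (fun a => w.1 ⬝ᵥ a) k1
      simp only [dotProduct_add, dotProduct_mulVec_eq, hCe, ← k3, zero_dotProduct,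
        add_zero] at this
      exact this.symm
    refine ⟨hR, hCe, k3.symm, ⟨C ((incidence ckt.brC)ᵀ *ᵥ ζ.1), ?_⟩, hl, hξ⟩
    rw [hR, map_zero, mulVec_zero, zero_add] at k1
    exact k1.symm

/-- First, the law for `w₁` paired with its own potential gives `A_V i_V = 0` for the source
currents of `w₀`, and there are no voltage source loops. Then the next law, paired with the
potential `e` of `w₀`, leaves `(A_Lᵀ e) · i_L + (A_λᵀ e) · i_λ = 0` with the currents of `w₁`. Here
`A_Lᵀ e = L i_L`, so the first term is nonnegative, and passivity makes the second positive unless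
`A_λᵀ e = 0`. So `e` is constant across every branch type in the cutset condition. -/
theorem index_le_two_of_isPassivePencil {I : Set ℝ} (hw : ckt.WellPosed I)
    (hp : IsPassivePencil A B Bv) (hC : IsPosDefMap C)
    (hG : IsPosDefMap G) (hL : IsPosDefMap L)
    (hJA : ∀ w, JA w = (incidence ckt.brC *ᵥ C ((incidence ckt.brC)ᵀ *ᵥ w.1), L w.2.1, 0,
      A w.2.2.2))
    (hJB : ∀ w, JB w = (incidence ckt.brC *ᵥ Kq ((incidence ckt.brC)ᵀ *ᵥ w.1)
      + incidence ckt.brR *ᵥ G ((incidence ckt.brR)ᵀ *ᵥ w.1) + incidence ckt.brL *ᵥ w.2.1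
      + incidence ckt.brV *ᵥ w.2.2.1 + incidence ckt.brLam *ᵥ w.2.2.2.2,
      KL w.2.1 - (incidence ckt.brL)ᵀ *ᵥ w.1, (incidence ckt.brV)ᵀ *ᵥ w.1,
      B w.2.2.2 + Bv *ᵥ ((incidence ckt.brLam)ᵀ *ᵥ w.1)))
    {w₀ w₁ w₂ : CoupledVar Nd Ind Vol ι κ} (h0 : JA w₀ = 0) (h1 : JA w₁ + JB w₀ = 0)
    (h2 : JA w₂ + JB w₁ = 0) : w₀ = 0 := by
  have hneg : ∀ w, JA (-w) = -JA w := fun w => by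
    simp [hJA, mulVec_neg]
  obtain ⟨hR, hCe, hV, -, hl, hξ⟩ := (mem_circuitIndexTwoSpace_iff hp hC hG hL hJA hJB w₀).2
    ⟨h0, -w₁, by rw [hneg]; exact neg_eq_of_add_eq_zero_right h1⟩
  have hi : w₀.2.2.2.2 = 0 := by rw [hξ]; rfl
  simp only [hJA, hJB, Prod.mk_add_mk, Prod.mk_eq_zero] at h1 h2
  obtain ⟨a1, a2, -, a4⟩ := h1
  obtain ⟨b1, -, b3, b4⟩ := h2
  simp only [hCe, hR, hl, hi, map_zero, mulVec_zero, zero_add, add_zero, zero_sub] at a1 a2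
  rw [hξ, map_zero, zero_add] at a4
  rw [zero_add] at b3
  have hC1 : (incidence ckt.brC)ᵀ *ᵥ w₁.1 = 0 := by
    refine hC.eq_zero ?_
    have := congrArg (fun a => w₁.1 ⬝ᵥ a) a1
    simpa only [dotProduct_add, dotProduct_mulVec_eq, b3, zero_dotProduct, add_zero,
      dotProduct_zero] using this
  have hv : w₀.2.2.1 = 0 := hw.no_loop _ (by
    rwa [hC1, map_zero, mulVec_zero, zero_add] at a1)
  have hsum : ((incidence ckt.brL)ᵀ *ᵥ w₀.1) ⬝ᵥ w₁.2.1 +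
      ((incidence ckt.brLam)ᵀ *ᵥ w₀.1) ⬝ᵥ w₁.2.2.2.2 = 0 := by
    have := congrArg (fun a => w₀.1 ⬝ᵥ a) b1
    simpa only [dotProduct_add, dotProduct_mulVec_eq, hCe, hR, hV, zero_dotProduct, zero_add,
      add_zero, dotProduct_zero] using this
  have hLl : (incidence ckt.brL)ᵀ *ᵥ w₀.1 = L w₁.2.1 := (eq_of_sub_eq_zero (by
    rw [sub_eq_add_neg]; exact a2)).symm
  have b4' : B w₁.2.2.2 + Bv *ᵥ ((incidence ckt.brLam)ᵀ *ᵥ w₁.1) = A (-w₂.2.2.2) := by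
    rw [map_neg]; exact eq_neg_of_add_eq_zero_right b4
  have hnonneg : 0 ≤ w₁.2.1 ⬝ᵥ L w₁.2.1 := by
    by_cases h : w₁.2.1 = 0
    · rw [h, zero_dotProduct]
    · exact (hL _ h).le
  rw [hLl, dotProduct_comm] at hsum
  have hlam : (incidence ckt.brLam)ᵀ *ᵥ w₀.1 = 0 := by
    by_contra h
    have := hp.passive _ _ _ _ a4 b4' h
    linarith
  rw [hlam, zero_dotProduct, add_zero] at hsum
  have he : w₀.1 = 0 := hw.no_cutset _ hR hCe hV (by rw [hLl, hL.eq_zero hsum, map_zero]) hlam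
  exact Prod.ext he (Prod.ext hl (Prod.ext hv hξ))

/-! ### Jacobians of the coupled system -/

theorem fderiv_partial_fst {E F W : Type*} [NormedAddCommGroup E] [NormedSpace ℝ E]
    [NormedAddCommGroup F] [NormedSpace ℝ F] [NormedAddCommGroup W] [NormedSpace ℝ W]
    {f : E × F → W} (hf : Differentiable ℝ f) (a : E) (b : F) (w : E) :
    fderiv ℝ (fun x => f (x, b)) a w = fderiv ℝ f (a, b) (w, 0) := by
  have := HasFDerivAt.comp (f := fun x => (x, b)) a (hf (a, b)).hasFDerivAt
    ((hasFDerivAt_id a).prodMk (hasFDerivAt_const b a))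
  have h2 : fderiv ℝ (fun x => f (x, b)) a = _ := this.fderiv
  rw [h2]
  rfl

variable {F : ElementDAE ι κ}

theorem jacDot_coupledDAE (ckt : Circuit Nd Cap Res Ind Vol Cur κ)
    {y z : CoupledVar Nd Ind Vol ι κ} {t : ℝ} {A : (ι → ℝ) × (κ → ℝ) →L[ℝ] (ι ⊕ κ → ℝ)}
    (hA : HasFDerivAt (fun p : (ι → ℝ) × (κ → ℝ) => F p.1 p.2 z.2.2.2.1 z.2.2.2.2
      ((incidence ckt.brLam)ᵀ *ᵥ z.1) t) A y.2.2.2) (w : CoupledVar Nd Ind Vol ι κ) :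
    jacDot (coupledDAE ckt F) y z t w = (incidence ckt.brC *ᵥ
        fderiv ℝ ckt.q ((incidence ckt.brC)ᵀ *ᵥ z.1, t) ((incidence ckt.brC)ᵀ *ᵥ w.1, 0),
      fderiv ℝ ckt.phiL (z.2.1, t) (w.2.1, 0), 0, A w.2.2.2) := by
  have h1 := (mulVecCLM (incidence ckt.brC)).hasFDerivAt.comp y
    ((fderiv ℝ ckt.q ((incidence ckt.brC)ᵀ *ᵥ z.1, t)).hasFDerivAt.comp y
      (((mulVecCLM (incidence ckt.brC)ᵀ).hasFDerivAt.comp y hasFDerivAt_fst).prodMk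
        (hasFDerivAt_const (1:ℝ) y)))
  have h2 := (fderiv ℝ ckt.phiL (z.2.1, t)).hasFDerivAt.comp y
    ((((ContinuousLinearMap.fst ℝ _ _).comp (ContinuousLinearMap.snd ℝ (Nd → ℝ)
      ((Ind → ℝ) × (Vol → ℝ) × (ι → ℝ) × (κ → ℝ)))).hasFDerivAt (x := y)).prodMk
        (hasFDerivAt_const (1:ℝ) y))
  have h4 := hA.comp y (((ContinuousLinearMap.snd ℝ (Vol → ℝ) ((ι → ℝ) × (κ → ℝ))).comp
    ((ContinuousLinearMap.snd ℝ (Ind → ℝ) ((Vol → ℝ) × (ι → ℝ) × (κ → ℝ))).comp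
      (ContinuousLinearMap.snd ℝ (Nd → ℝ)
        ((Ind → ℝ) × (Vol → ℝ) × (ι → ℝ) × (κ → ℝ))))).hasFDerivAt (x := y))
  have h := ((((((h1.add_const
    (incidence ckt.brR *ᵥ ckt.g ((incidence ckt.brR)ᵀ *ᵥ z.1, t))).add_const
    (incidence ckt.brL *ᵥ z.2.1)).add_const (incidence ckt.brV *ᵥ z.2.2.1)).add_const
    (incidence ckt.brLam *ᵥ z.2.2.2.2)).add_const (incidence ckt.brI *ᵥ ckt.isrc t)).prodMk
    ((h2.sub_const ((incidence ckt.brL)ᵀ *ᵥ z.1)).prodMk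
      ((hasFDerivAt_const ((incidence ckt.brV)ᵀ *ᵥ z.1 - ckt.vsrc t) y).prodMk h4)))
  have h' : jacDot (coupledDAE ckt F) y z t = _ := h.fderiv
  rw [h']
  rfl

/-- `Kq` and `KL` collect the second derivatives of `q` and `φ_L`. Only their existence matters:
they act through `A_Cᵀ e` and `i_L`, which vanish on index-2 components. -/
theorem jac_coupledDAE (ckt : Circuit Nd Cap Res Ind Vol Cur κ)
    (hq : ContDiff ℝ 2 ckt.q) (hg : ContDiff ℝ 1 ckt.g) (hphi : ContDiff ℝ 2 ckt.phiL)
    {Bv : Matrix (ι ⊕ κ) κ ℝ}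
    (hv : ∀ x' i' x i v t, F x' i' x i v t = F x' i' x i 0 t + Bv *ᵥ v)
    {y z : CoupledVar Nd Ind Vol ι κ} {t : ℝ} {B : (ι → ℝ) × (κ → ℝ) →L[ℝ] (ι ⊕ κ → ℝ)}
    (hB : HasFDerivAt (fun p : (ι → ℝ) × (κ → ℝ) => F y.2.2.2.1 y.2.2.2.2 p.1 p.2
      ((incidence ckt.brLam)ᵀ *ᵥ z.1) t) B z.2.2.2) :
    ∃ (Kq : (Cap → ℝ) →ₗ[ℝ] (Cap → ℝ)) (KL : (Ind → ℝ) →ₗ[ℝ] (Ind → ℝ)),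
    ∀ w : CoupledVar Nd Ind Vol ι κ,
    jac (coupledDAE ckt F) y z t w = (incidence ckt.brC *ᵥ Kq ((incidence ckt.brC)ᵀ *ᵥ w.1)
      + incidence ckt.brR *ᵥ fderiv ℝ ckt.g ((incidence ckt.brR)ᵀ *ᵥ z.1, t)
        ((incidence ckt.brR)ᵀ *ᵥ w.1, 0) + incidence ckt.brL *ᵥ w.2.1
      + incidence ckt.brV *ᵥ w.2.2.1 + incidence ckt.brLam *ᵥ w.2.2.2.2,
      KL w.2.1 - (incidence ckt.brL)ᵀ *ᵥ w.1, (incidence ckt.brV)ᵀ *ᵥ w.1,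
      B w.2.2.2 + Bv *ᵥ ((incidence ckt.brLam)ᵀ *ᵥ w.1)) := by
  have hq' : Differentiable ℝ (fun v : Cap → ℝ =>
      fderiv ℝ ckt.q (v, t) ((incidence ckt.brC)ᵀ *ᵥ y.1, 1)) := by
    have : Differentiable ℝ (fderiv ℝ ckt.q) :=
      (hq.fderiv_right (m := 1) (by norm_num)).differentiable one_ne_zero
    fun_prop
  have hphi' : Differentiable ℝ (fun l : Ind → ℝ => fderiv ℝ ckt.phiL (l, t) (y.2.1, 1)) := by
    have : Differentiable ℝ (fderiv ℝ ckt.phiL) :=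
      (hphi.fderiv_right (m := 1) (by norm_num)).differentiable one_ne_zero
    fun_prop
  refine ⟨fderiv ℝ (fun v : Cap → ℝ =>
      fderiv ℝ ckt.q (v, t) ((incidence ckt.brC)ᵀ *ᵥ y.1, 1)) ((incidence ckt.brC)ᵀ *ᵥ z.1),
    fderiv ℝ (fun l : Ind → ℝ => fderiv ℝ ckt.phiL (l, t) (y.2.1, 1)) z.2.1, fun w => ?_⟩
  let π₁ := ContinuousLinearMap.fst ℝ (Nd → ℝ) ((Ind → ℝ) × (Vol → ℝ) × (ι → ℝ) × (κ → ℝ))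
  let σ₁ := ContinuousLinearMap.snd ℝ (Nd → ℝ) ((Ind → ℝ) × (Vol → ℝ) × (ι → ℝ) × (κ → ℝ))
  let π₂ := (ContinuousLinearMap.fst ℝ (Ind → ℝ) ((Vol → ℝ) × (ι → ℝ) × (κ → ℝ))).comp σ₁
  let σ₂ := (ContinuousLinearMap.snd ℝ (Ind → ℝ) ((Vol → ℝ) × (ι → ℝ) × (κ → ℝ))).comp σ₁
  let π₃ := (ContinuousLinearMap.fst ℝ (Vol → ℝ) ((ι → ℝ) × (κ → ℝ))).comp σ₂
  let σ₃ := (ContinuousLinearMap.snd ℝ (Vol → ℝ) ((ι → ℝ) × (κ → ℝ))).comp σ₂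
  let π₅ := (ContinuousLinearMap.snd ℝ (ι → ℝ) (κ → ℝ)).comp σ₃
  have hdC := ((mulVecCLM (incidence ckt.brC)ᵀ).comp π₁).hasFDerivAt (x := z)
  have hdR := ((mulVecCLM (incidence ckt.brR)ᵀ).comp π₁).hasFDerivAt (x := z)
  have c1 := (mulVecCLM (incidence ckt.brC)).hasFDerivAt.comp z
    (HasFDerivAt.comp (f := (mulVecCLM (incidence ckt.brC)ᵀ).comp π₁) z
      (hq' ((incidence ckt.brC)ᵀ *ᵥ z.1)).hasFDerivAt hdC)
  have c2 := (mulVecCLM (incidence ckt.brR)).hasFDerivAt.comp z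
    (HasFDerivAt.comp (f := fun z => (((mulVecCLM (incidence ckt.brR)ᵀ).comp π₁) z, t)) z
      ((hg.differentiable one_ne_zero) ((incidence ckt.brR)ᵀ *ᵥ z.1, t)).hasFDerivAt
      (hdR.prodMk (hasFDerivAt_const t z)))
  have c3 := ((mulVecCLM (incidence ckt.brL)).comp π₂).hasFDerivAt (x := z)
  have c4 := ((mulVecCLM (incidence ckt.brV)).comp π₃).hasFDerivAt (x := z)
  have c5 := ((mulVecCLM (incidence ckt.brLam)).comp π₅).hasFDerivAt (x := z)
  have d1 := HasFDerivAt.comp (f := π₂) z (hphi' z.2.1).hasFDerivAt π₂.hasFDerivAt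
  have d2 := ((mulVecCLM (incidence ckt.brL)ᵀ).comp π₁).hasFDerivAt (x := z)
  have e1 := ((mulVecCLM (incidence ckt.brV)ᵀ).comp π₁).hasFDerivAt (x := z)
  have f1 := HasFDerivAt.comp (f := σ₃) z hB σ₃.hasFDerivAt
  have f2 := ((mulVecCLM Bv).comp
    ((mulVecCLM (incidence ckt.brLam)ᵀ).comp π₁)).hasFDerivAt (x := z)
  have f3 := (f1.add f2).sub_const (Bv *ᵥ ((incidence ckt.brLam)ᵀ *ᵥ z.1))
  have h := (((((c1.add c2).add c3).add c4).add c5).add_const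
    (incidence ckt.brI *ᵥ ckt.isrc t)).prodMk
    ((d1.sub d2).prodMk ((e1.sub_const (ckt.vsrc t)).prodMk f3))
  -- Linearity in the voltage allows the element to be differentiated at the frozen voltage `A_λᵀ
  -- z.1`, the change of voltage contributing the exact term `Bv`.
  have h0 := h.congr_of_eventuallyEq (f₁ := fun z' => coupledDAE ckt F y z' t) (by
    refine Eventually.of_forall fun z' => Prod.ext rfl (Prod.ext rfl (Prod.ext rfl ?_))
    change F y.2.2.2.1 y.2.2.2.2 z'.2.2.2.1 z'.2.2.2.2 ((incidence ckt.brLam)ᵀ *ᵥ z'.1) t =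
      F y.2.2.2.1 y.2.2.2.2 z'.2.2.2.1 z'.2.2.2.2 ((incidence ckt.brLam)ᵀ *ᵥ z.1) t +
        Bv *ᵥ ((incidence ckt.brLam)ᵀ *ᵥ z'.1) - Bv *ᵥ ((incidence ckt.brLam)ᵀ *ᵥ z.1)
    rw [hv, hv _ _ _ _ ((incidence ckt.brLam)ᵀ *ᵥ z.1)]
    abel)
  have h' : jac (coupledDAE ckt F) y z t = _ := h0.fderiv
  rw [h']
  rfl

theorem differentiable_coupledDAE (ckt : Circuit Nd Cap Res Ind Vol Cur κ)
    (hq : ContDiff ℝ 2 ckt.q) (hg : ContDiff ℝ 1 ckt.g) (hphi : ContDiff ℝ 2 ckt.phiL)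
    (hF : Differentiable ℝ (fun p : (ι → ℝ) × (κ → ℝ) × (ι → ℝ) × (κ → ℝ) × (κ → ℝ) × ℝ =>
      F p.1 p.2.1 p.2.2.1 p.2.2.2.1 p.2.2.2.2.1 p.2.2.2.2.2)) (t : ℝ) :
    Differentiable ℝ (fun p : CoupledVar Nd Ind Vol ι κ × CoupledVar Nd Ind Vol ι κ =>
      coupledDAE ckt F p.1 p.2 t) := by
  have hq' : Differentiable ℝ (fderiv ℝ ckt.q) :=
    (hq.fderiv_right (m := 1) (by norm_num)).differentiable one_ne_zero
  have hphi' : Differentiable ℝ (fderiv ℝ ckt.phiL) :=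
    (hphi.fderiv_right (m := 1) (by norm_num)).differentiable one_ne_zero
  have hg' := hg.differentiable one_ne_zero
  unfold coupledDAE
  have h1 : Differentiable ℝ (fun p : CoupledVar Nd Ind Vol ι κ × CoupledVar Nd Ind Vol ι κ =>
      F p.1.2.2.2.1 p.1.2.2.2.2 p.2.2.2.2.1 p.2.2.2.2.2 ((incidence ckt.brLam)ᵀ *ᵥ p.2.1) t) :=
    hF.comp (f := fun p : CoupledVar Nd Ind Vol ι κ × CoupledVar Nd Ind Vol ι κ =>
      (p.1.2.2.2.1, p.1.2.2.2.2, p.2.2.2.2.1, p.2.2.2.2.2, (incidence ckt.brLam)ᵀ *ᵥ p.2.1, t))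
      (by fun_prop)
  fun_prop

/-- A circuit with an element whose linearisations are passive has linear index-2 components. -/
theorem hasLinearIndexTwoComponents_coupledDAE {I : Set ℝ}
    (ckt : Circuit Nd Cap Res Ind Vol Cur κ) (hw : ckt.WellPosed I)
    (hF : Differentiable ℝ (fun p : (ι → ℝ) × (κ → ℝ) × (ι → ℝ) × (κ → ℝ) × (κ → ℝ) × ℝ =>
      F p.1 p.2.1 p.2.2.1 p.2.2.2.1 p.2.2.2.2.1 p.2.2.2.2.2))
    {Bv : Matrix (ι ⊕ κ) κ ℝ}
    (hv : ∀ x' i' x i v t, F x' i' x i v t = F x' i' x i 0 t + Bv *ᵥ v)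
    (hp : ∀ (y z : (ι → ℝ) × (κ → ℝ)) (v : κ → ℝ), ∀ t ∈ I,
      ∃ A B : (ι → ℝ) × (κ → ℝ) →L[ℝ] (ι ⊕ κ → ℝ),
      HasFDerivAt (fun p : (ι → ℝ) × (κ → ℝ) => F p.1 p.2 z.1 z.2 v t) A y ∧
      HasFDerivAt (fun p : (ι → ℝ) × (κ → ℝ) => F y.1 y.2 p.1 p.2 v t) B z ∧
      IsPassivePencil (A : (ι → ℝ) × (κ → ℝ) →ₗ[ℝ] (ι ⊕ κ → ℝ)) B Bv) :
    HasLinearIndexTwoComponents I (coupledDAE ckt F) := by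
  have hdq := hw.smooth_q.differentiable two_ne_zero
  have hdg := hw.smooth_g.differentiable one_ne_zero
  have hdp := hw.smooth_phiL.differentiable two_ne_zero
  have hC : ∀ v, ∀ t ∈ I, IsPosDefMap ((fderiv ℝ ckt.q (v, t) : _ →ₗ[ℝ] _) ∘ₗ
      LinearMap.inl ℝ (Cap → ℝ) ℝ) := fun v t ht w hw0 => by
    have := hw.posDef_C v t ht w hw0
    rwa [fderiv_partial_fst hdq] at this
  have hG : ∀ v, ∀ t ∈ I, IsPosDefMap ((fderiv ℝ ckt.g (v, t) : _ →ₗ[ℝ] _) ∘ₗ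
      LinearMap.inl ℝ (Res → ℝ) ℝ) := fun v t ht w hw0 => by
    have := hw.posDef_G v t ht w hw0
    rwa [fderiv_partial_fst hdg] at this
  have hL : ∀ v, ∀ t ∈ I, IsPosDefMap ((fderiv ℝ ckt.phiL (v, t) : _ →ₗ[ℝ] _) ∘ₗ
      LinearMap.inl ℝ (Ind → ℝ) ℝ) := fun v t ht w hw0 => by
    have := hw.posDef_L v t ht w hw0
    rwa [fderiv_partial_fst hdp] at this
  refine ⟨fun t _ => differentiable_coupledDAE ckt hw.smooth_q hw.smooth_g hw.smooth_phiL hF t,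
    fun t ht y z => ?_, ?_⟩
  · obtain ⟨A, B, hA, hB, hAB⟩ := hp y.2.2.2 z.2.2.2 ((incidence ckt.brLam)ᵀ *ᵥ z.1) t ht
    obtain ⟨Kq, KL, hJB⟩ := jac_coupledDAE ckt hw.smooth_q hw.smooth_g hw.smooth_phiL hv hB
    exact fun w₀ w₁ w₂ => index_le_two_of_isPassivePencil hw hAB (hC _ t ht) (hG _ t ht)
      (hL _ t ht) (jacDot_coupledDAE ckt hA) hJB
  · obtain ⟨g, hg⟩ := LinearMap.exists_leftInverse_of_injective
      (circuitIndexTwoSpace ckt ι).subtype (Submodule.ker_subtype _)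
    have hg' : ∀ w : circuitIndexTwoSpace ckt ι, g w = w := fun w => LinearMap.congr_fun hg w
    set T := (circuitIndexTwoSpace ckt ι).subtype ∘ₗ g with hT
    have hTmem : ∀ z, T z ∈ circuitIndexTwoSpace ckt ι := fun z => (g z).2
    have hrange : LinearMap.range T = circuitIndexTwoSpace ckt ι := by
      refine le_antisymm ?_ fun w hw => ⟨w, congrArg Subtype.val (hg' ⟨w, hw⟩)⟩
      rintro _ ⟨z, rfl⟩
      exact hTmem z
    -- Potentials in the range of `T` are not seen by capacitors, resistors or voltage sources. They
    -- enter only through inductor and element voltages, and the source currents only through `A_V`.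
    let Bl : CoupledVar Nd Ind Vol ι κ →ₗ[ℝ] CoupledEq Nd Ind Vol ι κ :=
      { toFun := fun w => (incidence ckt.brV *ᵥ w.2.2.1, -((incidence ckt.brL)ᵀ *ᵥ w.1), 0,
          Bv *ᵥ ((incidence ckt.brLam)ᵀ *ᵥ w.1))
        map_add' := fun a b => by
          simp only [Prod.fst_add, Prod.snd_add, mulVec_add, neg_add, Prod.mk_add_mk, add_zero]
        map_smul' := fun r a => by
          simp only [Prod.smul_fst, Prod.smul_snd, mulVec_smul, RingHom.id_apply, Prod.smul_mk,
            smul_neg, smul_zero] }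
    refine ⟨T, Bl, fun z => congrArg Subtype.val (hg' (g z)), fun t ht y z => ?_,
      fun t _ y z => ?_⟩
    · obtain ⟨A, B, hA, hB, hAB⟩ := hp y.2.2.2 z.2.2.2 ((incidence ckt.brLam)ᵀ *ᵥ z.1) t ht
      obtain ⟨Kq, KL, hJB⟩ := jac_coupledDAE ckt hw.smooth_q hw.smooth_g hw.smooth_phiL hv hB
      rw [hrange]
      ext w
      rw [mem_circuitIndexTwoSpace_iff hAB (hC _ t ht) (hG _ t ht)
        (hL _ t ht) (jacDot_coupledDAE ckt hA) hJB]
      rfl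
    · obtain ⟨hR, hCe, hV, -, hl, hξ⟩ := hTmem z
      set w := T z
      have hi : w.2.2.2.2 = 0 := by rw [hξ]; rfl
      have hx : w.2.2.2.1 = 0 := by rw [hξ]; rfl
      refine Prod.ext ?_ (Prod.ext ?_ (Prod.ext ?_ ?_))
      · simp only [coupledDAE, Bl, LinearMap.coe_mk, AddHom.coe_mk, Prod.fst_add, Prod.fst_sub,
          Prod.snd_sub, mulVec_sub, hR, hCe, hl, hi, sub_zero]
        abel
      · simp only [coupledDAE, Bl, LinearMap.coe_mk, AddHom.coe_mk, Prod.fst_add, Prod.fst_sub,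
          Prod.snd_sub, Prod.snd_add, mulVec_sub, hl, sub_zero]
        abel
      · simp only [coupledDAE, Bl, LinearMap.coe_mk, AddHom.coe_mk, Prod.fst_add, Prod.fst_sub,
          Prod.snd_add, mulVec_sub, hV, sub_zero, add_zero]
      · simp only [coupledDAE, Bl, LinearMap.coe_mk, AddHom.coe_mk, Prod.fst_sub,
          Prod.snd_sub, Prod.snd_add, mulVec_sub, hi, hx, sub_zero]
        rw [hv, hv _ _ _ _ (_ - _), mulVec_sub]
        abel

end Circuit

/-! ### Inductance-like elements given by a regular linear system -/

section Element

variable {ι κ : Type*} [Fintype ι] [Fintype κ]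

/-- An element is inductance-like with `φ(i, x, t) = i` if `F = 0` and `(d/dt) F = 0` imply a
regular linear system `L(x, i) (x', i') = r(x, i) + (0, v)` for `(x', i')` whose response to the
voltage is passive. -/
theorem isInductanceLike_of_linearSystem {I : Set ℝ} {F : ElementDAE ι κ}
    (hF : Differentiable ℝ (fun p : (ι → ℝ) × (κ → ℝ) × (ι → ℝ) × (κ → ℝ) × (κ → ℝ) × ℝ =>
      F p.1 p.2.1 p.2.2.1 p.2.2.2.1 p.2.2.2.2.1 p.2.2.2.2.2))
    (L : (ι → ℝ) × (κ → ℝ) → (ι → ℝ) × (κ → ℝ) →ₗ[ℝ] (ι → ℝ) × (κ → ℝ))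
    (r : (ι → ℝ) × (κ → ℝ) → (ι → ℝ) × (κ → ℝ))
    (hL : ∀ ξ, Continuous fun s => L s ξ) (hr : Continuous r)
    (hinj : ∀ s ξ, L s ξ = 0 → ξ = 0)
    (hpos : ∀ s ξ u, L s ξ = (0, u) → u ≠ 0 → 0 < u ⬝ᵥ ξ.2)
    (hsol : ∀ (x : ℝ → ι → ℝ) (i v : ℝ → κ → ℝ), ContDiff ℝ 2 x → ContDiff ℝ 2 i →
      ContDiff ℝ 1 v → ∀ t ∈ I, F (deriv x t) (deriv i t) (x t) (i t) (v t) t = 0 →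
        HasDerivAt (fun τ => F (deriv x τ) (deriv i τ) (x τ) (i τ) (v τ) τ) 0 t →
        L (x t, i t) (deriv x t, deriv i t) = r (x t, i t) + (0, v t)) :
    IsInductanceLike I F := by
  let Lc : (ι → ℝ) × (κ → ℝ) → ((ι → ℝ) × (κ → ℝ)) →L[ℝ] ((ι → ℝ) × (κ → ℝ)) :=
    fun s => LinearMap.toContinuousLinearMap (L s)
  have hLc : Continuous Lc := continuous_clm_apply.2 hL
  have hunit : ∀ s, IsUnit (Lc s) := fun s => by
    have hi : Function.Injective (L s) := LinearMap.ker_eq_bot.1 (LinearMap.ker_eq_bot'.2 (hinj s))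
    rw [ContinuousLinearMap.isUnit_iff_bijective]
    exact ⟨hi, LinearMap.surjective_of_injective hi⟩
  -- `R s` inverts the system matrix at the state `s`; it is continuous in `s` because inversion is
  -- continuous at units of the Banach algebra of operators.
  let R : (ι → ℝ) × (κ → ℝ) → ((ι → ℝ) × (κ → ℝ)) →L[ℝ] ((ι → ℝ) × (κ → ℝ)) :=
    fun s => Ring.inverse (Lc s)
  have hR : Continuous R := by
    refine continuous_iff_continuousAt.2 fun s => ?_
    have := NormedRing.inverse_continuousAt (hunit s).unit
    exact ContinuousAt.comp (f := Lc) this hLc.continuousAt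
  have hLR : ∀ s ξ, L s (R s ξ) = ξ := fun s ξ => by
    have := Ring.mul_inverse_cancel _ (hunit s)
    exact congrArg (fun T : ((ι → ℝ) × (κ → ℝ)) →L[ℝ] ((ι → ℝ) × (κ → ℝ)) => T ξ) this
  have hRL : ∀ s ξ, R s (L s ξ) = ξ := fun s ξ => by
    have := Ring.inverse_mul_cancel _ (hunit s)
    exact congrArg (fun T : ((ι → ℝ) × (κ → ℝ)) →L[ℝ] ((ι → ℝ) × (κ → ℝ)) => T ξ) this
  have hcont : Continuous (fun p : (ι → ℝ) × (κ → ℝ) × (κ → ℝ) × ℝ =>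
      R (p.1, p.2.1) (r (p.1, p.2.1) + (0, p.2.2.1))) := by
    have h1 : Continuous (fun p : (ι → ℝ) × (κ → ℝ) × (κ → ℝ) × ℝ => R (p.1, p.2.1)) :=
      hR.comp (by fun_prop)
    have h2 : Continuous (fun p : (ι → ℝ) × (κ → ℝ) × (κ → ℝ) × ℝ => r (p.1, p.2.1)) :=
      hr.comp (by fun_prop)
    exact h1.clm_apply (h2.add (by fun_prop))
  refine ⟨hF, fun x i v _ => (R (x, i) (r (x, i) + (0, v))).1, fun i _ _ => i,
    fun x i v _ => (R (x, i) (r (x, i) + (0, v))).2, continuous_fst.comp hcont,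
    continuous_snd.comp hcont, contDiff_fst, ?_, ?_⟩
  · intro x i v hx hi hv t ht h0 h1
    have h := hsol x i v hx hi hv t ht h0 h1
    have h' : R (x t, i t) (r (x t, i t) + (0, v t)) = (deriv x t, deriv i t) := by
      rw [← h, hRL]
    simp only [h']
    exact ⟨((hx.differentiable two_ne_zero) t).hasDerivAt,
      ((hi.differentiable two_ne_zero) t).hasDerivAt⟩
  · intro i x t _
    have hid : fderiv ℝ (fun i' : κ → ℝ => i') i = ContinuousLinearMap.id ℝ (κ → ℝ) := fderiv_fun_id
    refine ⟨by rw [hid]; exact ⟨ContinuousLinearEquiv.refl ℝ _, rfl⟩, fun v => ?_⟩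
    -- With `φ = i` the expression to be differentiated is the current rate, affine in the voltage
    -- with linear part the lower right block of `R`. Its positivity is `hpos` applied to `ξ = R (0,
    -- w)`.
    let Dv : (κ → ℝ) →L[ℝ] (κ → ℝ) := (ContinuousLinearMap.snd ℝ (ι → ℝ) (κ → ℝ)).comp
      ((R (x, i)).comp (ContinuousLinearMap.inr ℝ (ι → ℝ) (κ → ℝ)))
    refine ⟨Dv, ?_, fun w hw => hpos (x, i) _ w (hLR _ _) hw⟩
    have hc : HasFDerivAt (fun v' : κ → ℝ => (R (x, i) (r (x, i))).2 + Dv v') Dv v :=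
      Dv.hasFDerivAt.const_add _
    refine hc.congr_of_eventuallyEq (Eventually.of_forall fun v' => ?_)
    simp only [hid, ContinuousLinearMap.inverse_id, fderiv_fun_const, deriv_const', map_add]
    simp [Dv]

/-- Concatenation of coefficient vectors as a continuous linear map. -/
noncomputable def sumElimCLM (ι κ : Type*) [Fintype ι] [Fintype κ] :
    ((ι → ℝ) × (κ → ℝ)) →L[ℝ] (ι ⊕ κ → ℝ) :=
  LinearMap.toContinuousLinearMap (LinearEquiv.sumArrowLequivProdArrow ι κ ℝ ℝ).symm.toLinearMap

@[simp] theorem sumElimCLM_apply (p : (ι → ℝ) × (κ → ℝ)) :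
    sumElimCLM ι κ p = Sum.elim p.1 p.2 := rfl

/-- Splitting of a coefficient vector as a continuous linear map. -/
noncomputable def sumSplitCLM (ι κ : Type*) [Fintype ι] [Fintype κ] :
    (ι ⊕ κ → ℝ) →L[ℝ] ((ι → ℝ) × (κ → ℝ)) :=
  LinearMap.toContinuousLinearMap (LinearEquiv.sumArrowLequivProdArrow ι κ ℝ ℝ).toLinearMap

theorem sumElim_eq_zero_iff {f : ι → ℝ} {g : κ → ℝ} :
    (Sum.elim f g : ι ⊕ κ → ℝ) = 0 ↔ f = 0 ∧ g = 0 := by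
  refine ⟨fun h => ⟨funext fun a => congrFun h (Sum.inl a), funext fun b => congrFun h (Sum.inr b)⟩,
    ?_⟩
  rintro ⟨rfl, rfl⟩
  exact Sum.elim_zero_zero

theorem sumElim_add {f f' : ι → ℝ} {g g' : κ → ℝ} :
    (Sum.elim f g + Sum.elim f' g' : ι ⊕ κ → ℝ) = Sum.elim (f + f') (g + g') := by
  ext (a | b) <;> rfl

/-- The coefficient matrix of the voltage in both formulations. -/
noncomputable def voltageMatrix (ι κ : Type*) : Matrix (ι ⊕ κ) κ ℝ :=
  fromRows 0 (@diagonal κ ℝ (Classical.decEq κ) _ fun _ => -1)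

theorem voltageMatrix_mulVec (v : κ → ℝ) :
    voltageMatrix ι κ *ᵥ v = Sum.elim (0 : ι → ℝ) (-v) := by
  rw [voltageMatrix, fromRows_mulVec, zero_mulVec]
  congr 1
  ext k
  let := Classical.decEq κ
  rw [mulVec_diagonal, neg_one_mul, Pi.neg_apply]

/-- For a symmetric matrix there is a projection onto the kernel along the range. -/
theorem exists_projection_ker {n : Type*} [Fintype n] {M : Matrix n n ℝ} (hM : Mᵀ = M) :
    ∃ Q : (n → ℝ) →ₗ[ℝ] (n → ℝ), (∀ x, M *ᵥ x = 0 → Q x = x) ∧ (∀ x, Q (M *ᵥ x) = 0) ∧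
      ∀ x, ∃ z, x - Q x = M *ᵥ z := by
  have hdisj : Disjoint (LinearMap.ker M.mulVecLin) (LinearMap.range M.mulVecLin) := by
    rw [Submodule.disjoint_def]
    rintro _ h ⟨x, rfl⟩
    have h : M *ᵥ (M *ᵥ x) = 0 := h
    have h2 : (M *ᵥ x) ⬝ᵥ (M *ᵥ x) = 0 := by
      rw [dotProduct_mulVec_eq, hM, h, zero_dotProduct]
    exact dotProduct_self_eq_zero.1 h2
  have hc : IsCompl (LinearMap.ker M.mulVecLin) (LinearMap.range M.mulVecLin) := by
    refine ⟨hdisj, codisjoint_iff.2 (Submodule.eq_top_of_disjoint _ _ ?_ hdisj)⟩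
    have := LinearMap.finrank_range_add_finrank_ker M.mulVecLin
    omega
  refine ⟨Submodule.projection _ _ hc, fun x hx => ?_, fun x => ?_, fun x => ?_⟩
  · exact Submodule.projection_apply_left hc ⟨x, hx⟩
  · exact Submodule.projection_apply_right hc ⟨M *ᵥ x, ⟨x, rfl⟩⟩
  · have := Submodule.projection_add_projection_eq_self hc x
    obtain ⟨z, hz⟩ := Submodule.projection_apply_mem hc.symm x
    exact ⟨z, (sub_eq_of_eq_add' this.symm).trans hz.symm⟩

end Element

namespace Discretisation

variable {Nn Ed Fa Rd κ : Type*} [Fintype Nn] [Fintype Ed] [Fintype Fa] [Fintype Rd] [Fintype κ]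
variable (D : Discretisation Nn Ed Fa) {mat : Material D.Ω D.Ωc}

/-! ### Properties of the material matrices -/

theorem continuous_Mmud : Continuous (D.Mmud mat) := by
  obtain ⟨lo, hi, -, hf⟩ := mat.exists_isCurveFamily D.isOpen.measurableSet
  exact hf.continuous_diffMatMatrix D.memLp_edge

theorem Mmud_pos (h : Ed → ℝ) {d : Ed → ℝ} (hd : d ≠ 0) : 0 < d ⬝ᵥ (D.Mmud mat h *ᵥ d) := by
  obtain ⟨lo, hi, -, hf⟩ := mat.exists_isCurveFamily D.isOpen.measurableSet
  exact hf.diffMatMatrix_pos D.memLp_edge D.indep_edge h hd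

theorem hasFDerivAt_Mmu (h : Ed → ℝ) :
    HasFDerivAt (fun h => D.Mmu mat h *ᵥ h) (mulVecCLM (D.Mmud mat h)) h := by
  obtain ⟨lo, hi, -, hf⟩ := mat.exists_isCurveFamily D.isOpen.measurableSet
  exact hf.hasFDerivAt_matMatrix D.memLp_edge h

/-- The differential reluctivity matrix `M_{ν,d}(b)`. -/
noncomputable def Mnud (mat : Material D.Ω D.Ωc) : (Fa → ℝ) → Matrix Fa Fa ℝ :=
  diffMatMatrix D.Ω D.face mat.nu

theorem continuous_Mnud : Continuous (D.Mnud mat) := by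
  obtain ⟨lo, hi, hhi, hf⟩ := mat.exists_isCurveFamily D.isOpen.measurableSet
  exact (hf.invFunOn hhi).continuous_diffMatMatrix D.memLp_face

theorem Mnud_pos (b : Fa → ℝ) {d : Fa → ℝ} (hd : d ≠ 0) : 0 < d ⬝ᵥ (D.Mnud mat b *ᵥ d) := by
  obtain ⟨lo, hi, hhi, hf⟩ := mat.exists_isCurveFamily D.isOpen.measurableSet
  exact (hf.invFunOn hhi).diffMatMatrix_pos D.memLp_face D.indep_face b hd

theorem hasFDerivAt_Mnu (b : Fa → ℝ) :
    HasFDerivAt (fun b => D.Mnu mat b *ᵥ b) (mulVecCLM (D.Mnud mat b)) b := by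
  obtain ⟨lo, hi, hhi, hf⟩ := mat.exists_isCurveFamily D.isOpen.measurableSet
  exact (hf.invFunOn hhi).hasFDerivAt_matMatrix D.memLp_face b

theorem Msigma_transpose : (D.Msigma mat)ᵀ = D.Msigma mat := by
  ext i j
  simp only [transpose_apply, Msigma, linMatrix, real_inner_comm]

end Discretisation

namespace Discretisation

variable {Nn Ed Fa Rd κ : Type*} [Fintype Nn] [Fintype Ed] [Fintype Fa] [Fintype Rd] [Fintype κ]
variable (D : Discretisation Nn Ed Fa) {mat : Material D.Ω D.Ωc}

/-! ### The T-Ω formulation -/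

section TOmega

variable (P : Matrix Ed Rd ℝ) (Y : Matrix Ed κ ℝ)

/-- The magnetic field coefficients `h = P t + Sᵀ Ψ + Y i`. -/
noncomputable def tOmegaField : ((Rd ⊕ Nn → ℝ) × (κ → ℝ)) →L[ℝ] (Ed → ℝ) :=
  (mulVecCLM P).comp ((ContinuousLinearMap.fst ℝ _ _).comp
      ((sumSplitCLM Rd Nn).comp (ContinuousLinearMap.fst ℝ _ _))) +
    (mulVecCLM D.Sᵀ).comp ((ContinuousLinearMap.snd ℝ _ _).comp
      ((sumSplitCLM Rd Nn).comp (ContinuousLinearMap.fst ℝ _ _))) +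
    (mulVecCLM Y).comp (ContinuousLinearMap.snd ℝ _ _)

theorem tOmegaField_apply (s : (Rd ⊕ Nn → ℝ) × (κ → ℝ)) : D.tOmegaField P Y s =
    P *ᵥ (s.1 ∘ Sum.inl) + D.Sᵀ *ᵥ (s.1 ∘ Sum.inr) + Y *ᵥ s.2 := rfl

theorem tOmegaField_dotProduct (s : (Rd ⊕ Nn → ℝ) × (κ → ℝ)) (a : Ed → ℝ) :
    D.tOmegaField P Y s ⬝ᵥ a = (s.1 ∘ Sum.inl) ⬝ᵥ (Pᵀ *ᵥ a) + (s.1 ∘ Sum.inr) ⬝ᵥ (D.S *ᵥ a) +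
      s.2 ⬝ᵥ (Yᵀ *ᵥ a) := by
  rw [tOmegaField_apply, add_dotProduct, add_dotProduct, dotProduct_mulVec_eq Pᵀ,
    dotProduct_mulVec_eq D.S, dotProduct_mulVec_eq Yᵀ, transpose_transpose, transpose_transpose]

variable {P Y}

/-- The curl annihilates the gradient part. The source condition then excludes currents, regularity
of `K_ρ` gives `t = 0`, and injectivity of the discrete gradient gives `Ψ = 0`. -/
theorem tOmegaField_injective [DecidableEq Rd] (hg : D.TOmegaGauge mat P Y)
    {s : (Rd ⊕ Nn → ℝ) × (κ → ℝ)} (hs : D.tOmegaField P Y s = 0) : s = 0 := by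
  rw [tOmegaField_apply] at hs
  have hC : D.C *ᵥ (P *ᵥ (s.1 ∘ Sum.inl)) + D.C *ᵥ (Y *ᵥ s.2) = 0 := by
    have := congrArg (fun a => D.C *ᵥ a) hs
    simp only [mulVec_add, mulVec_zero, mulVec_mulVec, D.curl_mul_grad, zero_mulVec,
      add_zero] at this
    simpa only [mulVec_mulVec] using this
  have hi : s.2 = 0 := by
    by_contra h
    obtain ⟨h1, h2⟩ := hg.curl_source _ h
    by_cases ht : s.1 ∘ Sum.inl = 0
    · rw [ht, mulVec_zero, mulVec_zero, zero_add] at hC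
      exact h1 hC
    · refine h2 (-(s.1 ∘ Sum.inl)) (neg_ne_zero.2 ht) ?_
      rw [mulVec_neg, mulVec_neg]
      exact eq_neg_of_add_eq_zero_right hC
  have ht : s.1 ∘ Sum.inl = 0 := by
    rw [hi, mulVec_zero, mulVec_zero, add_zero] at hC
    refine eq_zero_of_mulVec_eq_zero hg.regular ?_
    simp only [← mulVec_mulVec, hC, mulVec_zero]
  have hΨ : s.1 ∘ Sum.inr = 0 := D.grad_injective _ (by
    simpa only [hi, ht, mulVec_zero, zero_add, add_zero] using hs)
  refine Prod.ext ?_ hi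
  rw [← Sum.elim_comp_inl_inr s.1, ht, hΨ]
  exact Sum.elim_zero_zero

/-- The magnetic energy of a change of the field is carried by the currents if the first two
equations of the T-Ω system are homogeneous. -/
theorem tOmega_passive [DecidableEq Rd] (hg : D.TOmegaGauge mat P Y) (h : Ed → ℝ)
    {s : (Rd ⊕ Nn → ℝ) × (κ → ℝ)} (hP : Pᵀ *ᵥ (D.Mmud mat h *ᵥ D.tOmegaField P Y s) = 0)
    (hS : D.S *ᵥ (D.Mmud mat h *ᵥ D.tOmegaField P Y s) = 0) (hs : s ≠ 0) :
    0 < s.2 ⬝ᵥ (Yᵀ *ᵥ (D.Mmud mat h *ᵥ D.tOmegaField P Y s)) := by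
  have h1 := D.Mmud_pos (mat := mat) h fun h0 => hs (D.tOmegaField_injective hg h0)
  rwa [tOmegaField_dotProduct, hP, hS, dotProduct_zero, dotProduct_zero, zero_add,
    zero_add] at h1

variable (mat P Y) in
/-- The system matrix `Gᵀ M_{μ,d}(h) G`, `G = (P Sᵀ Y)`, of the T-Ω system after one
differentiation. -/
noncomputable def tOmegaSystem (h : Ed → ℝ) :
    ((Rd ⊕ Nn → ℝ) × (κ → ℝ)) →L[ℝ] ((Rd ⊕ Nn → ℝ) × (κ → ℝ)) :=
  (((sumElimCLM Rd Nn).comp ((mulVecCLM Pᵀ).prod (mulVecCLM D.S))).prod (mulVecCLM Yᵀ)).comp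
    ((mulVecCLM (D.Mmud mat h)).comp (D.tOmegaField P Y))

theorem tOmegaSystem_apply (h : Ed → ℝ) (s : (Rd ⊕ Nn → ℝ) × (κ → ℝ)) :
    D.tOmegaSystem mat P Y h s =
      (Sum.elim (Pᵀ *ᵥ (D.Mmud mat h *ᵥ D.tOmegaField P Y s))
        (D.S *ᵥ (D.Mmud mat h *ᵥ D.tOmegaField P Y s)),
        Yᵀ *ᵥ (D.Mmud mat h *ᵥ D.tOmegaField P Y s)) := rfl

theorem tOmegaSystem_injective [DecidableEq Rd] (hg : D.TOmegaGauge mat P Y) (h : Ed → ℝ)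
    {s : (Rd ⊕ Nn → ℝ) × (κ → ℝ)} (hs : D.tOmegaSystem mat P Y h s = 0) : s = 0 := by
  rw [tOmegaSystem_apply, Prod.mk_eq_zero, sumElim_eq_zero_iff] at hs
  by_contra h0
  have := D.tOmega_passive hg h hs.1.1 hs.1.2 h0
  rw [hs.2, dotProduct_zero] at this
  exact this.false

variable (P Y) in
theorem tOmega_eq (x' x : Rd ⊕ Nn → ℝ) (i' i v : κ → ℝ) (t : ℝ) :
    D.tOmega mat P Y x' i' x i v t = sumElimCLM _ _ (sumElimCLM _ _
      ((Pᵀ * D.Cᵀ * D.Mrho mat * D.C * P) *ᵥ (x ∘ Sum.inl) +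
        Pᵀ *ᵥ (D.Mmud mat (D.tOmegaField P Y (x, i)) *ᵥ D.tOmegaField P Y (x', i')),
       D.S *ᵥ (D.Mmu mat (D.tOmegaField P Y (x, i)) *ᵥ D.tOmegaField P Y (x, i))),
       Yᵀ *ᵥ (D.Mmud mat (D.tOmegaField P Y (x, i)) *ᵥ D.tOmegaField P Y (x', i')) - v) := rfl

theorem tOmega_voltage (x' x : Rd ⊕ Nn → ℝ) (i' i v : κ → ℝ) (t : ℝ) :
    D.tOmega mat P Y x' i' x i v t =
      D.tOmega mat P Y x' i' x i 0 t + voltageMatrix (Rd ⊕ Nn) κ *ᵥ v := by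
  simp only [voltageMatrix_mulVec, tOmega_eq, sumElimCLM_apply, sumElim_add, add_zero,
    sub_eq_add_neg, neg_zero]

theorem differentiable_Mmud_mulVec (hs : ∀ i j, ContDiff ℝ 1 (fun h => D.Mmud mat h i j)) :
    Differentiable ℝ (fun p : (Ed → ℝ) × (Ed → ℝ) => D.Mmud mat p.1 *ᵥ p.2) := by
  refine differentiable_pi.2 fun i => ?_
  simp only [mulVec, dotProduct]
  have h : ∀ i j, Differentiable ℝ (fun h => D.Mmud mat h i j) := fun i j =>
    (hs i j).differentiable one_ne_zero
  fun_prop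

theorem differentiable_tOmega [DecidableEq Rd] (hg : D.TOmegaGauge mat P Y) :
    Differentiable ℝ (fun p : (Rd ⊕ Nn → ℝ) × (κ → ℝ) × (Rd ⊕ Nn → ℝ) × (κ → ℝ) × (κ → ℝ) × ℝ =>
      D.tOmega mat P Y p.1 p.2.1 p.2.2.1 p.2.2.2.1 p.2.2.2.2.1 p.2.2.2.2.2) := by
  have h1 : Differentiable ℝ (fun p : (Rd ⊕ Nn → ℝ) × (κ → ℝ) × (Rd ⊕ Nn → ℝ) × (κ → ℝ) ×
      (κ → ℝ) × ℝ => D.Mmud mat (D.tOmegaField P Y (p.2.2.1, p.2.2.2.1)) *ᵥ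
        D.tOmegaField P Y (p.1, p.2.1)) :=
    (D.differentiable_Mmud_mulVec hg.smooth).comp (f := fun p : (Rd ⊕ Nn → ℝ) × (κ → ℝ) ×
      (Rd ⊕ Nn → ℝ) × (κ → ℝ) × (κ → ℝ) × ℝ => (D.tOmegaField P Y (p.2.2.1, p.2.2.2.1),
        D.tOmegaField P Y (p.1, p.2.1))) (by fun_prop)
  have h2 : Differentiable ℝ (fun p : (Rd ⊕ Nn → ℝ) × (κ → ℝ) × (Rd ⊕ Nn → ℝ) × (κ → ℝ) ×
      (κ → ℝ) × ℝ => D.Mmu mat (D.tOmegaField P Y (p.2.2.1, p.2.2.2.1)) *ᵥ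
        D.tOmegaField P Y (p.2.2.1, p.2.2.2.1)) := by
    have : Differentiable ℝ (fun h => D.Mmu mat h *ᵥ h) := fun h =>
      (D.hasFDerivAt_Mmu h).differentiableAt
    exact this.comp (f := fun p : (Rd ⊕ Nn → ℝ) × (κ → ℝ) ×
      (Rd ⊕ Nn → ℝ) × (κ → ℝ) × (κ → ℝ) × ℝ => D.tOmegaField P Y (p.2.2.1, p.2.2.2.1))
      (by fun_prop)
  have h3 : Differentiable ℝ (fun p : (Rd ⊕ Nn → ℝ) × (κ → ℝ) × (Rd ⊕ Nn → ℝ) × (κ → ℝ) ×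
      (κ → ℝ) × ℝ => p.2.2.1 ∘ (Sum.inl : Rd → Rd ⊕ Nn)) := by
    refine differentiable_pi.2 fun i => ?_
    simp only [Function.comp]
    fun_prop
  simp only [tOmega_eq]
  fun_prop

theorem isInductanceLike_tOmega [DecidableEq Rd] (hg : D.TOmegaGauge mat P Y) (I : Set ℝ) :
    IsInductanceLike I (D.tOmega mat P Y) := by
  refine isInductanceLike_of_linearSystem (D.differentiable_tOmega hg)
    (fun s => D.tOmegaSystem mat P Y (D.tOmegaField P Y s))
    (fun s => (Sum.elim (-((Pᵀ * D.Cᵀ * D.Mrho mat * D.C * P) *ᵥ (s.1 ∘ Sum.inl))) 0, 0))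
    (fun ξ => ?_) ?_ (fun s ξ => D.tOmegaSystem_injective hg _) (fun s ξ u hu hu0 => ?_) ?_
  · have hM : Continuous fun s : (Rd ⊕ Nn → ℝ) × (κ → ℝ) =>
        D.Mmud mat (D.tOmegaField P Y s) *ᵥ D.tOmegaField P Y ξ :=
      (D.continuous_Mmud.comp (D.tOmegaField P Y).continuous).matrix_mulVec continuous_const
    exact ((((sumElimCLM Rd Nn).comp ((mulVecCLM Pᵀ).prod (mulVecCLM D.S))).prod
      (mulVecCLM Yᵀ)).continuous).comp hM
  · refine Continuous.prodMk ?_ continuous_const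
    refine (sumElimCLM Rd Nn).continuous.comp (Continuous.prodMk ?_ continuous_const)
    refine ((mulVecCLM _).continuous.comp ?_).neg
    exact continuous_pi fun j => (continuous_apply (Sum.inl j)).comp continuous_fst
  · have hu : D.tOmegaSystem mat P Y (D.tOmegaField P Y s) ξ = (0, u) := hu
    have hξ : ξ ≠ 0 := by
      rintro rfl
      rw [map_zero] at hu
      exact hu0 (congrArg Prod.snd hu).symm
    rw [tOmegaSystem_apply, Prod.mk.injEq, sumElim_eq_zero_iff] at hu
    have := D.tOmega_passive hg _ hu.1.1 hu.1.2 hξ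
    rwa [hu.2, dotProduct_comm] at this
  · intro x i v hx hi _ t _ h0 h1
    have hx' := ((hx.differentiable two_ne_zero) t).hasDerivAt
    have hi' := ((hi.differentiable two_ne_zero) t).hasDerivAt
    have hs : HasDerivAt (fun τ => D.tOmegaField P Y (x τ, i τ))
        (D.tOmegaField P Y (deriv x t, deriv i t)) t :=
      (D.tOmegaField P Y).hasFDerivAt.comp_hasDerivAt t (hx'.prodMk hi')
    -- The divergence block is differentiated along the trajectory in two ways: by the chain rule,
    -- with `M_{μ,d}` the derivative of `M_μ(h) h`, and as a block of `(d/dt) F = 0`. Uniqueness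
    -- yields `S M_{μ,d}(h) h' = 0`.
    have hS1 := (mulVecCLM D.S).hasFDerivAt.comp_hasDerivAt t
      ((D.hasFDerivAt_Mmu (mat := mat) _).comp_hasDerivAt t hs)
    have hS2 := (((ContinuousLinearMap.snd ℝ _ _).comp (sumSplitCLM Rd Nn)).comp
      ((ContinuousLinearMap.fst ℝ _ _).comp
        (sumSplitCLM (Rd ⊕ Nn) κ))).hasFDerivAt.comp_hasDerivAt t h1
    have hS := hS1.unique hS2
    rw [map_zero] at hS
    rw [tOmega_eq] at h0
    simp only [sumElimCLM_apply, sumElim_eq_zero_iff] at h0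
    obtain ⟨⟨h01, -⟩, h03⟩ := h0
    change D.tOmegaSystem mat P Y _ _ = _
    rw [tOmegaSystem_apply, Prod.mk_add_mk, add_zero, zero_add, eq_of_sub_eq_zero h03,
      eq_neg_of_add_eq_zero_right h01]
    congr 2

theorem hasLinearIndexTwoComponents_tOmega [DecidableEq Rd] (hg : D.TOmegaGauge mat P Y)
    {Nd Cap Res Ind Vol Cur : Type*} [Fintype Nd] [DecidableEq Nd] [Fintype Cap]
    [Fintype Res] [Fintype Ind] [Fintype Vol] [Fintype Cur] {I : Set ℝ}
    (ckt : Circuit Nd Cap Res Ind Vol Cur κ) (hw : ckt.WellPosed I) :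
    HasLinearIndexTwoComponents I (coupledDAE ckt (D.tOmega mat P Y)) := by
  refine hasLinearIndexTwoComponents_coupledDAE ckt hw (D.differentiable_tOmega hg)
    (fun x' i' x i v t => D.tOmega_voltage x' x i' i v t) fun y z v t _ => ?_
  set h := D.tOmegaField P Y z with hh
  set G := D.tOmegaField P Y with hG
  have hN : Differentiable ℝ (fun s => D.Mmud mat (G s) *ᵥ G y) :=
    (D.differentiable_Mmud_mulVec hg.smooth).comp (f := fun s => (G s, G y)) (by fun_prop)
  -- The derivative of `M_{μ,d}(h) h'` in the state needs no formula: it appears only in the first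
  -- and third equations, while the arguments below use the second.
  set N := fderiv ℝ (fun s => D.Mmud mat (G s) *ᵥ G y) z with hNdef
  let πl : ((Rd ⊕ Nn → ℝ) × (κ → ℝ)) →L[ℝ] (Rd → ℝ) := (ContinuousLinearMap.fst ℝ _ _).comp
    ((sumSplitCLM Rd Nn).comp (ContinuousLinearMap.fst ℝ _ _))
  have hd1 := (((mulVecCLM Pᵀ).comp ((mulVecCLM (D.Mmud mat h)).comp G)).hasFDerivAt
    (x := y)).const_add ((Pᵀ * D.Cᵀ * D.Mrho mat * D.C * P) *ᵥ (z.1 ∘ Sum.inl))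
  have hd2 := hasFDerivAt_const (𝕜 := ℝ) (D.S *ᵥ (D.Mmu mat h *ᵥ h)) y
  have hd3 := (((mulVecCLM Yᵀ).comp ((mulVecCLM (D.Mmud mat h)).comp G)).hasFDerivAt
    (x := y)).sub_const v
  have hA := (sumElimCLM _ _).hasFDerivAt.comp y
    (((sumElimCLM _ _).hasFDerivAt.comp y (hd1.prodMk hd2)).prodMk hd3)
  have k1 := (((mulVecCLM (Pᵀ * D.Cᵀ * D.Mrho mat * D.C * P)).comp πl).hasFDerivAt (x := z)).add
    ((mulVecCLM Pᵀ).hasFDerivAt.comp z (hN z).hasFDerivAt)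
  have k2 := (mulVecCLM D.S).hasFDerivAt.comp z
    (HasFDerivAt.comp (f := G) z (D.hasFDerivAt_Mmu (mat := mat) (G z)) G.hasFDerivAt)
  have k3 := ((mulVecCLM Yᵀ).hasFDerivAt.comp z (hN z).hasFDerivAt).sub_const v
  have hB := (sumElimCLM _ _).hasFDerivAt.comp z
    (((sumElimCLM _ _).hasFDerivAt.comp z (k1.prodMk k2)).prodMk k3)
  refine ⟨_, _, hA, hB, ?_⟩
  -- The divergence row contains neither derivatives nor voltages, so in the second equation of the
  -- pencil it yields the homogeneous condition that `tOmega_passive` requires.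
  have key : ∀ ξ ζ u,
      Sum.elim (Sum.elim ((Pᵀ * D.Cᵀ * D.Mrho mat * D.C * P) *ᵥ (ξ.1 ∘ Sum.inl) + Pᵀ *ᵥ N ξ)
        (D.S *ᵥ (D.Mmud mat h *ᵥ G ξ))) (Yᵀ *ᵥ N ξ) + voltageMatrix (Rd ⊕ Nn) κ *ᵥ u =
      Sum.elim (Sum.elim (Pᵀ *ᵥ (D.Mmud mat h *ᵥ G ζ)) 0) (Yᵀ *ᵥ (D.Mmud mat h *ᵥ G ζ)) →
      D.S *ᵥ (D.Mmud mat h *ᵥ G ξ) = 0 := by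
    intro ξ ζ u hu
    rw [voltageMatrix_mulVec, sumElim_add] at hu
    ext j
    have := congrFun hu (Sum.inl (Sum.inr j))
    simpa using this
  constructor
  · intro ξ ζ u h1 h2
    have h1 : (Sum.elim (Sum.elim (Pᵀ *ᵥ (D.Mmud mat h *ᵥ G ξ)) 0)
      (Yᵀ *ᵥ (D.Mmud mat h *ᵥ G ξ)) : (Rd ⊕ Nn) ⊕ κ → ℝ) = 0 := h1
    rw [sumElim_eq_zero_iff, sumElim_eq_zero_iff] at h1
    by_contra h0
    have := D.tOmega_passive hg h h1.1.1 (key ξ ζ u h2) h0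
    rw [h1.2, dotProduct_zero] at this
    exact this.false
  · intro u
    have hsurj : Function.Surjective (D.tOmegaSystem mat P Y h).toLinearMap :=
      LinearMap.surjective_of_injective (LinearMap.ker_eq_bot.1
        (LinearMap.ker_eq_bot'.2 fun ξ => D.tOmegaSystem_injective hg h))
    obtain ⟨ζ, hζ⟩ := hsurj (0, -u)
    have hζ : D.tOmegaSystem mat P Y h ζ = (0, -u) := hζ
    rw [tOmegaSystem_apply, Prod.mk.injEq, sumElim_eq_zero_iff] at hζ
    refine ⟨ζ, ?_⟩
    change _ = (Sum.elim (Sum.elim (Pᵀ *ᵥ (D.Mmud mat h *ᵥ G ζ)) 0)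
      (Yᵀ *ᵥ (D.Mmud mat h *ᵥ G ζ)) : (Rd ⊕ Nn) ⊕ κ → ℝ)
    rw [voltageMatrix_mulVec, hζ.1.1, hζ.2, Sum.elim_zero_zero]
  · intro ξ ζ u u' h1 h2 hu
    have h1 : (Sum.elim (Sum.elim (Pᵀ *ᵥ (D.Mmud mat h *ᵥ G ξ)) 0)
      (Yᵀ *ᵥ (D.Mmud mat h *ᵥ G ξ)) : (Rd ⊕ Nn) ⊕ κ → ℝ) +
        voltageMatrix (Rd ⊕ Nn) κ *ᵥ u = 0 := h1
    rw [voltageMatrix_mulVec, sumElim_add, add_zero, sumElim_eq_zero_iff,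
      sumElim_eq_zero_iff] at h1
    have hYu : Yᵀ *ᵥ (D.Mmud mat h *ᵥ G ξ) = u := by
      rw [← sub_eq_zero, sub_eq_add_neg]; exact h1.2
    have hξ : ξ ≠ 0 := by
      rintro rfl
      rw [map_zero, mulVec_zero, mulVec_zero] at hYu
      exact hu hYu.symm
    have := D.tOmega_passive hg h h1.1.1 (key ξ ζ u' h2) hξ
    rwa [hYu, dotProduct_comm] at this

end TOmega

end Discretisation

namespace Discretisation

variable {Nn Ed Fa Rd κ : Type*} [Fintype Nn] [Fintype Ed] [Fintype Fa] [Fintype Rd] [Fintype κ]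
variable (D : Discretisation Nn Ed Fa) {mat : Material D.Ω D.Ωc}

/-! ### The A* formulation -/

section AStar

variable (P : Matrix Ed Rd ℝ) (χ : κ → R3 → R3)

/-- The flux coefficients `b = C P a`. -/
noncomputable def aStarFlux : (Rd → ℝ) →L[ℝ] (Fa → ℝ) := (mulVecCLM D.C).comp (mulVecCLM P)

variable (mat) in
/-- The derivative `Pᵀ Cᵀ M_{ν,d}(b) C P` of the magnetic term of the A* system. -/
noncomputable def aStarStiffness (a : Rd → ℝ) : (Rd → ℝ) →L[ℝ] (Rd → ℝ) :=
  (mulVecCLM (Pᵀ * D.Cᵀ)).comp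
    ((mulVecCLM (D.Mnud mat (D.aStarFlux P a))).comp (D.aStarFlux P))

theorem hasFDerivAt_aStar_magnetic (a : Rd → ℝ) :
    HasFDerivAt (fun a => (Pᵀ * D.Cᵀ) *ᵥ
      (D.Mnu mat (D.aStarFlux P a) *ᵥ D.aStarFlux P a)) (D.aStarStiffness mat P a) a :=
  (mulVecCLM (Pᵀ * D.Cᵀ)).hasFDerivAt.comp a
    (HasFDerivAt.comp (f := D.aStarFlux P) a (D.hasFDerivAt_Mnu (mat := mat) (D.aStarFlux P a))
      (D.aStarFlux P).hasFDerivAt)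

theorem dotProduct_aStarStiffness (a x y : Rd → ℝ) : x ⬝ᵥ D.aStarStiffness mat P a y =
    D.aStarFlux P x ⬝ᵥ (D.Mnud mat (D.aStarFlux P a) *ᵥ D.aStarFlux P y) := by
  change x ⬝ᵥ ((Pᵀ * D.Cᵀ) *ᵥ _) = _
  rw [dotProduct_mulVec_eq, transpose_mul, transpose_transpose, transpose_transpose,
    ← mulVec_mulVec]
  rfl

variable (mat) in
/-- The reduced conductivity matrix `Pᵀ M_σ P`. -/
noncomputable def aStarConductivity : Matrix Rd Rd ℝ := Pᵀ * D.Msigma mat * P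

variable (mat) in
theorem aStarConductivity_transpose :
    (D.aStarConductivity mat P)ᵀ = D.aStarConductivity mat P := by
  simp only [aStarConductivity, transpose_mul, transpose_transpose, Msigma_transpose,
    Matrix.mul_assoc]

theorem aStar_eq (a' a : Rd → ℝ) (i' i v : κ → ℝ) (t : ℝ) :
    D.aStar mat P χ a' i' a i v t = sumElimCLM Rd κ
      (D.aStarConductivity mat P *ᵥ a' + (Pᵀ * D.Cᵀ) *ᵥ
        (D.Mnu mat (D.aStarFlux P a) *ᵥ D.aStarFlux P a) - (Pᵀ * D.Xs χ) *ᵥ i,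
       (Pᵀ * D.Xs χ)ᵀ *ᵥ a' - v) := rfl

theorem aStar_voltage (a' a : Rd → ℝ) (i' i v : κ → ℝ) (t : ℝ) :
    D.aStar mat P χ a' i' a i v t =
      D.aStar mat P χ a' i' a i 0 t + voltageMatrix Rd κ *ᵥ v := by
  simp only [voltageMatrix_mulVec, aStar_eq, sumElimCLM_apply, sumElim_add, add_zero,
    sub_eq_add_neg, neg_zero]

theorem differentiable_aStar :
    Differentiable ℝ (fun p : (Rd → ℝ) × (κ → ℝ) × (Rd → ℝ) × (κ → ℝ) × (κ → ℝ) × ℝ =>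
      D.aStar mat P χ p.1 p.2.1 p.2.2.1 p.2.2.2.1 p.2.2.2.2.1 p.2.2.2.2.2) := by
  have h1 : Differentiable ℝ (fun p : (Rd → ℝ) × (κ → ℝ) × (Rd → ℝ) × (κ → ℝ) × (κ → ℝ) × ℝ =>
      (Pᵀ * D.Cᵀ) *ᵥ (D.Mnu mat (D.aStarFlux P p.2.2.1) *ᵥ D.aStarFlux P p.2.2.1)) := by
    have : Differentiable ℝ (fun a => (Pᵀ * D.Cᵀ) *ᵥ
        (D.Mnu mat (D.aStarFlux P a) *ᵥ D.aStarFlux P a)) := fun a =>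
      (D.hasFDerivAt_aStar_magnetic P a).differentiableAt
    exact this.comp (f := fun p : (Rd → ℝ) × (κ → ℝ) × (Rd → ℝ) × (κ → ℝ) × (κ → ℝ) × ℝ =>
      p.2.2.1) (by fun_prop)
  simp only [aStar_eq]
  fun_prop

variable {P χ}

/-- By symmetry of the conductivity matrix, orthogonality to its range means membership in its
kernel; hence projection onto the kernel keeps the source term intact. -/
theorem AStarGauge.conductivity_mulVec_source {D : Discretisation Nn Ed Fa}
    {mat : Material D.Ω D.Ωc} (hg : D.AStarGauge mat P χ) (i : κ → ℝ) :
    D.aStarConductivity mat P *ᵥ ((Pᵀ * D.Xs χ) *ᵥ i) = 0 := by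
  refine dotProduct_eq_zero _ fun a => ?_
  rw [← D.aStarConductivity_transpose mat P, ← dotProduct_mulVec_eq]
  exact hg.orth i a

/-- The pencil assumption concerns the secant matrix `M_ν`; it is used at `λ = 1` only to show `C P
y ≠ 0` for `y` in the conductivity kernel. Definiteness of `M_{ν,d}` then gives the sign. -/
theorem aStarStiffness_pos (hg : D.AStarGauge mat P χ) (a : Rd → ℝ) {y : Rd → ℝ} (hy : y ≠ 0)
    (hM : D.aStarConductivity mat P *ᵥ y = 0) : 0 < y ⬝ᵥ D.aStarStiffness mat P a y := by
  rw [dotProduct_aStarStiffness]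
  refine D.Mnud_pos _ fun h0 => ?_
  have h := hg.pencil a 1 one_pos y hy
  have h0 : D.C *ᵥ (P *ᵥ y) = 0 := h0
  have hM : (Pᵀ * D.Msigma mat * P) *ᵥ y = 0 := hM
  rw [one_smul, add_mulVec, hM, zero_add, ← mulVec_mulVec, ← mulVec_mulVec, h0, mulVec_zero,
    dotProduct_zero] at h
  exact h.false

/-- The magnetic energy of a change of the potential is carried by the currents. -/
theorem aStar_passive (hg : D.AStarGauge mat P χ) (a : Rd → ℝ) {y z : Rd → ℝ} {j : κ → ℝ}
    (hM : D.aStarConductivity mat P *ᵥ y = 0)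
    (hK : D.aStarStiffness mat P a y = (Pᵀ * D.Xs χ) *ᵥ j + D.aStarConductivity mat P *ᵥ z)
    (hy : y ≠ 0) : 0 < ((Pᵀ * D.Xs χ)ᵀ *ᵥ y) ⬝ᵥ j := by
  have h := D.aStarStiffness_pos hg a hy hM
  rwa [hK, dotProduct_add, dotProduct_mulVec_eq (D.aStarConductivity mat P),
    D.aStarConductivity_transpose, hM, zero_dotProduct, add_zero, dotProduct_mulVec_eq] at h

/-- Full column rank makes `Xᵀ X` invertible, and the solution is sought in the range of `X`, which
lies in the conductivity kernel. -/
theorem AStarGauge.exists_source_response {D : Discretisation Nn Ed Fa}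
    {mat : Material D.Ω D.Ωc} (hg : D.AStarGauge mat P χ) (u : κ → ℝ) :
    ∃ a, D.aStarConductivity mat P *ᵥ a = 0 ∧ (Pᵀ * D.Xs χ)ᵀ *ᵥ a = u := by
  have hinj : Function.Injective
      ((Pᵀ * D.Xs χ)ᵀ.mulVecLin ∘ₗ (Pᵀ * D.Xs χ).mulVecLin) := by
    refine LinearMap.ker_eq_bot.1 (LinearMap.ker_eq_bot'.2 fun j hj => hg.rank j ?_)
    have hj : (Pᵀ * D.Xs χ)ᵀ *ᵥ ((Pᵀ * D.Xs χ) *ᵥ j) = 0 := hj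
    refine dotProduct_self_eq_zero.1 ?_
    rw [dotProduct_mulVec_eq, hj, zero_dotProduct]
  obtain ⟨j, hj⟩ := LinearMap.surjective_of_injective hinj u
  exact ⟨(Pᵀ * D.Xs χ) *ᵥ j, hg.conductivity_mulVec_source j, hj⟩

/-- With `Q` the projection onto `ker M` along `im M`, the first equation splits into `M a' + (K - Q
K) = 0` and the constraint `Q K(a) = X i`. The constraint is differentiated and added to the other
part; nothing is lost, since the two summands lie in complementary subspaces. -/
theorem isInductanceLike_aStar (hg : D.AStarGauge mat P χ) (I : Set ℝ) :
    IsInductanceLike I (D.aStar mat P χ) := by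
  obtain ⟨Q, hQ1, hQ2, hQ3⟩ := exists_projection_ker (D.aStarConductivity_transpose mat P)
  set M := D.aStarConductivity mat P with hMdef
  set X := Pᵀ * D.Xs χ with hX
  set K : (Rd → ℝ) → Rd → ℝ := fun a => (Pᵀ * D.Cᵀ) *ᵥ
        (D.Mnu mat (D.aStarFlux P a) *ᵥ D.aStarFlux P a) with hK
  have hKd : ∀ a, HasFDerivAt K (D.aStarStiffness mat P a) a :=
    D.hasFDerivAt_aStar_magnetic P
  have hMX : ∀ i, M *ᵥ (X *ᵥ i) = 0 := hg.conductivity_mulVec_source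
  have hQX : ∀ i, Q (X *ᵥ i) = X *ᵥ i := fun i => hQ1 _ (hMX i)
  have hQc : Continuous Q := LinearMap.continuous_of_finiteDimensional Q
  let L : (Rd → ℝ) × (κ → ℝ) → (Rd → ℝ) × (κ → ℝ) →ₗ[ℝ] (Rd → ℝ) × (κ → ℝ) := fun s =>
    LinearMap.prod ((M.mulVecLin + Q ∘ₗ (D.aStarStiffness mat P s.1).toLinearMap) ∘ₗ
      LinearMap.fst ℝ _ _ - X.mulVecLin ∘ₗ LinearMap.snd ℝ _ _)
      (Xᵀ.mulVecLin ∘ₗ LinearMap.fst ℝ _ _)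
  have hL : ∀ s ξ, L s ξ = (M *ᵥ ξ.1 + Q (D.aStarStiffness mat P s.1 ξ.1) - X *ᵥ ξ.2,
      Xᵀ *ᵥ ξ.1) := fun s ξ => rfl
  -- Applying `Q` recovers both parts of the combined equation: `Q` kills `im M` and fixes `X ξ.2`.
  have hsplit : ∀ s (ξ : (Rd → ℝ) × (κ → ℝ)),
      M *ᵥ ξ.1 + Q (D.aStarStiffness mat P s ξ.1) - X *ᵥ ξ.2 = 0 → M *ᵥ ξ.1 = 0 ∧
        ∃ z, D.aStarStiffness mat P s ξ.1 = X *ᵥ ξ.2 + M *ᵥ z := by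
    intro s ξ h
    have h2 := congrArg Q h
    have hQQ : Q (Q (D.aStarStiffness mat P s ξ.1)) = Q (D.aStarStiffness mat P s ξ.1) := by
      obtain ⟨z, hz⟩ := hQ3 (D.aStarStiffness mat P s ξ.1)
      have := congrArg Q hz
      rw [map_sub, hQ2, sub_eq_zero] at this
      exact this.symm
    rw [map_sub, map_add, hQ2, zero_add, hQQ, hQX, map_zero] at h2
    obtain ⟨z, hz⟩ := hQ3 (D.aStarStiffness mat P s ξ.1)
    refine ⟨?_, z, ?_⟩
    · rw [add_sub_assoc, h2, add_zero] at h
      exact h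
    · rw [← hz, ← eq_of_sub_eq_zero h2]; abel
  refine isInductanceLike_of_linearSystem (D.differentiable_aStar P χ) L
    (fun s => (-(K s.1 - Q (K s.1)), 0)) (fun ξ => ?_) ?_ (fun s ξ h => ?_)
    (fun s ξ u h hu => ?_) ?_
  · have hM : Continuous fun s : (Rd → ℝ) × (κ → ℝ) =>
        D.Mnud mat (D.aStarFlux P s.1) *ᵥ D.aStarFlux P ξ.1 :=
      (D.continuous_Mnud.comp ((D.aStarFlux P).continuous.comp continuous_fst)).matrix_mulVec
        continuous_const
    simp only [hL]
    exact ((continuous_const.add (hQc.comp ((mulVecCLM (Pᵀ * D.Cᵀ)).continuous.comp hM))).sub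
      continuous_const).prodMk continuous_const
  · have hKc : Continuous K := continuous_iff_continuousAt.2 fun a => (hKd a).continuousAt
    have h1 : Continuous fun s : (Rd → ℝ) × (κ → ℝ) => K s.1 := hKc.comp continuous_fst
    exact ((h1.sub (hQc.comp h1)).neg).prodMk continuous_const
  · rw [hL, Prod.mk_eq_zero] at h
    obtain ⟨h1, z, hz⟩ := hsplit _ _ h.1
    have hy : ξ.1 = 0 := by
      by_contra h0
      have := D.aStar_passive hg s.1 h1 hz h0
      rw [h.2, zero_dotProduct] at this
      exact this.false
    refine Prod.ext hy (hg.rank _ ?_)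
    have := h.1
    rw [hy, map_zero, map_zero, mulVec_zero, zero_add, zero_sub, neg_eq_zero] at this
    exact this
  · rw [hL, Prod.mk.injEq] at h
    obtain ⟨h1, z, hz⟩ := hsplit _ _ h.1
    have h0 : ξ.1 ≠ 0 := fun h0 => hu (by rw [← h.2, h0, mulVec_zero])
    have := D.aStar_passive hg s.1 h1 hz h0
    rwa [h.2] at this
  · intro a i v ha hi _ t _ h0 h1
    have ha' := ((ha.differentiable two_ne_zero) t).hasDerivAt
    have hi' := ((hi.differentiable two_ne_zero) t).hasDerivAt
    rw [aStar_eq, sumElimCLM_apply, sumElim_eq_zero_iff] at h0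
    obtain ⟨h01, h02⟩ := h0
    have h01 : M *ᵥ deriv a t + K (a t) - X *ᵥ i t = 0 := h01
    have hQK : Q (K (a t)) = X *ᵥ i t := by
      have := congrArg Q h01
      rw [map_sub, map_add, hQ2, zero_add, hQX, map_zero] at this
      exact eq_of_sub_eq_zero this
    -- This projected component of `F` contains no derivatives of the unknowns at all, so
    -- differentiating it involves only `a'` and `i'`.
    have hQK' : ∀ τ, Q ((sumSplitCLM Rd κ (D.aStar mat P χ (deriv a τ) (deriv i τ) (a τ) (i τ)
        (v τ) τ)).1) = Q (K (a τ)) - X *ᵥ i τ := by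
      intro τ
      change Q (M *ᵥ deriv a τ + K (a τ) - X *ᵥ i τ) = _
      rw [map_sub, map_add, hQ2, zero_add, hQX]
    have hd1 := ((LinearMap.toContinuousLinearMap Q).comp ((ContinuousLinearMap.fst ℝ _ _).comp
      (sumSplitCLM Rd κ))).hasFDerivAt.comp_hasDerivAt t h1
    rw [map_zero] at hd1
    have hd2 : HasDerivAt (fun τ => Q (K (a τ)) - X *ᵥ i τ)
        (Q (D.aStarStiffness mat P (a t) (deriv a t)) - X *ᵥ deriv i t) t :=
      ((LinearMap.toContinuousLinearMap Q).hasFDerivAt.comp_hasDerivAt t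
        ((hKd (a t)).comp_hasDerivAt t ha')).sub
        ((mulVecCLM X).hasFDerivAt.comp_hasDerivAt t hi')
    have hd := hd2.unique (hd1.congr_of_eventuallyEq
      (Eventually.of_forall fun τ => (hQK' τ).symm))
    rw [hL, Prod.mk_add_mk, add_zero, zero_add, eq_of_sub_eq_zero h02]
    congr 1
    change M *ᵥ deriv a t + Q (D.aStarStiffness mat P (a t) (deriv a t)) - X *ᵥ deriv i t = _
    rw [add_sub_assoc, hd, add_zero, hQK, eq_neg_iff_add_eq_zero, ← add_sub_assoc]
    exact h01

theorem hasLinearIndexTwoComponents_aStar (hg : D.AStarGauge mat P χ)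
    {Nd Cap Res Ind Vol Cur : Type*} [Fintype Nd] [DecidableEq Nd] [Fintype Cap]
    [Fintype Res] [Fintype Ind] [Fintype Vol] [Fintype Cur] {I : Set ℝ}
    (ckt : Circuit Nd Cap Res Ind Vol Cur κ) (hw : ckt.WellPosed I) :
    HasLinearIndexTwoComponents I (coupledDAE ckt (D.aStar mat P χ)) := by
  refine hasLinearIndexTwoComponents_coupledDAE ckt hw (D.differentiable_aStar P χ)
    (fun a' i' a i v t => D.aStar_voltage P χ a' a i' i v t) fun y z v t _ => ?_
  set M := D.aStarConductivity mat P with hMdef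
  set X := Pᵀ * D.Xs χ with hX
  have hd1 := ((((mulVecCLM M).comp (ContinuousLinearMap.fst ℝ (Rd → ℝ) (κ → ℝ))).hasFDerivAt
    (x := y)).add_const ((Pᵀ * D.Cᵀ) *ᵥ
      (D.Mnu mat (D.aStarFlux P z.1) *ᵥ D.aStarFlux P z.1))).sub_const (X *ᵥ z.2)
  have hd2 := (((mulVecCLM Xᵀ).comp (ContinuousLinearMap.fst ℝ (Rd → ℝ) (κ → ℝ))).hasFDerivAt
    (x := y)).sub_const v
  have hA := (sumElimCLM _ _).hasFDerivAt.comp y (hd1.prodMk hd2)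
  have k1 := ((HasFDerivAt.comp (f := Prod.fst) z (D.hasFDerivAt_aStar_magnetic (mat := mat) P z.1)
    hasFDerivAt_fst).const_add (M *ᵥ y.1)).sub
    (((mulVecCLM X).comp (ContinuousLinearMap.snd ℝ (Rd → ℝ) (κ → ℝ))).hasFDerivAt (x := z))
  have k2 := hasFDerivAt_const (𝕜 := ℝ) (Xᵀ *ᵥ y.1 - v) z
  have hB := (sumElimCLM _ _).hasFDerivAt.comp z (k1.prodMk k2)
  refine ⟨_, _, hA, hB, ?_⟩
  have key : ∀ (ξ ζ : (Rd → ℝ) × (κ → ℝ)) (u : κ → ℝ),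
      (Sum.elim (D.aStarStiffness mat P z.1 ξ.1 - X *ᵥ ξ.2) 0 : Rd ⊕ κ → ℝ) +
        voltageMatrix Rd κ *ᵥ u = Sum.elim (M *ᵥ ζ.1) (Xᵀ *ᵥ ζ.1) →
      D.aStarStiffness mat P z.1 ξ.1 = X *ᵥ ξ.2 + M *ᵥ ζ.1 := by
    intro ξ ζ u hu
    rw [voltageMatrix_mulVec, sumElim_add, add_zero] at hu
    have : D.aStarStiffness mat P z.1 ξ.1 - X *ᵥ ξ.2 = M *ᵥ ζ.1 :=
      funext fun r => congrFun hu (Sum.inl r)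
    rw [← this]; abel
  constructor
  · intro ξ ζ u h1 h2
    have h1 : (Sum.elim (M *ᵥ ξ.1) (Xᵀ *ᵥ ξ.1) : Rd ⊕ κ → ℝ) = 0 := h1
    rw [sumElim_eq_zero_iff] at h1
    have h3 := key ξ ζ u h2
    have hy : ξ.1 = 0 := by
      by_contra h0
      have := D.aStar_passive hg z.1 h1.1 h3 h0
      rw [h1.2, zero_dotProduct] at this
      exact this.false
    -- Once the potential vanishes, `X ξ.2` equals `-(M ζ.1)`, so it is orthogonal to itself; full
    -- column rank then removes the current.
    refine Prod.ext hy (hg.rank _ (dotProduct_self_eq_zero.1 ?_))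
    rw [hy, map_zero] at h3
    change (X *ᵥ ξ.2) ⬝ᵥ (X *ᵥ ξ.2) = 0
    have h4 : X *ᵥ ξ.2 = -(M *ᵥ ζ.1) := eq_neg_of_add_eq_zero_left h3.symm
    nth_rw 2 [h4]
    rw [dotProduct_neg, neg_eq_zero]
    exact hg.orth _ _
  · intro u
    obtain ⟨a, ha1, ha2⟩ := hg.exists_source_response (-u)
    refine ⟨(a, 0), ?_⟩
    change _ = (Sum.elim (M *ᵥ a) (Xᵀ *ᵥ a) : Rd ⊕ κ → ℝ)
    rw [voltageMatrix_mulVec, ha1, ha2]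
  · intro ξ ζ u u' h1 h2 hu
    have h1 : (Sum.elim (M *ᵥ ξ.1) (Xᵀ *ᵥ ξ.1) : Rd ⊕ κ → ℝ) +
      voltageMatrix Rd κ *ᵥ u = 0 := h1
    rw [voltageMatrix_mulVec, sumElim_add, add_zero, sumElim_eq_zero_iff] at h1
    have hXu : Xᵀ *ᵥ ξ.1 = u := by
      rw [← sub_eq_zero, sub_eq_add_neg]; exact h1.2
    have h0 : ξ.1 ≠ 0 := fun h0 => hu (by rw [← hXu, h0, mulVec_zero])
    have := D.aStar_passive hg z.1 h1.1 (key ξ ζ u' h2) h0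
    rwa [hXu] at this

end AStar

end Discretisation

end FieldCircuit

/-! ### The proposition for both formulations. -/

theorem mainTheorem7
    {Nn Ed Fa Rd₁ Rd₂ κ Nd Cap Res Ind Vol Cur : Type*}
    [Fintype Nn] [Fintype Ed] [Fintype Fa] [Fintype Rd₁] [DecidableEq Rd₁] [Fintype Rd₂]
    [Fintype κ] [Fintype Nd] [DecidableEq Nd] [Fintype Cap] [Fintype Res] [Fintype Ind]
    [Fintype Vol] [Fintype Cur]
    (t₀ t₁ : ℝ)
    (D : FieldCircuit.Discretisation Nn Ed Fa) (mat : FieldCircuit.Material D.Ω D.Ωc) :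
    (∀ (P : Matrix Ed Rd₁ ℝ) (Y : Matrix Ed κ ℝ), D.TOmegaGauge mat P Y →
      FieldCircuit.IsInductanceLike (Set.Icc t₀ t₁) (D.tOmega mat P Y) ∧
      FieldCircuit.IsVoltageLinear (D.tOmega mat P Y) ∧
      ∀ ckt : FieldCircuit.Circuit Nd Cap Res Ind Vol Cur κ, ckt.WellPosed (Set.Icc t₀ t₁) →
        FieldCircuit.HasLinearIndexTwoComponents (Set.Icc t₀ t₁)
          (FieldCircuit.coupledDAE ckt (D.tOmega mat P Y))) ∧
    (∀ (P : Matrix Ed Rd₂ ℝ) (χ : κ → FieldCircuit.R3 → FieldCircuit.R3),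
      D.AStarGauge mat P χ →
      FieldCircuit.IsInductanceLike (Set.Icc t₀ t₁) (D.aStar mat P χ) ∧
      FieldCircuit.IsVoltageLinear (D.aStar mat P χ) ∧
      ∀ ckt : FieldCircuit.Circuit Nd Cap Res Ind Vol Cur κ, ckt.WellPosed (Set.Icc t₀ t₁) →
        FieldCircuit.HasLinearIndexTwoComponents (Set.Icc t₀ t₁)
          (FieldCircuit.coupledDAE ckt (D.aStar mat P χ))) := by
  refine ⟨fun P Y hg => ⟨D.isInductanceLike_tOmega hg _, ?_, fun ckt hw =>
      D.hasLinearIndexTwoComponents_tOmega hg ckt hw⟩,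
    fun P χ hg => ⟨D.isInductanceLike_aStar hg _, ?_, fun ckt hw =>
      D.hasLinearIndexTwoComponents_aStar hg ckt hw⟩⟩
  · exact ⟨fun x' i' x i t => D.tOmega mat P Y x' i' x i 0 t, FieldCircuit.voltageMatrix _ _,
      fun x' i' x i v t => D.tOmega_voltage x' x i' i v t⟩
  · exact ⟨fun a' i' a i t => D.aStar mat P χ a' i' a i 0 t, FieldCircuit.voltageMatrix _ _,
      fun a' i' a i v t => D.aStar_voltage P χ a' a i' i v t⟩
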